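/- Let $M$ be a non-empty closed (compact, Hausdorff, without boundary) smooth manifold of dimension $n\ge 1$. Let $\widetilde J^2(M)\to M$ be the vector bundle of reduced $2$-jets of real functions ($2$-jets modulo the value of the function); in local coordinates $x$ on $M$ its elements are written $(x,y',y'')$, with $y'$ the first derivative and $y''$ the (symmetric) second derivative, and $\pi:\widetilde J^2(M)\to T^*M$, $(x,y',y'')\mapsto (x,y')$, is the natural projection. Let $\mathcal M\subset\widetilde J^2(M)$ be the open set of reduced $2$-jets of Morse functions, i.e. of the jets for which $y'\neq 0$ or $y''$ is nondegenerate, and let $\mathcal M_0^i\subset\mathcal M$ be the set of jets with $y'=0$ and $y''$ nondegenerate of index $i$; it is a proper submanifold of codimension $n$. A (continuous) section of $\mathcal M$ is holonomic if it is of the form $j^2f$ for a $C^\infty$ function $f:M\to\mathbb R$ (necessarily Morse). Homotopies are homotopies through continuous sections of $\mathcal M$. For a section $s$ of $\mathcal M$, let $\langle\mu_i,[s]\rangle\in\mathbb Z$ be the algebraic intersection number of $s$ with $\mathcal M_0^i$: deform $s$ in $\mathcal M$ to a smooth section transverse to $\mathcal M_0^i$ and count its (finitely many) intersection points $a$ with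 $\mathcal M_0^i$ with the sign $(-1)^i\,\mathrm{sign}\det\big(\partial y'_j/\partial x_k\big)(a)$; that the result does not depend on the deformation is part of the assertion whenever a value of $\langle\mu_i,[s]\rangle$ is asserted below. Then the $h$-principle does not hold true for the sections of $\mathcal M$: there is a section of $\mathcal M$ which is not homotopic to any holonomic section of $\mathcal M$. More precisely: 1. There is a smooth section $s$ of $\mathcal M$ with $\langle\mu_0,[s]\rangle=0$ such that the $1$-form $\pi\circ s$ is transverse to the zero section of $T^*M$ and such that, near each zero $a$ of $\pi\circ s$, one has $s=j^2f$ for some smooth function $f$ defined near $a$ which has at $a$ a nondegenerate critical point of index $1$ or $2$. (When $n=1$, $\pi\circ s$ has no zeros.) 2. A section $s$ of $\mathcal M$ with $\langle\mu_0,[s]\rangle=0$ is never homotopic to a holonomic section. -/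

import Mathlib

open scoped Manifold ContDiff Topology
open Set

noncomputable section

namespace MorseJet

variable {E : Type*} [NormedAddCommGroup E] [NormedSpace ℝ E]

theorem two_le_infty : (2 : ℕ∞ω) ≤ ∞ := by
  exact WithTop.coe_le_coe.2 (le_top : (2 : ℕ∞) ≤ ⊤)

/-- Continuous bilinear forms on `E`. -/
abbrev Bil (E : Type*) [NormedAddCommGroup E] [NormedSpace ℝ E] : Type _ :=
  E →L[ℝ] E →L[ℝ] ℝ

/-- The space of symmetric bilinear forms on `E`, identified with quadratic forms. -/
def SymBil (E : Type*) [NormedAddCommGroup E] [NormedSpace ℝ E] :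
    @Submodule ℝ (Bil E) _ NormedAddCommGroup.toAddCommGroup.toAddCommMonoid
      NormedSpace.toModule where
  carrier := {q | ∀ u v, q u v = q v u}
  add_mem' {a b} ha hb u v := by simp [ha u v, hb u v]
  zero_mem' u v := by simp
  smul_mem' c a ha u v := by simp [ha u v]

/-- Symmetric bilinear forms on `E`, as a normed space. -/
def SymForm (E : Type*) [NormedAddCommGroup E] [NormedSpace ℝ E] : Type _ := SymBil E

instance : NormedAddCommGroup (SymForm E) := inferInstanceAs (NormedAddCommGroup (SymBil E))

instance : NormedSpace ℝ (SymForm E) := inferInstanceAs (NormedSpace ℝ (SymBil E))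

instance [FiniteDimensional ℝ E] : FiniteDimensional ℝ (SymForm E) :=
  inferInstanceAs (FiniteDimensional ℝ (SymBil E))

/-- The bilinear form underlying a symmetric form. -/
def SymForm.toBil (q : SymForm E) : Bil E := q.1

@[ext] theorem SymForm.ext {q r : SymForm E} (h : ∀ u v, q.toBil u v = r.toBil u v) : q = r :=
  Subtype.ext (ContinuousLinearMap.ext fun u => ContinuousLinearMap.ext fun v => h u v)

theorem SymForm.symm (q : SymForm E) (u v : E) : q.toBil u v = q.toBil v u := q.2 u v

/-- Symmetrization `b ↦ ½ (b(u, v) + b(v, u))`; it is the identity on the symmetric forms. -/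
def symmetrize (E : Type*) [NormedAddCommGroup E] [NormedSpace ℝ E] [FiniteDimensional ℝ E] :
    Bil E →L[ℝ] SymForm E :=
  LinearMap.toContinuousLinearMap (F' := SymForm E)
    { toFun := fun b : Bil E =>
        (⟨(1 / 2 : ℝ) • (b + b.flip), fun u v => by simp [add_comm]⟩ : SymBil E)
      map_add' := fun a b => Subtype.ext <| by
        ext u v
        change (1 / 2 : ℝ) * ((a + b) u v + (a + b) v u) =
          (1 / 2 : ℝ) * (a u v + a v u) + (1 / 2 : ℝ) * (b u v + b v u)
        simp
        ring
      map_smul' := fun c a => Subtype.ext <| by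
        ext u v
        change (1 / 2 : ℝ) * ((c • a) u v + (c • a) v u) =
          c * ((1 / 2 : ℝ) * (a u v + a v u))
        simp
        ring }

theorem symmetrize_apply [FiniteDimensional ℝ E] (b : Bil E) (u v : E) :
    (symmetrize E b).toBil u v = (1 / 2 : ℝ) * (b u v + b v u) := by
  rfl

theorem symmetrize_coe [FiniteDimensional ℝ E] (b : Bil E) (hb : ∀ u v, b u v = b v u) :
    (symmetrize E b).toBil = b := by
  ext u v
  rw [symmetrize_apply, hb v u]
  ring

/-- Fibre of the reduced `2`-jet bundle in a chart: a pair `(y', y'')` consisting of a first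
derivative and a symmetric second derivative. -/
abbrev JetModel (E : Type*) [NormedAddCommGroup E] [NormedSpace ℝ E] : Type _ :=
  (E →L[ℝ] ℝ) × SymForm E

/-- Second order chain rule: the action on `2`-jets of a change of variables with first
derivative `L` and second derivative `B`, that is
`(p, q) ↦ (p ∘ L, q (L ·, L ·) + p (B (·, ·)))`.
(The symmetrization only matters when `B` is not symmetric.) -/
def jetPull (E : Type*) [NormedAddCommGroup E] [NormedSpace ℝ E] [FiniteDimensional ℝ E]
    (L : E →L[ℝ] E) (B : E →L[ℝ] E →L[ℝ] E) :
    JetModel E →L[ℝ] JetModel E :=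
  LinearMap.toContinuousLinearMap
    { toFun := fun j : JetModel E =>
        (j.1.comp L,
          symmetrize E (j.2.toBil.bilinearComp L L + (ContinuousLinearMap.compL ℝ _ _ _ j.1).comp B))
      map_add' := fun a b => by
        refine Prod.ext (ContinuousLinearMap.add_comp _ _ _) ?_
        change symmetrize E _ = symmetrize E _ + symmetrize E _
        rw [← map_add]
        congr 1
        ext u v
        change (a.2.toBil (L u) (L v) + b.2.toBil (L u) (L v)) + (a.1 (B u v) + b.1 (B u v)) =
          (a.2.toBil (L u) (L v) + a.1 (B u v)) + (b.2.toBil (L u) (L v) + b.1 (B u v))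
        ring
      map_smul' := fun c a => by
        refine Prod.ext (ContinuousLinearMap.smul_comp _ _ _) ?_
        change symmetrize E _ = c • symmetrize E _
        rw [← map_smul]
        congr 1
        ext u v
        change c * a.2.toBil (L u) (L v) + c * a.1 (B u v) =
          c * (a.2.toBil (L u) (L v) + a.1 (B u v))
        ring }

theorem jetPull_fst [FiniteDimensional ℝ E] (L : E →L[ℝ] E) (B : E →L[ℝ] E →L[ℝ] E)
    (j : JetModel E) : (jetPull E L B j).1 = j.1.comp L := by
  rfl

theorem jetPull_snd [FiniteDimensional ℝ E] (L : E →L[ℝ] E) (B : E →L[ℝ] E →L[ℝ] E)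
    (hB : ∀ u v, B u v = B v u) (j : JetModel E) (u v : E) :
    (jetPull E L B j).2.toBil u v = j.2.toBil (L u) (L v) + j.1 (B u v) := by
  change (symmetrize E _).toBil u v = _
  rw [symmetrize_apply]
  change (1 / 2 : ℝ) * ((j.2.toBil (L u) (L v) + j.1 (B u v)) + (j.2.toBil (L v) (L u) + j.1 (B v u))) = _
  rw [hB v u, j.2.symm (L v) (L u)]
  ring

variable {M : Type*} [TopologicalSpace M] [ChartedSpace E M]

/-- Change of variables between two charts: it expresses the coordinates `i` through the
coordinates `j`. -/
def transition (i j : atlas E M) : E → E := fun y => i.1 (j.1.symm y)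

theorem transition_contDiffAt [IsManifold 𝓘(ℝ, E) ∞ M] (i j : atlas E M) {x : M}
    (hi : x ∈ i.1.source) (hj : x ∈ j.1.source) :
    ContDiffAt ℝ ∞ (transition i j) (j.1 x) := by
  have h := 𝓘(ℝ, E).contDiffWithinAt_extendCoordChange' (n := ∞)
    (IsManifold.subset_maximalAtlas (I := 𝓘(ℝ, E)) (n := ∞) j.2)
    (IsManifold.subset_maximalAtlas (I := 𝓘(ℝ, E)) (n := ∞) i.2) hj hi
  rw [← contDiffWithinAt_univ]
  exact (by simpa [Function.comp_def] using h :
    ContDiffWithinAt ℝ ∞ (fun y => i.1 (j.1.symm y)) univ (j.1 x))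

theorem transition_symm [IsManifold 𝓘(ℝ, E) ∞ M] (i j : atlas E M) {x : M}
    (hi : x ∈ i.1.source) (hj : x ∈ j.1.source) (u v : E) :
    fderiv ℝ (fderiv ℝ (transition i j)) (j.1 x) u v =
      fderiv ℝ (fderiv ℝ (transition i j)) (j.1 x) v u :=
  (transition_contDiffAt i j hi hj).isSymmSndFDerivAt (by simpa using two_le_infty) u v

variable [FiniteDimensional ℝ E]

/-- Change of coordinates of reduced `2`-jets, from the chart `i` to the chart `j`. -/
def jetCoordChange (i j : atlas E M) (x : M) : JetModel E →L[ℝ] JetModel E :=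
  jetPull E (fderiv ℝ (transition i j) (j.1 x)) (fderiv ℝ (fderiv ℝ (transition i j)) (j.1 x))

theorem jetCoordChange_self (i : atlas E M) (x : M) (hx : x ∈ i.1.source)
    (v : JetModel E) : jetCoordChange i i x v = v := by
  have h0 : transition i i =ᶠ[𝓝 (i.1 x)] id := by
    filter_upwards [i.1.open_target.mem_nhds (i.1.map_source hx)] with y hy
    exact i.1.right_inv hy
  have h1 : fderiv ℝ (transition i i) =ᶠ[𝓝 (i.1 x)] fun _ => ContinuousLinearMap.id ℝ E := by
    filter_upwards [h0.fderiv (𝕜 := ℝ)] with y hy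
    rw [hy, fderiv_id]
  have h2 : fderiv ℝ (fderiv ℝ (transition i i)) (i.1 x) = 0 := by
    rw [h1.fderiv_eq]
    simp
  unfold jetCoordChange
  rw [h2, h1.eq_of_nhds]
  refine Prod.ext ?_ (SymForm.ext fun a b => ?_)
  · rw [jetPull_fst]
    rfl
  · rw [jetPull_snd _ _ (by simp)]
    simp

theorem jetCoordChange_comp [IsManifold 𝓘(ℝ, E) ∞ M] (i j k : atlas E M) (x : M)
    (hx : x ∈ i.1.source ∩ j.1.source ∩ k.1.source) (v : JetModel E) :
    jetCoordChange j k x (jetCoordChange i j x v) = jetCoordChange i k x v := by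
  obtain ⟨⟨hi, hj⟩, hk⟩ := hx
  have hψ := transition_contDiffAt j k hj hk
  have hφ := transition_contDiffAt i j hi hj
  have hval : transition j k (k.1 x) = j.1 x := by simp [transition, k.1.left_inv hk]
  have hφ' : ContDiffAt ℝ ∞ (transition i j) (transition j k (k.1 x)) := by rwa [hval]
  have h0 : transition i k =ᶠ[𝓝 (k.1 x)] (transition i j) ∘ (transition j k) := by
    have hc : k.1.symm ⁻¹' j.1.source ∈ 𝓝 (k.1 x) :=
      k.1.symm.continuousAt (k.1.map_source hk) (by
        rw [k.1.left_inv hk]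
        exact j.1.open_source.mem_nhds hj)
    filter_upwards [hc] with y hy
    simp [transition, j.1.left_inv hy]
  have hψe : ∀ᶠ y in 𝓝 (k.1 x), ContDiffAt ℝ 2 (transition j k) y :=
    (hψ.of_le two_le_infty).eventually (by simp)
  have hφe : ∀ᶠ y in 𝓝 (k.1 x), ContDiffAt ℝ 2 (transition i j) (transition j k y) :=
    hψ.continuousAt.eventually
      ((hφ'.of_le two_le_infty).eventually (by simp))
  have h1 : fderiv ℝ (transition i k) =ᶠ[𝓝 (k.1 x)] fun y =>
      (fderiv ℝ (transition i j) (transition j k y)).comp (fderiv ℝ (transition j k) y) := by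
    filter_upwards [h0.fderiv (𝕜 := ℝ), hψe, hφe] with y hy h h'
    rw [hy, fderiv_comp _ (h'.differentiableAt (by simp)) (h.differentiableAt (by simp))]
  have hd : DifferentiableAt ℝ (fderiv ℝ (transition j k)) (k.1 x) :=
    (hψ.fderiv_right (m := 1) two_le_infty).differentiableAt (by simp)
  have hd' : DifferentiableAt ℝ (fderiv ℝ (transition i j)) (transition j k (k.1 x)) :=
    (hφ'.fderiv_right (m := 1) two_le_infty).differentiableAt (by simp)
  have hd'' : DifferentiableAt ℝ (transition j k) (k.1 x) := hψ.differentiableAt (by simp)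
  have h2 : ∀ a b, fderiv ℝ (fderiv ℝ (transition i k)) (k.1 x) a b =
      fderiv ℝ (transition i j) (j.1 x) (fderiv ℝ (fderiv ℝ (transition j k)) (k.1 x) a b) +
      fderiv ℝ (fderiv ℝ (transition i j)) (j.1 x) (fderiv ℝ (transition j k) (k.1 x) a)
        (fderiv ℝ (transition j k) (k.1 x) b) := by
    intro a b
    have hc : HasFDerivAt (fun y => fderiv ℝ (transition i j) (transition j k y)) _ (k.1 x) :=
      hd'.hasFDerivAt.comp (k.1 x) hd''.hasFDerivAt
    rw [h1.fderiv_eq, (hc.clm_comp hd.hasFDerivAt).fderiv, hval]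
    simp
  refine Prod.ext ?_ (SymForm.ext fun a b => ?_)
  · simp only [jetCoordChange, jetPull_fst]
    rw [h1.eq_of_nhds, hval, ContinuousLinearMap.comp_assoc]
  · simp only [jetCoordChange]
    rw [jetPull_snd _ _ (transition_symm j k hj hk),
      jetPull_snd _ _ (transition_symm i j hi hj),
      jetPull_snd _ _ (transition_symm i k hi hk), jetPull_fst, h2, h1.eq_of_nhds, hval]
    simp
    ring

theorem jetCoordChange_contMDiffOn [IsManifold 𝓘(ℝ, E) ∞ M] (i j : atlas E M) :
    ContMDiffOn 𝓘(ℝ, E) 𝓘(ℝ, JetModel E →L[ℝ] JetModel E) ∞ (jetCoordChange (M := M) i j)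
      (i.1.source ∩ j.1.source) := by
  set U : Set E := j.1.target ∩ j.1.symm ⁻¹' i.1.source with hU
  have hUo : IsOpen U := j.1.symm.isOpen_inter_preimage i.1.open_source
  have h : ∀ y ∈ U, ContDiffAt ℝ ∞ (transition i j) y := by
    intro y hy
    have := transition_contDiffAt i j hy.2 (j.1.map_target hy.1)
    rwa [j.1.right_inv hy.1] at this
  have h1 : ContDiffOn ℝ ∞ (fderiv ℝ (transition i j)) U := fun y hy =>
    ((h y hy).fderiv_right (by simp)).contDiffWithinAt
  have h2 : ContDiffOn ℝ ∞ (fderiv ℝ (fderiv ℝ (transition i j))) U := fun y hy =>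
    (((h y hy).fderiv_right (m := ∞) (by simp)).fderiv_right (by simp)).contDiffWithinAt
  have key : ContDiffOn ℝ ∞ (fun y => jetPull E
      (fderiv ℝ (transition i j) y) (fderiv ℝ (fderiv ℝ (transition i j)) y)) U := by
    refine contDiffOn_clm_apply.2 fun v => ?_
    change ContDiffOn ℝ ∞ (fun y => (v.1.comp (fderiv ℝ (transition i j) y),
          symmetrize E (v.2.toBil.bilinearComp (fderiv ℝ (transition i j) y)
            (fderiv ℝ (transition i j) y) + (ContinuousLinearMap.compL ℝ _ _ _ v.1).comp
              (fderiv ℝ (fderiv ℝ (transition i j)) y)))) U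
    have h3 : ContDiffOn ℝ ∞ (fun y => v.2.toBil.bilinearComp (fderiv ℝ (transition i j) y)
        (fderiv ℝ (transition i j) y)) U := by
      refine contDiffOn_clm_apply.2 fun a => contDiffOn_clm_apply.2 fun b => ?_
      simp only [ContinuousLinearMap.bilinearComp_apply]
      exact (contDiffOn_const.clm_apply (h1.clm_apply contDiffOn_const)).clm_apply
        (h1.clm_apply contDiffOn_const)
    have h4 : ContDiffOn ℝ ∞ (fun y => (ContinuousLinearMap.compL ℝ E E ℝ v.1).comp
        (fderiv ℝ (fderiv ℝ (transition i j)) y)) U := by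
      refine contDiffOn_clm_apply.2 fun a => contDiffOn_clm_apply.2 fun b => ?_
      exact contDiffOn_const.clm_apply ((h2.clm_apply contDiffOn_const).clm_apply
        contDiffOn_const)
    have h5 : ContDiff ℝ ∞ (symmetrize E) :=
      ContinuousLinearMap.contDiff (𝕜 := ℝ) (E := Bil E) (F := SymForm E) (symmetrize E)
    exact (contDiffOn_const.clm_comp h1).prodMk (h5.comp_contDiffOn (h3.add h4))
  intro x hx
  have hj : ContMDiffAt 𝓘(ℝ, E) 𝓘(ℝ, E) ∞ j.1 x :=
    contMDiffAt_of_mem_maximalAtlas (IsManifold.subset_maximalAtlas j.2) hx.2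
  have hxU : j.1 x ∈ U := ⟨j.1.map_source hx.2, by simpa [j.1.left_inv hx.2] using hx.1⟩
  have hk := (key (j.1 x) hxU).contDiffAt (hUo.mem_nhds hxU)
  exact (hk.contMDiffAt.comp x hj).contMDiffWithinAt

variable (E M) in
/-- The bundle `J̃²(M)` of reduced `2`-jets of functions (`2`-jets modulo the value). -/
def jetCore [IsManifold 𝓘(ℝ, E) ∞ M] :
    VectorBundleCore ℝ M (JetModel E) (atlas E M) where
  baseSet i := i.1.source
  isOpen_baseSet i := i.1.open_source
  indexAt := achart E
  mem_baseSet_at := mem_chart_source E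
  coordChange := jetCoordChange
  coordChange_self := jetCoordChange_self
  continuousOn_coordChange i j := (jetCoordChange_contMDiffOn i j).continuousOn
  coordChange_comp := jetCoordChange_comp

instance jetCore_isContMDiff [IsManifold 𝓘(ℝ, E) ∞ M] :
    (jetCore E M).IsContMDiff 𝓘(ℝ, E) ∞ where
  contMDiffOn_coordChange := jetCoordChange_contMDiffOn

/-- The fibre of `J̃²(M)` over `x`: pairs `(y', y'')` in the preferred chart at `x`. -/
abbrev Jet (E : Type*) [NormedAddCommGroup E] [NormedSpace ℝ E] [FiniteDimensional ℝ E]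
    {M : Type*} [TopologicalSpace M] [ChartedSpace E M] [IsManifold 𝓘(ℝ, E) ∞ M] (x : M) :
    Type _ :=
  (jetCore E M).Fiber x

variable [IsManifold 𝓘(ℝ, E) ∞ M]

/-- The first derivative `y'` of a jet, that is its image under `π : J̃²(M) → T*M`. -/
def Jet.first {x : M} (j : Jet E x) : E →L[ℝ] ℝ := Prod.fst (show JetModel E from j)

/-- The second derivative `y''` of a jet. It is independent of the chart (up to the linear action
of the derivative of the change of charts) when the jet is critical, that is when `y' = 0`. -/
def Jet.second {x : M} (j : Jet E x) : SymForm E := Prod.snd (show JetModel E from j)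

/-- The reduced `2`-jet at `x` of a real function `f` which is smooth near `x`. -/
def jet2 (f : M → ℝ) (x : M) : Jet E x :=
  show JetModel E from
    (fderiv ℝ (f ∘ (chartAt E x).symm) (chartAt E x x),
      symmetrize E (fderiv ℝ (fderiv ℝ (f ∘ (chartAt E x).symm)) (chartAt E x x)))

/-- Nondegenerate quadratic forms. -/
def SymForm.Nondeg (q : SymForm E) : Prop := ∀ u, (∀ v, q.toBil u v = 0) → u = 0

/-- Index of a quadratic form: maximal dimension of a subspace on which it is negative definite. -/
def SymForm.index (q : SymForm E) : ℕ := sigNeg q.toBil.toBilinForm.toQuadraticMap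

/-- The fibre of `𝓜`: jets of functions whose differential is transverse to the zero section,
i.e. jets which are noncritical or have nondegenerate second derivative. -/
def Jet.IsMorse {x : M} (j : Jet E x) : Prop := j.first = 0 → j.second.Nondeg

/-- The fibre of `𝓜₀ⁱ`: critical jets with nondegenerate second derivative of index `i`. -/
def Jet.IsCritical {x : M} (i : ℕ) (j : Jet E x) : Prop :=
  j.first = 0 ∧ j.second.Nondeg ∧ j.second.index = i

variable (E M) in
/-- Continuous sections of `𝓜 ⊆ J̃²(M)`. -/
structure MorseSection where
  jet : ∀ x : M, Jet E x
  continuous_jet : Continuous fun x => (⟨x, jet x⟩ : (jetCore E M).TotalSpace)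
  isMorse : ∀ x, (jet x).IsMorse

namespace MorseSection

/-- Homotopy through continuous sections of `𝓜`. -/
def Homotopic (s t : MorseSection E M) : Prop :=
  ∃ H : unitInterval → MorseSection E M, H 0 = s ∧ H 1 = t ∧
    Continuous fun p : unitInterval × M =>
      (⟨p.2, (H p.1).jet p.2⟩ : (jetCore E M).TotalSpace)

/-- A section of `𝓜` is holonomic if it is the `2`-jet `j²f` of a smooth function `f` (which is
then a Morse function). -/
def IsHolonomic (s : MorseSection E M) : Prop :=
  ∃ f : M → ℝ, ContMDiff 𝓘(ℝ, E) 𝓘(ℝ, ℝ) ∞ f ∧ ∀ x, s.jet x = jet2 f x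

/-- Smoothness of a section. -/
def Smooth (s : MorseSection E M) : Prop :=
  ContMDiff 𝓘(ℝ, E) (𝓘(ℝ, E).prod 𝓘(ℝ, JetModel E)) ∞
    fun x => (⟨x, s.jet x⟩ : (jetCore E M).TotalSpace)

/-- The `1`-form `π ∘ s` written in the preferred chart at `a`, as a map `y ↦ y'(y)`. -/
def localForm (s : MorseSection E M) (a : M) (y : E) : E →L[ℝ] ℝ :=
  ((jetCore E M).localTriv (achart E a)
    ⟨(chartAt E a).symm y, s.jet ((chartAt E a).symm y)⟩).2.1

/-- The derivative at `a` of the local expression of the `1`-form `π ∘ s`, i.e. the bilinear form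
with matrix `∂y'_j / ∂x_k`. -/
def derivForm (s : MorseSection E M) (a : M) : Bil E :=
  fderiv ℝ (s.localForm a) (chartAt E a a)

/-- Transversality of `s` to `𝓜₀ⁱ`. Since `π` identifies the normal bundle of `𝓜₀ⁱ` in `𝓜` with
that of the zero section in `T*M`, it says that `π ∘ s` is transverse to the zero section at
all the points which `s` sends into `𝓜₀ⁱ`. -/
def TransverseTo (s : MorseSection E M) (i : ℕ) : Prop :=
  ∀ a, (s.jet a).IsCritical i → Function.Bijective (s.derivForm a)

/-- The sign of an intersection point of `s(M)` with `𝓜₀ⁱ`: the sign of the Jacobian of `x ↦ y'(x)`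
(it does not depend on the choice of a chart or of a basis), changed when `i` is odd because
of the opposite coorientation of `𝓜₀ⁱ` for odd `i`. -/
def intersectionSign (s : MorseSection E M) (i : ℕ) (a : M) : ℤ :=
  (-1) ^ i * (SignType.sign
    (LinearMap.BilinForm.toMatrix (Module.finBasis ℝ E) (s.derivForm a).toBilinForm).det : ℤ)

/-- The algebraic number of intersection points of `s(M)` with `𝓜₀ⁱ`. (For a smooth section
transverse to `𝓜₀ⁱ` over a compact `M`, there are finitely many of them.) -/
def signedCount (s : MorseSection E M) (i : ℕ) : ℤ :=
  ∑ᶠ a ∈ {a : M | (s.jet a).IsCritical i}, s.intersectionSign i a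

/-- `⟨μᵢ, [s]⟩ = m`: the section `s` can be deformed in `𝓜` to a smooth section transverse to
`𝓜₀ⁱ`, and the algebraic number of intersection points with `𝓜₀ⁱ` of every smooth
section which is homotopic to `s` and transverse to `𝓜₀ⁱ` is `m`. -/
def IsPairing (i : ℕ) (s : MorseSection E M) (m : ℤ) : Prop :=
  (∃ t : MorseSection E M, s.Homotopic t ∧ t.Smooth ∧ t.TransverseTo i) ∧
    ∀ t : MorseSection E M, s.Homotopic t → t.Smooth → t.TransverseTo i → t.signedCount i = m

theorem IsPairing.unique {i : ℕ} {s : MorseSection E M} {m m' : ℤ} (h : IsPairing i s m)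
    (h' : IsPairing i s m') : m = m' := by
  obtain ⟨t, h1, h2, h3⟩ := h.1
  rw [← h.2 t h1 h2 h3, ← h'.2 t h1 h2 h3]

end MorseSection

variable (E M) in
/-- The `h`-principle for sections of `𝓜`: every section of `𝓜` is homotopic through sections of
`𝓜` to a holonomic one. -/
def HPrinciple : Prop :=
  ∀ s : MorseSection E M, ∃ t : MorseSection E M, t.IsHolonomic ∧ s.Homotopic t

end MorseJet

end

/-!
A holonomic section `j²f` of the bundle of Morse jets meets the set of critical jets of index `0`
exactly at the local minima of the Morse function `f`. At a minimum the Jacobian of `df` is the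
Hessian, whose determinant is positive, so all these intersections count with the sign `+1`; since
`M` is compact, there is at least one. A section homotopic to a holonomic one therefore has a
representative with a positive count, and the value `0` is excluded
(`not_isPairing_zero_of_isHolonomic`). Conversely, a section which avoids the critical jets of
index `0` has the intersection number `0` (`isPairing_zero_of_forall_not`), because the count is
invariant under homotopies of sections of Morse jets. So it remains to prove this invariance and to
construct sections without critical jets of index `0`.

*Invariance* (`signedCount_eq_of_homotopic`). In a chart, the number of zeros of a covector field
counted with signs is the degree of a map `ℝⁿ → ℝⁿ`, obtained as an integral: for a bump function
`χ` near `0`, the integral of `χ(f) det Df` is constant along an affine homotopy without zeros on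
the boundary, by Piola's identity (`sum_fderiv_cofactor`, `finsum_sign_eq`). To pass to the
manifold, all sections of the jet bundle are written as combinations, with functions as
coefficients, of the jets of finitely many generating functions (`ChartCover.genFun`,
`ChartCover.coeff`). Two sections are joined by a chain in which each step is supported in one
chart (`ChartCover.chain`); by Sard's theorem a small perturbation by a constant combination of the
differentials of the generating functions makes all the members of the chain transverse to the zero
section (`ChartCover.dense_nondegOn`). This gives the invariance of the number of zeros in an open
set whose boundary is free of zeros (`ChartCover.zeroCount_eq`). Finally, a critical Morse jet of
index `0` cannot be deformed into a critical jet of another index without leaving the Morse jets.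
Hence the zeros of index `0` of a continuous section have a neighbourhood which isolates them for
all nearby sections (`ChartCover.exists_isolating`), the count of index `0` is locally constant
among sections, and so it is constant along a homotopy (`ChartCover.minCount_eq_of_homotopy`).

*Existence.* A `1`-form `α` has a canonical lift `jetOf α` to reduced `2`-jets, by the symmetrized
derivative of `α`; if `α` is, near each zero, the differential of a nondegenerate quadratic form of
index `1` or `2`, this lift is a section with the required properties
(`exists_section_of_form`). In dimension at least two, such a form is obtained from the
differential of a function with nondegenerate critical points
(`exists_form_isModelAt`). The derivative at a zero only has to stay among the invertible bilinear
forms, which need not be symmetric; a rotation by `π` in a plane of coordinates changes two signs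
of a diagonal form, so that every index can be changed to `1` or `2`
(`exists_reflTransGen_of_symm`), and such paths of derivatives are realized by modifications of
`α` near its zeros which create no new zeros (`exists_form_linear_of_reflTransGen`).

In dimension one the form must have no zeros at all (`exists_form_ne_zero`); the classification of
closed curves is not needed. Consider a transverse form with as few zeros as possible, and suppose
that it has a zero. Inside a chart interval the zeros can be cancelled in pairs, and a single zero
can be moved at will. So the set of positions to which the given zero can be moved, keeping the
other zeros, is open and closed and contains no other zero of the form. But the number of zeros in
an open and closed set, counted with signs, is the same for `α` and `-α`, whereas in dimension one
the change of sign reverses each of the signs; so this number is `0`, and it cannot be `±1`.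
-/

noncomputable section

set_option linter.unusedSectionVars false

namespace MorseJet

/-! ### The degree integral in `ℝⁿ` -/

section Degree

open MeasureTheory Metric

variable {ι : Type*} [Fintype ι] [DecidableEq ι]

/-- The determinant, as a continuous multilinear function of the rows. -/
def detRows (ι : Type*) [Fintype ι] [DecidableEq ι] :
    ContinuousMultilinearMap ℝ (fun _ : ι => ι → ℝ) ℝ where
  toMultilinearMap := (Matrix.detRowAlternating (n := ι) (R := ℝ)).toMultilinearMap
  cont := Continuous.matrix_det continuous_id

theorem detRows_update_swap (m : ι → ι → ℝ) {i j : ι} (hij : i ≠ j) (a b : ι → ℝ) :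
    detRows ι (Function.update (Function.update m i a) j b) =
      -detRows ι (Function.update (Function.update m i b) j a) := by
  have h := (Matrix.detRowAlternating (n := ι) (R := ℝ)).map_swap
    (Function.update (Function.update m i b) j a) hij
  have h2 : (Function.update (Function.update m i b) j a) ∘ Equiv.swap i j =
      Function.update (Function.update m i a) j b := by
    funext k
    simp only [Function.comp]
    rcases eq_or_ne k i with rfl | hki
    · simp [hij]
    rcases eq_or_ne k j with rfl | hkj
    · simp [hij]
    · simp [Equiv.swap_apply_of_ne_of_ne hki hkj, hki, hkj]
  rw [h2] at h
  exact h

/-- The gradient (row of partial derivatives) of a real function on `ι → ℝ`. -/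
def grad (h : (ι → ℝ) → ℝ) (x : ι → ℝ) : ι → ℝ := fun k => fderiv ℝ h x (Pi.single k 1)

/-- The rows of the Jacobian matrix of a map. -/
def jacRows (f : (ι → ℝ) → (ι → ℝ)) (x : ι → ℝ) : ι → ι → ℝ := fun i => grad (fun y => f y i) x

theorem jacRows_apply {f : (ι → ℝ) → (ι → ℝ)} {x : ι → ℝ} (hf : DifferentiableAt ℝ f x)
    (i k : ι) : jacRows f x i k = fderiv ℝ f x (Pi.single k 1) i := by
  unfold jacRows grad
  have := (hasFDerivAt_pi'.1 hf.hasFDerivAt i).fderiv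
  rw [this]
  rfl

theorem detRows_jacRows {f : (ι → ℝ) → (ι → ℝ)} {x : ι → ℝ} (hf : DifferentiableAt ℝ f x) :
    detRows ι (jacRows f x) = (fderiv ℝ f x).det := by
  have : (fderiv ℝ f x).det = (LinearMap.toMatrix' (fderiv ℝ f x : (ι → ℝ) →ₗ[ℝ] (ι → ℝ))).det := by
    rw [LinearMap.det_toMatrix']
  rw [this]
  change Matrix.det _ = _
  congr 1
  ext i k
  rw [jacRows_apply hf, LinearMap.toMatrix'_apply]
  congr 2

theorem contDiff_grad {h : (ι → ℝ) → ℝ} (hh : ContDiff ℝ ∞ h) : ContDiff ℝ ∞ (grad h) := by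
  refine contDiff_pi.2 fun k => ?_
  exact (hh.fderiv_right (m := ∞) (by simp)).clm_apply contDiff_const

theorem contDiff_jacRows {f : (ι → ℝ) → (ι → ℝ)} (hf : ContDiff ℝ ∞ f) :
    ContDiff ℝ ∞ (jacRows f) :=
  contDiff_pi.2 fun i => contDiff_grad (contDiff_pi.1 hf i)

theorem grad_grad_symm {h : (ι → ℝ) → ℝ} (hh : ContDiff ℝ ∞ h) (x : ι → ℝ) (k l : ι) :
    fderiv ℝ (grad h) x (Pi.single k 1) l = fderiv ℝ (grad h) x (Pi.single l 1) k := by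
  have key : ∀ k l : ι, fderiv ℝ (grad h) x (Pi.single k 1) l =
      fderiv ℝ (fderiv ℝ h) x (Pi.single k 1) (Pi.single l 1) := by
    intro k l
    have h1 : DifferentiableAt ℝ (grad h) x := (contDiff_grad hh).differentiable (by simp) x
    have h2 : DifferentiableAt ℝ (fderiv ℝ h) x :=
      (hh.fderiv_right (m := ∞) (by simp)).differentiable (by simp) x
    have h3 := (hasFDerivAt_pi'.1 h1.hasFDerivAt l).fderiv
    have h4 : fderiv ℝ (fun y => grad h y l) x (Pi.single k 1) =
        fderiv ℝ (fderiv ℝ h) x (Pi.single k 1) (Pi.single l 1) := by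
      unfold grad
      rw [fderiv_clm_apply h2 (differentiableAt_const _)]
      simp
    rw [← h4, h3]
    rfl
  rw [key, key]
  exact (hh.contDiffAt.isSymmSndFDerivAt (by simpa using two_le_infty)) _ _

theorem detRows_update_sum (m : ι → ι → ℝ) (j : ι) (v : ι → ℝ) :
    detRows ι (Function.update m j v) =
      ∑ l, v l * detRows ι (Function.update m j (Pi.single l 1)) := by
  have : v = ∑ l, v l • (Pi.single l 1 : ι → ℝ) := by
    ext k
    simp [Finset.sum_apply, Pi.single_apply]
  conv_lhs => rw [this]
  change (detRows ι).toMultilinearMap.toLinearMap m j _ = _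
  rw [map_sum]
  exact Finset.sum_congr rfl fun l _ => by rw [map_smul]; rfl

/-- The cofactor rows of a Jacobian matrix are divergence free (Piola's identity). -/
theorem sum_fderiv_cofactor {f : (ι → ℝ) → (ι → ℝ)} (hf : ContDiff ℝ ∞ f) (i : ι) (x : ι → ℝ) :
    ∑ k, fderiv ℝ (fun y => detRows ι (Function.update (jacRows f y) i (Pi.single k 1))) x
      (Pi.single k 1) = 0 := by
  have hJ := contDiff_jacRows hf
  have hk : ∀ k, fderiv ℝ (fun y => detRows ι
      (Function.update (jacRows f y) i (Pi.single k 1))) x (Pi.single k 1) =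
      ∑ j, if j = i then 0 else
        ∑ l, fderiv ℝ (grad fun y => f y j) x (Pi.single k 1) l *
          detRows ι (Function.update (Function.update (jacRows f x) i (Pi.single k 1)) j
            (Pi.single l 1)) := by
    intro k
    have hd : ∀ j, HasFDerivAt (fun y => Function.update (jacRows f y) i (Pi.single k 1) j)
        (if j = i then 0 else fderiv ℝ (grad fun y => f y j) x) x := by
      intro j
      by_cases h : j = i
      · subst h
        simpa using (hasFDerivAt_const (𝕜 := ℝ) (Pi.single k (1 : ℝ) : ι → ℝ) x)
      · simp only [Function.update_of_ne h, h, if_false]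
        exact ((contDiff_grad (contDiff_pi.1 hf j)).differentiable (by simp) x).hasFDerivAt
    have := HasFDerivAt.multilinear_comp (E := fun _ : ι => ι → ℝ) (detRows ι) hd
    rw [this.fderiv]
    simp only [sum_apply]
    refine Finset.sum_congr rfl fun j _ => ?_
    by_cases h : j = i
    · simp [h]
    · simp only [h, if_false, ContinuousLinearMap.comp_apply]
      rw [← detRows_update_sum]
      rfl
  simp only [hk]
  rw [Finset.sum_comm]
  refine Finset.sum_eq_zero fun j _ => ?_
  by_cases h : j = i
  · simp [h]
  simp only [h, if_false]
  set S := ∑ k, ∑ l, fderiv ℝ (grad fun y => f y j) x (Pi.single k 1) l *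
          detRows ι (Function.update (Function.update (jacRows f x) i (Pi.single k 1)) j
            (Pi.single l 1)) with hS
  have : S = -S := by
    conv_lhs => rw [hS, Finset.sum_comm]
    rw [hS, ← Finset.sum_neg_distrib]
    refine Finset.sum_congr rfl fun k _ => ?_
    rw [← Finset.sum_neg_distrib]
    refine Finset.sum_congr rfl fun l _ => ?_
    rw [grad_grad_symm (contDiff_pi.1 hf j), detRows_update_swap _ (Ne.symm h)]
    ring
  linarith

/-- The `n`-form `df₁ ∧ … ∧ dh ∧ … ∧ dfₙ`, with `dh` at the place `i`, is exact, so that its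
integral vanishes if `h` has compact support. -/
theorem integral_detRows_update_grad {f : (ι → ℝ) → (ι → ℝ)} (hf : ContDiff ℝ ∞ f) (i : ι)
    {h : (ι → ℝ) → ℝ} (hh : ContDiff ℝ ∞ h) (hc : HasCompactSupport h) :
    ∫ x, detRows ι (Function.update (jacRows f x) i (grad h x)) = 0 := by
  have hJ := contDiff_jacRows hf
  set c : ι → (ι → ℝ) → ℝ := fun k y =>
    detRows ι (Function.update (jacRows f y) i (Pi.single k 1)) with hcdef
  have hcs : ∀ k, ContDiff ℝ ∞ (c k) := by
    intro k
    refine (detRows ι).contDiff.comp (contDiff_pi.2 fun j => ?_)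
    by_cases hj : j = i
    · subst hj
      simpa using contDiff_const
    · simpa [hj] using contDiff_pi.1 hJ j
  have hh' : ∀ k, Continuous fun x => fderiv ℝ h x (Pi.single k 1) := fun k =>
    (contDiff_pi.1 (contDiff_grad hh) k).continuous
  have hcs' : ∀ k, Continuous fun x => fderiv ℝ (c k) x (Pi.single k 1) := fun k =>
    (contDiff_pi.1 (contDiff_grad (hcs k)) k).continuous
  have i1 : ∀ k, Integrable fun x => fderiv ℝ h x (Pi.single k 1) * c k x := fun k =>
    ((hh' k).mul (hcs k).continuous).integrable_of_hasCompactSupport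
      ((hc.fderiv_apply ℝ _).mul_right)
  have i2 : ∀ k, Integrable fun x => h x * fderiv ℝ (c k) x (Pi.single k 1) := fun k =>
    (hh.continuous.mul (hcs' k)).integrable_of_hasCompactSupport hc.mul_right
  have i3 : ∀ k, Integrable fun x => h x * c k x := fun k =>
    (hh.continuous.mul (hcs k).continuous).integrable_of_hasCompactSupport hc.mul_right
  have e1 : ∀ x, detRows ι (Function.update (jacRows f x) i (grad h x)) =
      ∑ k, fderiv ℝ h x (Pi.single k 1) * c k x := fun x => detRows_update_sum _ _ _
  simp only [e1]
  rw [integral_finsetSum _ fun k _ => i1 k]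
  have e2 : ∀ k, ∫ x, fderiv ℝ h x (Pi.single k 1) * c k x =
      -∫ x, h x * fderiv ℝ (c k) x (Pi.single k 1) := by
    intro k
    rw [integral_mul_fderiv_eq_neg_fderiv_mul_of_integrable (i1 k) (i2 k) (i3 k)
      (fun x _ => hh.differentiable (by simp) x) (fun x _ => (hcs k).differentiable (by simp) x),
      neg_neg]
  simp only [e2]
  rw [Finset.sum_neg_distrib, ← integral_finsetSum _ fun k _ => i2 k]
  have e3 : ∀ x, ∑ k, h x * fderiv ℝ (c k) x (Pi.single k 1) = 0 := by
    intro x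
    rw [← Finset.mul_sum, sum_fderiv_cofactor hf, mul_zero]
  simp [e3]

theorem grad_eq_zero_of_eventuallyEq {h : (ι → ℝ) → ℝ} {x : ι → ℝ} (hx : h =ᶠ[𝓝 x] 0) :
    grad h x = 0 := by
  funext k
  simp [grad, hx.fderiv_eq]

theorem jacRows_add_smul {f g : (ι → ℝ) → (ι → ℝ)} (hf : ContDiff ℝ ∞ f) (hg : ContDiff ℝ ∞ g)
    (u : ℝ) (x : ι → ℝ) :
    jacRows (fun y => f y + u • g y) x = jacRows f x + u • jacRows g x := by
  have hf' : DifferentiableAt ℝ f x := hf.differentiable (by simp) x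
  have hg' : DifferentiableAt ℝ g x := hg.differentiable (by simp) x
  ext i k
  have e : fderiv ℝ (fun y => f y + u • g y) x = fderiv ℝ f x + u • fderiv ℝ g x :=
    (hf'.hasFDerivAt.add (hg'.hasFDerivAt.const_smul u)).fderiv
  have hd : DifferentiableAt ℝ (fun y => f y + u • g y) x := hf'.add (hg'.const_smul u)
  rw [jacRows_apply hd, e]
  simp [jacRows_apply hf', jacRows_apply hg']

/-- The derivative at `u` of `χ(f + u g) det D(f + u g)`. -/
def degDensityDeriv (χ : (ι → ℝ) → ℝ) (f g : (ι → ℝ) → (ι → ℝ)) (u : ℝ) (x : ι → ℝ) : ℝ :=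
  fderiv ℝ χ (f x + u • g x) (g x) * detRows ι (jacRows f x + u • jacRows g x) +
    χ (f x + u • g x) *
      ∑ j, detRows ι (Function.update (jacRows f x + u • jacRows g x) j (jacRows g x j))

theorem hasDerivAt_degDensity {χ : (ι → ℝ) → ℝ} (hχ : ContDiff ℝ ∞ χ)
    (f g : (ι → ℝ) → (ι → ℝ)) (u : ℝ) (x : ι → ℝ) :
    HasDerivAt (fun t : ℝ => χ (f x + t • g x) * detRows ι (jacRows f x + t • jacRows g x))
      (degDensityDeriv χ f g u x) u := by
  have h1 : HasDerivAt (fun t : ℝ => f x + t • g x) (g x) u := by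
    simpa using ((hasDerivAt_id u).smul_const (g x)).const_add (f x)
  have h2 : HasDerivAt (fun t : ℝ => jacRows f x + t • jacRows g x) (jacRows g x) u := by
    simpa using ((hasDerivAt_id u).smul_const (jacRows g x)).const_add (jacRows f x)
  have h3 := ((hχ.differentiable (by simp) (f x + u • g x)).hasFDerivAt).comp_hasDerivAt u h1
  have h4 := ((detRows ι).hasFDerivAt (jacRows f x + u • jacRows g x)).comp_hasDerivAt u h2
  have h5 := h3.mul h4
  rw [ContinuousMultilinearMap.linearDeriv_apply] at h5
  exact h5

/-- The derivative of the degree integral vanishes as long as no zero crosses the boundary. -/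
theorem integral_degDensityDeriv {χ : (ι → ℝ) → ℝ} (hχ : ContDiff ℝ ∞ χ)
    {f g : (ι → ℝ) → (ι → ℝ)} (hf : ContDiff ℝ ∞ f) (hg : ContDiff ℝ ∞ g) {U : Set (ι → ℝ)}
    (hU : IsOpen U) (hb : Bornology.IsBounded U) {u : ℝ}
    (h0 : ∀ x ∈ frontier U, f x + u • g x ∉ tsupport χ) :
    ∫ x in U, degDensityDeriv χ f g u x = 0 := by
  set F : (ι → ℝ) → (ι → ℝ) := fun y => f y + u • g y with hF
  have hFs : ContDiff ℝ ∞ F := hf.add (hg.const_smul u)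
  set h : ι → (ι → ℝ) → ℝ := fun j => U.indicator fun x => g x j * χ (F x) with hh
  have hin : ∀ j, ∀ x ∈ U, h j =ᶠ[𝓝 x] fun x => g x j * χ (F x) := fun j x hx => by
    filter_upwards [hU.mem_nhds hx] with y hy
    exact indicator_of_mem hy _
  have hout : ∀ j, ∀ x ∉ U, h j =ᶠ[𝓝 x] 0 := by
    intro j x hx
    by_cases hxc : x ∈ closure U
    · have hxf : x ∈ frontier U := by rw [hU.frontier_eq]; exact ⟨hxc, hx⟩
      have : ∀ᶠ y in 𝓝 x, F y ∉ tsupport χ :=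
        hFs.continuous.continuousAt.eventually ((isClosed_tsupport χ).isOpen_compl.mem_nhds (h0 x hxf))
      filter_upwards [this] with y hy
      by_cases hyU : y ∈ U
      · simp [hh, hyU, image_eq_zero_of_notMem_tsupport hy]
      · simp [hh, hyU]
    · filter_upwards [isClosed_closure.isOpen_compl.mem_nhds hxc] with y hy
      exact indicator_of_notMem (fun hyU => hy (subset_closure hyU)) _
  have hps : ∀ j, ContDiff ℝ ∞ fun x => g x j * χ (F x) := fun j =>
    (contDiff_pi.1 hg j).mul (hχ.comp hFs)
  have hs : ∀ j, ContDiff ℝ ∞ (h j) := by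
    intro j
    refine contDiff_iff_contDiffAt.2 fun x => ?_
    by_cases hx : x ∈ U
    · exact (hps j).contDiffAt.congr_of_eventuallyEq (hin j x hx)
    · exact contDiffAt_const.congr_of_eventuallyEq (hout j x hx)
  have hcs : ∀ j, HasCompactSupport (h j) := fun j =>
    HasCompactSupport.of_support_subset_isCompact hb.isCompact_closure
      (support_indicator_subset.trans subset_closure)
  have hpt : ∀ x ∈ U, degDensityDeriv χ f g u x =
      ∑ j, detRows ι (Function.update (jacRows F x) j (grad (h j) x)) := by
    intro x hx
    have hJ := jacRows_add_smul hf hg u x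
    have hgr : ∀ j, grad (h j) x = χ (F x) • jacRows g x j +
        g x j • ∑ i, fderiv ℝ χ (F x) (Pi.single i 1) • jacRows F x i := by
      intro j
      funext k
      have hd1 : DifferentiableAt ℝ (fun y => g y j) x :=
        (contDiff_pi.1 hg j).differentiable (by simp) x
      have hd2 : HasFDerivAt (fun y => χ (F y)) ((fderiv ℝ χ (F x)).comp (fderiv ℝ F x)) x :=
        (hχ.differentiable (by simp) (F x)).hasFDerivAt.comp x
          (hFs.differentiable (by simp) x).hasFDerivAt
      have e1 : fderiv ℝ F x (Pi.single k 1) =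
          ∑ i, jacRows F x i k • (Pi.single i 1 : ι → ℝ) := by
        ext l
        simp [Finset.sum_apply, Pi.single_apply, jacRows_apply (hFs.differentiable (by simp) x)]
      have hd3 : fderiv ℝ (fun y => g y j * χ (F y)) x = g x j • (fderiv ℝ χ (F x)).comp
          (fderiv ℝ F x) + χ (F x) • fderiv ℝ (fun y => g y j) x :=
        (hd1.hasFDerivAt.mul hd2).fderiv
      unfold grad
      rw [(hin j x hx).fderiv_eq, hd3]
      simp only [add_apply, smul_apply, ContinuousLinearMap.comp_apply, e1, map_sum, map_smul,
        Pi.add_apply, Pi.smul_apply, Finset.sum_apply, smul_eq_mul]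
      change _ = χ (F x) * fderiv ℝ (fun y => g y j) x (Pi.single k 1) + _
      rw [add_comm]
      congr 2
      exact Finset.sum_congr rfl fun i _ => mul_comm _ _
    have hup : ∀ j, detRows ι (Function.update (jacRows F x) j (grad (h j) x)) =
        χ (F x) * detRows ι (Function.update (jacRows F x) j (jacRows g x j)) +
          g x j * (fderiv ℝ χ (F x) (Pi.single j 1) * detRows ι (jacRows F x)) := by
      intro j
      rw [hgr]
      set L := (detRows ι).toMultilinearMap.toLinearMap (jacRows F x) j with hL
      have hLa : ∀ v, detRows ι (Function.update (jacRows F x) j v) = L v := fun v => rfl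
      simp only [hLa, map_add, map_smul, map_sum, smul_eq_mul]
      congr 2
      rw [Finset.sum_eq_single j]
      · congr 1
        rw [← hLa, Function.update_eq_self]
      · intro i _ hij
        have : L (jacRows F x i) = 0 :=
          (Matrix.detRowAlternating (n := ι) (R := ℝ)).map_update_self (jacRows F x) hij.symm
        rw [this, mul_zero]
      · simp
    simp only [hup, Finset.sum_add_distrib, ← Finset.mul_sum]
    unfold degDensityDeriv
    rw [← hJ]
    have e2 : fderiv ℝ χ (F x) (g x) = ∑ j, g x j * fderiv ℝ χ (F x) (Pi.single j 1) := by
      have : g x = ∑ j, g x j • (Pi.single j 1 : ι → ℝ) := by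
        ext l
        simp [Finset.sum_apply, Pi.single_apply]
      conv_lhs => rw [this]
      simp
    change fderiv ℝ χ (F x) (g x) * _ + χ (F x) * _ = _
    rw [e2, Finset.sum_mul, add_comm]
    simp only [mul_assoc]
    rfl
  have hpt' : ∀ x ∉ U, ∑ j, detRows ι (Function.update (jacRows F x) j (grad (h j) x)) = 0 := by
    intro x hx
    refine Finset.sum_eq_zero fun j _ => ?_
    rw [grad_eq_zero_of_eventuallyEq (hout j x hx)]
    exact (detRows ι).map_update_zero _ _
  rw [setIntegral_congr_fun hU.measurableSet hpt,
    setIntegral_eq_integral_of_forall_compl_eq_zero hpt', integral_finsetSum]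
  · exact Finset.sum_eq_zero fun j _ => integral_detRows_update_grad hFs j (hs j) (hcs j)
  · intro j _
    refine Continuous.integrable_of_hasCompactSupport ?_ ?_
    · refine (detRows ι).cont.comp (continuous_pi fun i => ?_)
      by_cases hi : i = j
      · subst hi
        simpa using (contDiff_grad (hs i)).continuous
      · simpa [hi] using (contDiff_pi.1 (contDiff_jacRows hFs) i).continuous
    · refine HasCompactSupport.of_support_subset_isCompact hb.isCompact_closure fun x hx => ?_
      by_contra hxU
      refine hx ?_
      have hxU' : x ∉ U := fun h' => hxU (subset_closure h')
      simp only [grad_eq_zero_of_eventuallyEq (hout j x hxU')]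
      exact (detRows ι).map_update_zero _ _

theorem continuous_degDensityDeriv {χ : (ι → ℝ) → ℝ} (hχ : ContDiff ℝ ∞ χ)
    {f g : (ι → ℝ) → (ι → ℝ)} (hf : ContDiff ℝ ∞ f) (hg : ContDiff ℝ ∞ g) :
    Continuous fun p : ℝ × (ι → ℝ) => degDensityDeriv χ f g p.1 p.2 := by
  have c1 : Continuous fun p : ℝ × (ι → ℝ) => f p.2 + p.1 • g p.2 :=
    (hf.continuous.comp continuous_snd).add
      (continuous_fst.smul (hg.continuous.comp continuous_snd))
  have cg := (contDiff_jacRows hg).continuous.comp (continuous_snd (X := ℝ))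
  have c2 : Continuous fun p : ℝ × (ι → ℝ) => jacRows f p.2 + p.1 • jacRows g p.2 :=
    ((contDiff_jacRows hf).continuous.comp continuous_snd).add (continuous_fst.smul cg)
  have c3 : Continuous (fderiv ℝ χ) := (hχ.fderiv_right (m := ∞) (by simp)).continuous
  refine (((c3.comp c1).clm_apply (hg.continuous.comp continuous_snd)).mul
    ((detRows ι).cont.comp c2)).add ((hχ.continuous.comp c1).mul
      (continuous_finsetSum _ fun j _ => (detRows ι).cont.comp (c2.update j ?_)))
  exact (continuous_apply j).comp cg

/-- Homotopy invariance of the degree integral. -/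
theorem integral_degDensity_eq {χ : (ι → ℝ) → ℝ} (hχ : ContDiff ℝ ∞ χ)
    {f g : (ι → ℝ) → (ι → ℝ)} (hf : ContDiff ℝ ∞ f) (hg : ContDiff ℝ ∞ g) {U : Set (ι → ℝ)}
    (hU : IsOpen U) (hb : Bornology.IsBounded U)
    (h0 : ∀ u ∈ Icc (0 : ℝ) 1, ∀ x ∈ frontier U, f x + u • g x ∉ tsupport χ) :
    ∫ x in U, χ (f x + g x) * detRows ι (jacRows (fun y => f y + g y) x) =
      ∫ x in U, χ (f x) * detRows ι (jacRows f x) := by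
  set Φ : ℝ → (ι → ℝ) → ℝ := fun t x =>
    χ (f x + t • g x) * detRows ι (jacRows f x + t • jacRows g x) with hΦ
  have hUf : volume U < ⊤ := hb.measure_lt_top
  have hcΦ : ∀ t, Continuous (Φ t) := fun t =>
    (hχ.continuous.comp (hf.continuous.add (hg.continuous.const_smul t))).mul
      ((detRows ι).cont.comp ((contDiff_jacRows hf).continuous.add
        ((contDiff_jacRows hg).continuous.const_smul t)))
  have hint : ∀ F : (ι → ℝ) → ℝ, Continuous F → IntegrableOn F U := fun F hF =>
    (hF.continuousOn.integrableOn_compact hb.isCompact_closure).mono_set subset_closure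
  have hder : ∀ u, HasDerivAt (fun t => ∫ x in U, Φ t x)
      (∫ x in U, degDensityDeriv χ f g u x) u := by
    intro u
    obtain ⟨C, hC⟩ := ((isCompact_Icc (a := u - 1) (b := u + 1)).prod
      hb.isCompact_closure).exists_bound_of_continuousOn
      (continuous_degDensityDeriv hχ hf hg).continuousOn
    refine (hasDerivAt_integral_of_dominated_loc_of_deriv_le (𝕜 := ℝ) (bound := fun _ => C)
      (s := Icc (u - 1) (u + 1)) (Icc_mem_nhds (by linarith) (by linarith)) ?_ ?_ ?_ ?_ ?_ ?_).2
    · exact Filter.Eventually.of_forall fun t => (hcΦ t).aestronglyMeasurable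
    · exact hint _ (hcΦ u)
    · exact ((continuous_degDensityDeriv hχ hf hg).comp
        (Continuous.prodMk_right u)).aestronglyMeasurable
    · exact (ae_restrict_mem hU.measurableSet).mono fun x hx t ht =>
        hC (t, x) ⟨ht, subset_closure hx⟩
    · exact integrableOn_const hUf.ne
    · exact Filter.Eventually.of_forall fun x t _ => hasDerivAt_degDensity hχ f g t x
  have := constant_of_has_deriv_right_zero (f := fun t => ∫ x in U, Φ t x) (a := 0) (b := 1)
    (fun t _ => (hder t).continuousAt.continuousWithinAt) (fun t ht => by
      have := (hder t).hasDerivWithinAt (s := Ici t)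
      rwa [integral_degDensityDeriv hχ hf hg hU hb (h0 t ⟨ht.1, ht.2.le⟩)] at this) 1 (by simp)
  have hJ : ∀ x, jacRows (fun y => f y + g y) x = jacRows f x + jacRows g x := by
    intro x
    simpa using jacRows_add_smul hf hg 1 x
  simpa [hΦ, hJ] using this

/-! ### Zeros of maps in `ℝⁿ`, counted with signs -/

/-- A compact set of isolated points is finite. -/
theorem finite_of_isCompact_of_isolated {T : Type*} [TopologicalSpace T] {Z : Set T}
    (hZ : IsCompact Z) (h : ∀ a ∈ Z, ∃ N ∈ 𝓝 a, ∀ b ∈ N, b ∈ Z → b = a) : Z.Finite := by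
  choose! N hN hNZ using h
  obtain ⟨t, ht, hZt⟩ := hZ.elim_nhds_subcover N hN
  refine t.finite_toSet.subset fun b hb => ?_
  obtain ⟨a, ha, hba⟩ := mem_iUnion₂.1 (hZt hb)
  rw [hNZ a (ht a ha) b hba hb]
  exact ha

/-- The inverse function theorem near a nondegenerate zero, with control of the sign of the
Jacobian. -/
theorem exists_nhd_of_nondegenerate_zero {f : (ι → ℝ) → (ι → ℝ)} (hf : ContDiff ℝ ∞ f)
    {a : ι → ℝ} (ha : f a = 0) (hd : detRows ι (jacRows f a) ≠ 0) {W : Set (ι → ℝ)}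
    (hW : IsOpen W) (haW : a ∈ W) :
    ∃ N, IsOpen N ∧ a ∈ N ∧ N ⊆ W ∧ InjOn f N ∧
      (∀ x ∈ N, SignType.sign (detRows ι (jacRows f x)) = SignType.sign (detRows ι (jacRows f a))) ∧
      f '' N ∈ 𝓝 (0 : ι → ℝ) := by
  have hda := hd
  rw [detRows_jacRows (hf.differentiable (by simp) a)] at hda
  set f' := ContinuousLinearMap.toContinuousLinearEquivOfDetNeZero (fderiv ℝ f a) hda with hf'
  have hfd : HasFDerivAt f (f' : (ι → ℝ) →L[ℝ] (ι → ℝ)) a := by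
    simpa [hf'] using (hf.differentiable (by simp) a).hasFDerivAt
  set e := hf.contDiffAt.toOpenPartialHomeomorph f hfd (by simp) with he
  have hcont : Continuous fun x => detRows ι (jacRows f x) :=
    (detRows ι).cont.comp (contDiff_jacRows hf).continuous
  have hsO : IsOpen {x | SignType.sign (detRows ι (jacRows f x)) =
      SignType.sign (detRows ι (jacRows f a))} := by
    rcases lt_or_gt_of_ne hd with h | h
    · simpa only [sign_neg h, sign_eq_neg_one_iff] using isOpen_lt hcont continuous_const
    · simpa only [sign_pos h, sign_eq_one_iff] using isOpen_lt continuous_const hcont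
  have hsrc : a ∈ e.source := ContDiffAt.mem_toOpenPartialHomeomorph_source _ hfd _
  refine ⟨e.source ∩ W ∩ _, (e.open_source.inter hW).inter hsO, ⟨⟨hsrc, haW⟩, rfl⟩,
    fun x hx => hx.1.2, fun x hx y hy hxy => e.injOn hx.1.1 hy.1.1 hxy, fun x hx => hx.2, ?_⟩
  have ho : IsOpen (e '' (e.source ∩ W ∩ _)) :=
    e.isOpen_image_of_subset_source ((e.open_source.inter hW).inter hsO) (fun x hx => hx.1.1)
  refine ho.mem_nhds ⟨a, ⟨⟨hsrc, haW⟩, rfl⟩, ha⟩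

theorem finite_zeros {f : (ι → ℝ) → (ι → ℝ)} (hf : ContDiff ℝ ∞ f) {U : Set (ι → ℝ)}
    (hb : Bornology.IsBounded U)
    (hfr : ∀ x ∈ frontier U, f x ≠ 0) (hnd : ∀ x ∈ U, f x = 0 → detRows ι (jacRows f x) ≠ 0) :
    {x | x ∈ U ∧ f x = 0}.Finite := by
  have hZ : {x | x ∈ U ∧ f x = 0} = closure U ∩ f ⁻¹' {0} := by
    ext x
    refine ⟨fun h => ⟨subset_closure h.1, h.2⟩, fun h => ⟨?_, h.2⟩⟩
    by_contra hx
    exact hfr x ⟨h.1, fun hi => hx (interior_subset hi)⟩ h.2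
  refine finite_of_isCompact_of_isolated ?_ ?_
  · rw [hZ]
    exact hb.isCompact_closure.inter_right (isClosed_singleton.preimage hf.continuous)
  · rintro a ⟨haU, ha⟩
    obtain ⟨N, hNo, haN, -, hinj, -⟩ :=
      exists_nhd_of_nondegenerate_zero hf ha (hnd a haU ha) isOpen_univ (mem_univ a)
    exact ⟨N, hNo.mem_nhds haN, fun b hb' hbZ => hinj hb' haN (hbZ.2.trans ha.symm)⟩

/-- If all the zeros of `f` in `U` are nondegenerate, the degree integral counts them with the
signs of the Jacobian, provided that `χ` has a small support. -/
theorem exists_integral_eq_sum_sign {f : (ι → ℝ) → (ι → ℝ)} (hf : ContDiff ℝ ∞ f)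
    {U : Set (ι → ℝ)} (hU : IsOpen U) (hb : Bornology.IsBounded U)
    (hfr : ∀ x ∈ frontier U, f x ≠ 0) (hnd : ∀ x ∈ U, f x = 0 → detRows ι (jacRows f x) ≠ 0) :
    ∃ ε > 0, ∀ χ : (ι → ℝ) → ℝ, Continuous χ → Function.support χ ⊆ ball 0 ε → ∫ x, χ x = 1 →
      ∫ x in U, χ (f x) * detRows ι (jacRows f x) =
        ((∑ᶠ x ∈ {x | x ∈ U ∧ f x = 0}, (SignType.sign (detRows ι (jacRows f x)) : ℤ) : ℤ) : ℝ) := by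
  have hfin := finite_zeros hf hb hfr hnd
  set Z := {x | x ∈ U ∧ f x = 0} with hZ
  obtain ⟨V, hV, hVd⟩ := hfin.t2_separation
  have hN := fun a (ha : a ∈ Z) => exists_nhd_of_nondegenerate_zero hf ha.2 (hnd a ha.1 ha.2)
    ((hV a).2.inter hU) ⟨(hV a).1, ha.1⟩
  choose! N hNo haN hNW hNi hNs hNn using hN
  have hK : IsCompact (closure U \ ⋃ a ∈ Z, N a) :=
    hb.isCompact_closure.diff (isOpen_biUnion hNo)
  obtain ⟨δ, hδ, hKδ⟩ : ∃ δ > 0, ∀ x ∈ closure U \ ⋃ a ∈ Z, N a, δ ≤ ‖f x‖ := by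
    rcases (closure U \ ⋃ a ∈ Z, N a).eq_empty_or_nonempty with h | h
    · exact ⟨1, one_pos, by simp [h]⟩
    · obtain ⟨x, hx, hmin⟩ := hK.exists_isMinOn h (hf.continuous.norm.continuousOn)
      refine ⟨‖f x‖, norm_pos_iff.2 fun h0 => ?_, fun y hy => hmin hy⟩
      by_cases hxU : x ∈ U
      · exact hx.2 (mem_iUnion₂.2 ⟨x, ⟨hxU, h0⟩, haN x ⟨hxU, h0⟩⟩)
      · exact hfr x ⟨hx.1, fun hi => hxU (interior_subset hi)⟩ h0
  have hinter : (⋂ a ∈ Z, f '' N a) ∩ ball 0 δ ∈ 𝓝 (0 : ι → ℝ) :=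
    Filter.inter_mem ((Filter.biInter_mem hfin).2 hNn) (ball_mem_nhds _ hδ)
  obtain ⟨ε, hε, hεs⟩ := Metric.mem_nhds_iff.1 hinter
  refine ⟨ε, hε, fun χ hχ hsupp hone => ?_⟩
  have hcd : Continuous fun x => detRows ι (jacRows f x) :=
    (detRows ι).cont.comp (contDiff_jacRows hf).continuous
  have hcG : Continuous fun x => χ (f x) * detRows ι (jacRows f x) :=
    (hχ.comp hf.continuous).mul hcd
  have hNU : ∀ a ∈ Z, N a ⊆ U := fun a ha x hx => (hNW a ha hx).2
  have e1 : ∫ x in U, χ (f x) * detRows ι (jacRows f x) =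
      ∫ x in ⋃ a ∈ hfin.toFinset, N a, χ (f x) * detRows ι (jacRows f x) := by
    refine (setIntegral_eq_of_subset_of_forall_sdiff_eq_zero hU.measurableSet ?_ ?_)
    · exact iUnion₂_subset fun a ha => hNU a (by simpa using ha)
    · intro x hx
      have : χ (f x) = 0 := by
        by_contra h0
        have h1 := (hεs (hsupp h0)).2
        have h2 := hKδ x ⟨subset_closure hx.1, fun h => hx.2 (by simpa using h)⟩
        rw [mem_ball_zero_iff] at h1
        linarith
      rw [this, zero_mul]
  rw [e1, integral_biUnion_finset]
  · rw [finsum_mem_eq_finite_toFinset_sum _ hfin]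
    push_cast
    refine Finset.sum_congr rfl fun a ha => ?_
    have haZ : a ∈ Z := by simpa using ha
    have e2 : ∫ x in N a, χ (f x) * detRows ι (jacRows f x) =
        (SignType.sign (detRows ι (jacRows f a)) : ℝ) *
          ∫ x in N a, |(fderiv ℝ f x).det| • χ (f x) := by
      rw [← integral_const_mul]
      refine setIntegral_congr_fun (hNo a haZ).measurableSet fun x hx => ?_
      rw [← hNs a haZ x hx, ← detRows_jacRows (hf.differentiable (by simp) x), smul_eq_mul,
        ← mul_assoc, sign_mul_abs, mul_comm]
    rw [e2, ← integral_image_eq_integral_abs_det_fderiv_smul volume (hNo a haZ).measurableSet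
      (fun x _ => (hf.differentiable (by simp) x).hasFDerivAt.hasFDerivWithinAt) (hNi a haZ) χ,
      setIntegral_eq_integral_of_forall_compl_eq_zero, hone, mul_one]
    intro x hx
    by_contra h0
    exact hx (mem_iInter₂.1 (hεs (hsupp h0)).1 a haZ)
  · exact fun a ha => (hNo a (by simpa using ha)).measurableSet
  · intro a ha b hb' hab
    exact (hVd (by simpa using ha) (by simpa using hb') hab).mono
      (fun x hx => (hNW a (by simpa using ha) hx).1) (fun x hx => (hNW b (by simpa using hb') hx).1)
  · exact fun a ha => ((hcG.continuousOn.integrableOn_compact hb.isCompact_closure).mono_set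
      ((hNU a (by simpa using ha)).trans subset_closure))

/-- Homotopy invariance of the algebraic number of zeros in a bounded open set, for affine
homotopies without zeros on the boundary. -/
theorem finsum_sign_eq {f g : (ι → ℝ) → (ι → ℝ)} (hf : ContDiff ℝ ∞ f) (hg : ContDiff ℝ ∞ g)
    {U : Set (ι → ℝ)} (hU : IsOpen U) (hb : Bornology.IsBounded U)
    (hfr : ∀ u ∈ Icc (0 : ℝ) 1, ∀ x ∈ frontier U, f x + u • g x ≠ 0)
    (h0 : ∀ x ∈ U, f x = 0 → (fderiv ℝ f x).det ≠ 0)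
    (h1 : ∀ x ∈ U, f x + g x = 0 → (fderiv ℝ (fun y => f y + g y) x).det ≠ 0) :
    ∑ᶠ x ∈ {x | x ∈ U ∧ f x = 0}, (SignType.sign (fderiv ℝ f x).det : ℤ) =
      ∑ᶠ x ∈ {x | x ∈ U ∧ f x + g x = 0},
        (SignType.sign (fderiv ℝ (fun y => f y + g y) x).det : ℤ) := by
  have hfg : ContDiff ℝ ∞ (fun y => f y + g y) := hf.add hg
  have hdf : ∀ x, (fderiv ℝ f x).det = detRows ι (jacRows f x) := fun x =>
    (detRows_jacRows (hf.differentiable (by simp) x)).symm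
  have hdfg : ∀ x, (fderiv ℝ (fun y => f y + g y) x).det =
      detRows ι (jacRows (fun y => f y + g y) x) := fun x =>
    (detRows_jacRows (hfg.differentiable (by simp) x)).symm
  simp only [hdf, hdfg] at h0 h1 ⊢
  obtain ⟨ε₀, hε₀, H0⟩ := exists_integral_eq_sum_sign hf hU hb
    (fun x hx => by simpa using hfr 0 (by simp) x hx) h0
  obtain ⟨ε₁, hε₁, H1⟩ := exists_integral_eq_sum_sign hfg hU hb
    (fun x hx => by simpa using hfr 1 (by simp) x hx) h1
  obtain ⟨δ, hδ, hδf⟩ : ∃ δ > 0, ∀ u ∈ Icc (0 : ℝ) 1, ∀ x ∈ frontier U, δ ≤ ‖f x + u • g x‖ := by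
    have hK : IsCompact (Icc (0 : ℝ) 1 ×ˢ frontier U) :=
      isCompact_Icc.prod (hb.isCompact_closure.of_isClosed_subset isClosed_frontier
        frontier_subset_closure)
    have hc : Continuous fun p : ℝ × (ι → ℝ) => ‖f p.2 + p.1 • g p.2‖ :=
      ((hf.continuous.comp continuous_snd).add
        (continuous_fst.smul (hg.continuous.comp continuous_snd))).norm
    rcases (Icc (0 : ℝ) 1 ×ˢ frontier U).eq_empty_or_nonempty with h | h
    · refine ⟨1, one_pos, fun u hu x hx => ?_⟩
      have : (u, x) ∈ Icc (0 : ℝ) 1 ×ˢ frontier U := ⟨hu, hx⟩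
      simp [h] at this
    · obtain ⟨p, hp, hmin⟩ := hK.exists_isMinOn h hc.continuousOn
      exact ⟨_, norm_pos_iff.2 (hfr p.1 hp.1 p.2 hp.2), fun u hu x hx =>
        hmin (show (u, x) ∈ Icc (0 : ℝ) 1 ×ˢ frontier U from ⟨hu, hx⟩)⟩
  set ε := min (min ε₀ ε₁) δ with hε
  have hεpos : 0 < ε := by positivity
  let b : ContDiffBump (0 : ι → ℝ) := ⟨ε / 4, ε / 2, by positivity, by linarith⟩
  have hbs : Function.support (b.normed volume) ⊆ ball 0 ε := by
    rw [b.support_normed_eq]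
    exact ball_subset_ball (by change ε / 2 ≤ ε; linarith)
  have hbt : tsupport (b.normed volume) ⊆ ball 0 δ := by
    rw [b.tsupport_normed_eq]
    exact closedBall_subset_ball (by
      change ε / 2 < δ
      have : ε ≤ δ := min_le_right _ _
      linarith)
  have hbo : ∫ x, b.normed volume x = 1 := b.integral_normed
  have e0 := H0 (b.normed volume) b.continuous_normed (hbs.trans (ball_subset_ball
    ((min_le_left _ _).trans (min_le_left _ _)))) hbo
  have e1 := H1 (b.normed volume) b.continuous_normed (hbs.trans (ball_subset_ball
    ((min_le_left _ _).trans (min_le_right _ _)))) hbo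
  have e2 := integral_degDensity_eq (χ := b.normed volume) b.contDiff_normed hf hg hU hb
    (fun u hu x hx h => by
      have h2 := hbt h
      rw [mem_ball_zero_iff] at h2
      exact absurd (hδf u hu x hx) (not_le.2 h2))
  rw [e0, e1] at e2
  exact_mod_cast e2.symm

end Degree

/-! ### `1`-forms on a manifold, in charts -/

section Forms

variable {E : Type*} [NormedAddCommGroup E] [NormedSpace ℝ E]
variable {M : Type*} [TopologicalSpace M] [ChartedSpace E M]

/-- The derivative at `x` of the change of charts `transition i j`. -/
def transitionDeriv (i j : atlas E M) (x : M) : E →L[ℝ] E := fderiv ℝ (transition i j) (j.1 x)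

/-- The local expression, in the preferred chart at `c`, of a `1`-form `α`. A `1`-form is given by
its values in the preferred chart at each point. -/
def locForm (α : M → E →L[ℝ] ℝ) (c : M) (y : E) : E →L[ℝ] ℝ :=
  (α ((chartAt E c).symm y)).comp
    (transitionDeriv (achart E ((chartAt E c).symm y)) (achart E c) ((chartAt E c).symm y))

theorem locForm_add (α β : M → E →L[ℝ] ℝ) (c : M) (y : E) :
    locForm (α + β) c y = locForm α c y + locForm β c y := by
  simp [locForm, ContinuousLinearMap.add_comp]

theorem locForm_smul (g : M → ℝ) (α : M → E →L[ℝ] ℝ) (c : M) (y : E) :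
    locForm (fun x => g x • α x) c y = g ((chartAt E c).symm y) • locForm α c y := by
  simp [locForm, ContinuousLinearMap.smul_comp]

variable [FiniteDimensional ℝ E] [IsManifold 𝓘(ℝ, E) ∞ M]

theorem transitionDeriv_comp (i j k : atlas E M) {x : M} (hi : x ∈ i.1.source)
    (hj : x ∈ j.1.source) (hk : x ∈ k.1.source) :
    (transitionDeriv i j x).comp (transitionDeriv j k x) = transitionDeriv i k x := by
  have hψ := transition_contDiffAt j k hj hk
  have hφ := transition_contDiffAt i j hi hj
  have hval : transition j k (k.1 x) = j.1 x := by simp [transition, k.1.left_inv hk]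
  have h0 : transition i k =ᶠ[𝓝 (k.1 x)] (transition i j) ∘ (transition j k) := by
    have hc : k.1.symm ⁻¹' j.1.source ∈ 𝓝 (k.1 x) :=
      k.1.symm.continuousAt (k.1.map_source hk) (by
        rw [k.1.left_inv hk]
        exact j.1.open_source.mem_nhds hj)
    filter_upwards [hc] with y hy
    simp [transition, j.1.left_inv hy]
  unfold transitionDeriv
  rw [h0.fderiv_eq, fderiv_comp _ (by rw [hval]; exact hφ.differentiableAt (by simp))
    (hψ.differentiableAt (by simp)), hval]

theorem transitionDeriv_self (i : atlas E M) {x : M} (hi : x ∈ i.1.source) :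
    transitionDeriv i i x = ContinuousLinearMap.id ℝ E := by
  have h0 : transition i i =ᶠ[𝓝 (i.1 x)] id := by
    filter_upwards [i.1.open_target.mem_nhds (i.1.map_source hi)] with y hy
    exact i.1.right_inv hy
  unfold transitionDeriv
  rw [h0.fderiv_eq, fderiv_id]

theorem transitionDeriv_comp_symm (i j : atlas E M) {x : M} (hi : x ∈ i.1.source)
    (hj : x ∈ j.1.source) :
    (transitionDeriv i j x).comp (transitionDeriv j i x) = ContinuousLinearMap.id ℝ E := by
  rw [transitionDeriv_comp i j i hi hj hi, transitionDeriv_self i hi]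

theorem transitionDeriv_bijective (i j : atlas E M) {x : M} (hi : x ∈ i.1.source)
    (hj : x ∈ j.1.source) : Function.Bijective (transitionDeriv i j x) := by
  refine Function.bijective_iff_has_inverse.2 ⟨transitionDeriv j i x, fun v => ?_, fun v => ?_⟩
  · exact congrArg (fun L : E →L[ℝ] E => L v) (transitionDeriv_comp_symm j i hj hi)
  · exact congrArg (fun L : E →L[ℝ] E => L v) (transitionDeriv_comp_symm i j hi hj)

theorem locForm_apply (α : M → E →L[ℝ] ℝ) {c x : M} (hx : x ∈ (chartAt E c).source) :
    locForm α c (chartAt E c x) = (α x).comp (transitionDeriv (achart E x) (achart E c) x) := by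
  unfold locForm
  rw [(chartAt E c).left_inv hx]

theorem locForm_self (α : M → E →L[ℝ] ℝ) (x : M) : locForm α x (chartAt E x x) = α x := by
  rw [locForm_apply α (mem_chart_source E x), transitionDeriv_self _ (mem_chart_source E x)]
  rfl

theorem locForm_change (α : M → E →L[ℝ] ℝ) {c d x : M} (hc : x ∈ (chartAt E c).source)
    (hd : x ∈ (chartAt E d).source) :
    locForm α c (chartAt E c x) =
      (locForm α d (chartAt E d x)).comp (transitionDeriv (achart E d) (achart E c) x) := by
  rw [locForm_apply α hc, locForm_apply α hd, ContinuousLinearMap.comp_assoc,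
    transitionDeriv_comp _ _ _ (mem_chart_source E x) hd hc]

theorem locForm_eq_zero_iff (α : M → E →L[ℝ] ℝ) {c x : M} (hc : x ∈ (chartAt E c).source) :
    locForm α c (chartAt E c x) = 0 ↔ α x = 0 := by
  rw [locForm_apply α hc]
  refine ⟨fun h => ?_, fun h => by rw [h, ContinuousLinearMap.zero_comp]⟩
  ext v
  obtain ⟨w, rfl⟩ := (transitionDeriv_bijective (achart E x) (achart E c)
    (mem_chart_source E x) hc).2 v
  exact congrArg (fun L : E →L[ℝ] ℝ => L w) h

theorem locForm_eventually_change (α : M → E →L[ℝ] ℝ) {c d x : M}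
    (hc : x ∈ (chartAt E c).source) (hd : x ∈ (chartAt E d).source) :
    locForm α c =ᶠ[𝓝 (chartAt E c x)] fun y =>
      (locForm α d (transition (achart E d) (achart E c) y)).comp
        (fderiv ℝ (transition (achart E d) (achart E c)) y) := by
  have h1 : (chartAt E c).symm ⁻¹' (chartAt E d).source ∈ 𝓝 (chartAt E c x) :=
    (chartAt E c).symm.continuousAt ((chartAt E c).map_source hc) (by
      rw [(chartAt E c).left_inv hc]
      exact (chartAt E d).open_source.mem_nhds hd)
  filter_upwards [h1, (chartAt E c).open_target.mem_nhds ((chartAt E c).map_source hc)] with y hy hyt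
  have := locForm_change α ((chartAt E c).map_target hyt) hy
  rw [(chartAt E c).right_inv hyt] at this
  rw [this]
  unfold transitionDeriv
  change _ = ContinuousLinearMap.comp (locForm α d _) (fderiv ℝ _ y)
  congr 2
  exact (chartAt E c).right_inv hyt

/-- A `1`-form is smooth at `x` if its expression in the preferred chart at `x` is. -/
def FormSmoothAt (α : M → E →L[ℝ] ℝ) (x : M) : Prop :=
  ContDiffAt ℝ ∞ (locForm α x) (chartAt E x x)

theorem FormSmoothAt.of_chart {α : M → E →L[ℝ] ℝ} {c d x : M}
    (hc : x ∈ (chartAt E c).source) (hd : x ∈ (chartAt E d).source)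
    (h : ContDiffAt ℝ ∞ (locForm α d) (chartAt E d x)) :
    ContDiffAt ℝ ∞ (locForm α c) (chartAt E c x) := by
  have ht := transition_contDiffAt (achart E d) (achart E c) hd hc
  have hval : transition (achart E d) (achart E c) (chartAt E c x) = chartAt E d x := by
    simp [transition, (chartAt E c).left_inv hc]
  refine ContDiffAt.congr_of_eventuallyEq ?_ (locForm_eventually_change α hc hd)
  have h' : ContDiffAt ℝ ∞ (locForm α d)
      (transition (achart E d) (achart E c) (chartAt E c x)) := by rwa [hval]
  exact (ContDiffAt.comp (chartAt E c x) h' ht).clm_comp (ht.fderiv_right (by simp))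

theorem FormSmoothAt.chart {α : M → E →L[ℝ] ℝ} {c x : M} (h : FormSmoothAt α x)
    (hc : x ∈ (chartAt E c).source) : ContDiffAt ℝ ∞ (locForm α c) (chartAt E c x) :=
  FormSmoothAt.of_chart hc (mem_chart_source E x) h

theorem formSmoothAt_iff {α : M → E →L[ℝ] ℝ} {c x : M} (hc : x ∈ (chartAt E c).source) :
    FormSmoothAt α x ↔ ContDiffAt ℝ ∞ (locForm α c) (chartAt E c x) :=
  ⟨fun h => h.chart hc, fun h => FormSmoothAt.of_chart (mem_chart_source E x) hc h⟩

theorem FormSmoothAt.contDiffOn {α : M → E →L[ℝ] ℝ} (h : ∀ x, FormSmoothAt α x) (c : M) :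
    ContDiffOn ℝ ∞ (locForm α c) (chartAt E c).target := by
  intro y hy
  have := (h _).chart ((chartAt E c).map_target hy)
  rw [(chartAt E c).right_inv hy] at this
  exact this.contDiffWithinAt

theorem FormSmoothAt.add {α β : M → E →L[ℝ] ℝ} {x : M} (hα : FormSmoothAt α x)
    (hβ : FormSmoothAt β x) : FormSmoothAt (α + β) x := by
  unfold FormSmoothAt at *
  have : locForm (α + β) x = fun y => locForm α x y + locForm β x y :=
    funext fun y => locForm_add α β x y
  rw [this]
  exact hα.add hβ

theorem contDiffAt_comp_chart_symm {g : M → ℝ} {c x : M} (hc : x ∈ (chartAt E c).source)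
    (hg : ContMDiffAt 𝓘(ℝ, E) 𝓘(ℝ, ℝ) ∞ g x) :
    ContDiffAt ℝ ∞ (fun y => g ((chartAt E c).symm y)) (chartAt E c x) := by
  have h1 : ContMDiffAt 𝓘(ℝ, E) 𝓘(ℝ, E) ∞ (chartAt E c).symm (chartAt E c x) :=
    contMDiffOn_chart_symm.contMDiffAt
      ((chartAt E c).open_target.mem_nhds ((chartAt E c).map_source hc))
  have h2 : ContMDiffAt 𝓘(ℝ, E) 𝓘(ℝ, ℝ) ∞ g ((chartAt E c).symm (chartAt E c x)) := by
    rwa [(chartAt E c).left_inv hc]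
  exact (h2.comp _ h1).contDiffAt

theorem FormSmoothAt.smul {α : M → E →L[ℝ] ℝ} {g : M → ℝ} {x : M} (hα : FormSmoothAt α x)
    (hg : ContMDiffAt 𝓘(ℝ, E) 𝓘(ℝ, ℝ) ∞ g x) : FormSmoothAt (fun x => g x • α x) x := by
  unfold FormSmoothAt at *
  have : locForm (fun x => g x • α x) x = fun y => g ((chartAt E x).symm y) • locForm α x y :=
    funext fun y => locForm_smul g α x y
  rw [this]
  exact (contDiffAt_comp_chart_symm (mem_chart_source E x) hg).smul hα

theorem locForm_congr {α β : M → E →L[ℝ] ℝ} {c x : M} (hc : x ∈ (chartAt E c).source)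
    (h : α =ᶠ[𝓝 x] β) : locForm α c =ᶠ[𝓝 (chartAt E c x)] locForm β c := by
  have h1 := ((chartAt E c).symm.continuousAt ((chartAt E c).map_source hc)).eventually
    (show ∀ᶠ z in 𝓝 ((chartAt E c).symm (chartAt E c x)), α z = β z by
      rw [(chartAt E c).left_inv hc]; exact h)
  filter_upwards [h1] with y hy
  unfold locForm
  rw [hy]

theorem FormSmoothAt.congr {α β : M → E →L[ℝ] ℝ} {x : M} (hα : FormSmoothAt α x)
    (h : β =ᶠ[𝓝 x] α) : FormSmoothAt β x :=
  ContDiffAt.congr_of_eventuallyEq hα (locForm_congr (mem_chart_source E x) h)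

theorem isClosed_zeros {α : M → E →L[ℝ] ℝ} (hα : ∀ x, FormSmoothAt α x) :
    IsClosed {x | α x = 0} := by
  refine isOpen_compl_iff.1 (isOpen_iff_mem_nhds.2 fun x hx => ?_)
  have h1 : ∀ᶠ y in 𝓝 x, locForm α x (chartAt E x y) ≠ 0 := by
    have hc : ContinuousAt (fun y => locForm α x (chartAt E x y)) x :=
      ContinuousAt.comp (g := locForm α x) (hα x).continuousAt
        ((chartAt E x).continuousAt (mem_chart_source E x))
    refine hc.eventually_ne ?_
    rw [locForm_self]
    exact hx
  filter_upwards [h1, (chart_source_mem_nhds E x)] with y hy hys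
  exact fun h => hy ((locForm_eq_zero_iff α hys).2 h)

/-- The derivative at `x` of the local expression of `α` in the preferred chart at `c`. -/
def formDeriv (α : M → E →L[ℝ] ℝ) (c x : M) : Bil E := fderiv ℝ (locForm α c) (chartAt E c x)

/-- Transformation of the derivative of the local expression of a `1`-form under a change of
charts. -/
theorem formDeriv_change_add {α : M → E →L[ℝ] ℝ} {c d x : M} (h : FormSmoothAt α x)
    (hc : x ∈ (chartAt E c).source) (hd : x ∈ (chartAt E d).source) (u v : E) :
    formDeriv α c x u v = formDeriv α d x (transitionDeriv (achart E d) (achart E c) x u)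
      (transitionDeriv (achart E d) (achart E c) x v) + locForm α d (chartAt E d x)
        (fderiv ℝ (fderiv ℝ (transition (achart E d) (achart E c))) (chartAt E c x) u v) := by
  have ht := transition_contDiffAt (achart E d) (achart E c) hd hc
  have hval : transition (achart E d) (achart E c) (chartAt E c x) = chartAt E d x := by
    simp [transition, (chartAt E c).left_inv hc]
  have h1 : HasFDerivAt (fun y => locForm α d (transition (achart E d) (achart E c) y))
      ((fderiv ℝ (locForm α d) (chartAt E d x)).comp
        (fderiv ℝ (transition (achart E d) (achart E c)) (chartAt E c x))) (chartAt E c x) := by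
    have := ((h.chart hd).differentiableAt (by simp)).hasFDerivAt
    rw [← hval] at this
    have := this.comp (chartAt E c x) (ht.differentiableAt (by simp)).hasFDerivAt
    rwa [hval] at this
  have h2 : DifferentiableAt ℝ (fderiv ℝ (transition (achart E d) (achart E c))) (chartAt E c x) :=
    (ht.fderiv_right (m := ∞) (by simp)).differentiableAt (by simp)
  have h3 := h1.clm_comp h2.hasFDerivAt
  unfold formDeriv
  rw [(locForm_eventually_change α hc hd).fderiv_eq, h3.fderiv]
  simp only [hval]
  simp only [add_apply, ContinuousLinearMap.comp_apply, ContinuousLinearMap.flip_apply,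
    ContinuousLinearMap.compL_apply]
  rw [add_comm]
  rfl

/-- At a zero, the derivative of a `1`-form is a well defined bilinear form on the tangent
space. -/
theorem formDeriv_change {α : M → E →L[ℝ] ℝ} {c d x : M} (h : FormSmoothAt α x)
    (hc : x ∈ (chartAt E c).source) (hd : x ∈ (chartAt E d).source) (h0 : α x = 0) (u v : E) :
    formDeriv α c x u v = formDeriv α d x (transitionDeriv (achart E d) (achart E c) x u)
      (transitionDeriv (achart E d) (achart E c) x v) := by
  rw [formDeriv_change_add h hc hd, (locForm_eq_zero_iff α hd).2 h0]
  simp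

/-- The sign of the Jacobian of a `1`-form at a zero. -/
def bilSign (B : Bil E) : SignType :=
  SignType.sign (LinearMap.BilinForm.toMatrix (Module.finBasis ℝ E) B.toBilinForm).det

theorem bilinForm_det_comp {ι : Type*} [Fintype ι] [DecidableEq ι] (b : Module.Basis ι ℝ E)
    (B B' : Bil E) (L : E →L[ℝ] E) (h : ∀ u v, B u v = B' (L u) (L v)) :
    (LinearMap.BilinForm.toMatrix b B.toBilinForm).det =
      LinearMap.det (L : E →ₗ[ℝ] E) ^ 2 * (LinearMap.BilinForm.toMatrix b B'.toBilinForm).det := by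
  have : B.toBilinForm = LinearMap.BilinForm.comp B'.toBilinForm (L : E →ₗ[ℝ] E)
      (L : E →ₗ[ℝ] E) := by
    ext u v
    exact h u v
  rw [this, LinearMap.BilinForm.toMatrix_comp b b, Matrix.det_mul, Matrix.det_mul,
    Matrix.det_transpose, LinearMap.det_toMatrix]
  ring

theorem bilSign_congr {B B' : Bil E} {L : E →L[ℝ] E} (hL : Function.Bijective L)
    (h : ∀ u v, B u v = B' (L u) (L v)) : bilSign B = bilSign B' := by
  unfold bilSign
  rw [bilinForm_det_comp _ B B' L h, sign_mul, sign_pow]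
  have : LinearMap.det (L : E →ₗ[ℝ] E) ≠ 0 := by
    have := LinearEquiv.isUnit_det' (LinearEquiv.ofBijective (L : E →ₗ[ℝ] E) hL)
    exact this.ne_zero
  have h2 : SignType.sign (LinearMap.det (L : E →ₗ[ℝ] E)) ^ 2 = 1 := by
    rcases lt_or_gt_of_ne this with h | h
    · rw [sign_neg h]; rfl
    · rw [sign_pos h]; rfl
  rw [h2, one_mul]

theorem bilSign_change {α : M → E →L[ℝ] ℝ} {c d x : M} (h : FormSmoothAt α x)
    (hc : x ∈ (chartAt E c).source) (hd : x ∈ (chartAt E d).source) (h0 : α x = 0) :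
    bilSign (formDeriv α c x) = bilSign (formDeriv α d x) :=
  bilSign_congr (transitionDeriv_bijective (achart E d) (achart E c) hd hc)
    fun u v => formDeriv_change h hc hd h0 u v

theorem finrank_dual_clm : Module.finrank ℝ (E →L[ℝ] ℝ) = Module.finrank ℝ E := by
  rw [← (LinearMap.toContinuousLinearMap (𝕜 := ℝ) (E := E) (F' := ℝ)).finrank_eq]
  exact Subspace.dual_finrank_eq

theorem bijective_iff_separating {B : Bil E} :
    Function.Bijective B ↔ ∀ u, (∀ v, B u v = 0) → u = 0 := by
  have h2 : Function.Injective (B : E →ₗ[ℝ] E →L[ℝ] ℝ) ↔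
      Function.Surjective (B : E →ₗ[ℝ] E →L[ℝ] ℝ) :=
    LinearMap.injective_iff_surjective_of_finrank_eq_finrank finrank_dual_clm.symm
  have h3 : Function.Bijective B ↔ Function.Injective B := ⟨fun h => h.1, fun h => ⟨h, h2.1 h⟩⟩
  rw [h3, injective_iff_map_eq_zero]
  refine forall_congr' fun u => ?_
  rw [ContinuousLinearMap.ext_iff]
  rfl

theorem bilSign_ne_zero_iff {B : Bil E} : bilSign B ≠ 0 ↔ Function.Bijective B := by
  unfold bilSign
  rw [Ne, sign_eq_zero_iff, ← Ne]
  have h1 := LinearMap.separatingLeft_iff_det_ne_zero (B := B.toBilinForm)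
    (Module.finBasis ℝ E)
  rw [bijective_iff_separating]
  exact h1.symm

theorem formDeriv_bijective_change {α : M → E →L[ℝ] ℝ} {c d x : M} (h : FormSmoothAt α x)
    (hc : x ∈ (chartAt E c).source) (hd : x ∈ (chartAt E d).source) (h0 : α x = 0) :
    Function.Bijective (formDeriv α c x) ↔ Function.Bijective (formDeriv α d x) := by
  rw [← bilSign_ne_zero_iff, bilSign_change h hc hd h0, bilSign_ne_zero_iff]

end Forms

variable {E : Type*} [NormedAddCommGroup E] [NormedSpace ℝ E] [FiniteDimensional ℝ E]
variable {M : Type*} [TopologicalSpace M] [ChartedSpace E M] [IsManifold 𝓘(ℝ, E) ∞ M]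

/-! ### Zeros of maps to the dual space, and cutoffs -/

section Local

/-- `finsum_sign_eq` for maps from a vector space to its dual. -/
theorem finsum_bilSign_eq {f g : E → E →L[ℝ] ℝ} (hf : ContDiff ℝ ∞ f) (hg : ContDiff ℝ ∞ g)
    {U : Set E} (hU : IsOpen U) (hb : Bornology.IsBounded U)
    (hfr : ∀ u ∈ Icc (0 : ℝ) 1, ∀ x ∈ frontier U, f x + u • g x ≠ 0)
    (h0 : ∀ x ∈ U, f x = 0 → Function.Bijective (fderiv ℝ f x))
    (h1 : ∀ x ∈ U, f x + g x = 0 → Function.Bijective (fderiv ℝ (fun y => f y + g y) x)) :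
    ∑ᶠ x ∈ {x | x ∈ U ∧ f x = 0}, (bilSign (fderiv ℝ f x) : ℤ) =
      ∑ᶠ x ∈ {x | x ∈ U ∧ f x + g x = 0}, (bilSign (fderiv ℝ (fun y => f y + g y) x) : ℤ) := by
  set b := Module.finBasis ℝ E with hbdef
  set e := b.equivFunL with he
  -- a covector is determined by its values on the basis
  let co : (E →L[ℝ] ℝ) →L[ℝ] (Fin (Module.finrank ℝ E) → ℝ) :=
    ContinuousLinearMap.pi fun i => ContinuousLinearMap.apply ℝ ℝ (b i)
  have hco : ∀ p, co p = 0 ↔ p = 0 := by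
    intro p
    refine ⟨fun h => ?_, fun h => by rw [h, map_zero]⟩
    have : (p : E →ₗ[ℝ] ℝ) = 0 := b.ext fun i => congrFun h i
    ext v
    exact congrArg (fun L : E →ₗ[ℝ] ℝ => L v) this
  set T : (E → E →L[ℝ] ℝ) → (Fin (Module.finrank ℝ E) → ℝ) → (Fin (Module.finrank ℝ E) → ℝ) :=
    fun F z => co (F (e.symm z)) with hT
  have hTs : ∀ F, ContDiff ℝ ∞ F → ContDiff ℝ ∞ (T F) := fun F hF =>
    co.contDiff.comp (hF.comp e.symm.contDiff)
  have hTadd : ∀ z, T f z + T g z = T (fun y => f y + g y) z := fun z => (map_add co _ _).symm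
  have hdet : ∀ F, ContDiff ℝ ∞ F → ∀ z, (fderiv ℝ (T F) z).det =
      (LinearMap.BilinForm.toMatrix b (fderiv ℝ F (e.symm z)).toBilinForm).det := by
    intro F hF z
    have hd : HasFDerivAt (T F) (co.comp ((fderiv ℝ F (e.symm z)).comp
        (e.symm : (Fin (Module.finrank ℝ E) → ℝ) →L[ℝ] E))) z :=
      co.hasFDerivAt.comp z (((hF.differentiable (by simp) _).hasFDerivAt).comp z
        e.symm.hasFDerivAt)
    rw [hd.fderiv]
    unfold ContinuousLinearMap.det
    rw [← LinearMap.det_toMatrix', ← Matrix.det_transpose]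
    congr 1
    ext i k
    rw [Matrix.transpose_apply, LinearMap.toMatrix'_apply, LinearMap.BilinForm.toMatrix_apply]
    have hei : e.symm (Pi.single i 1) = b i := by
      rw [e.symm_apply_eq]
      ext j
      refine Eq.trans ?_ (b.equivFun_self i j).symm
      simp [Pi.single_apply, eq_comm]
    change fderiv ℝ F (e.symm z) (e.symm (Pi.single i 1)) (b k) = _
    rw [hei]
    rfl
  have hsg : ∀ F, ContDiff ℝ ∞ F → ∀ z, bilSign (fderiv ℝ F (e.symm z)) =
      SignType.sign (fderiv ℝ (T F) z).det := fun F hF z => by rw [hdet F hF]; rfl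
  have hbij : ∀ F, ContDiff ℝ ∞ F → ∀ z, Function.Bijective (fderiv ℝ F (e.symm z)) →
      (fderiv ℝ (T F) z).det ≠ 0 := fun F hF z h => by
    rw [← bilSign_ne_zero_iff, hsg F hF] at h
    exact fun h' => h (by rw [h', sign_zero])
  have hsum : ∀ F, ContDiff ℝ ∞ F → ∑ᶠ x ∈ {x | x ∈ U ∧ F x = 0}, (bilSign (fderiv ℝ F x) : ℤ) =
      ∑ᶠ z ∈ {z | z ∈ e.symm ⁻¹' U ∧ T F z = 0}, (SignType.sign (fderiv ℝ (T F) z).det : ℤ) := by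
    intro F hF
    refine finsum_mem_eq_of_bijOn e ⟨fun x hx => ?_, e.injective.injOn, fun z hz => ?_⟩
      fun x _ => ?_
    · refine ⟨by simpa using hx.1, ?_⟩
      simp [hT, hx.2]
    · exact ⟨e.symm z, ⟨hz.1, (hco _).1 hz.2⟩, by simp⟩
    · have := hsg F hF (e x)
      rw [e.symm_apply_apply] at this
      rw [this]
  have hsum2 := hsum _ (hf.add hg)
  have hset : {z | z ∈ e.symm ⁻¹' U ∧ T (fun y => f y + g y) z = 0} =
      {z | z ∈ e.symm ⁻¹' U ∧ T f z + T g z = 0} := by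
    ext z
    simp only [mem_ofPred_eq, hTadd]
  rw [hsum f hf]
  refine Eq.trans ?_ hsum2.symm
  have hTfun : (fun z => T f z + T g z) = T (fun y => f y + g y) := funext hTadd
  have key := finsum_sign_eq (hTs f hf) (hTs g hg) (U := e.symm ⁻¹' U)
    (hU.preimage e.symm.continuous) ?_ ?_ ?_ ?_
  · rw [key, hTfun]
    exact finsum_mem_congr hset.symm fun z _ => rfl
  · have := e.lipschitz.isBounded_image hb
    rwa [show e.symm ⁻¹' U = e '' U from (e.image_eq_preimage_symm U).symm]
  · intro u hu z hz
    have hz' : e.symm z ∈ frontier U := by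
      have := e.symm.toHomeomorph.preimage_frontier U
      have h' : z ∈ e.symm.toHomeomorph ⁻¹' frontier U := by
        rw [this]
        exact hz
      exact h'
    have h2 := hfr u hu _ hz'
    intro h3
    refine h2 ((hco _).1 ?_)
    rw [map_add, map_smul]
    exact h3
  · exact fun z hz hz0 => hbij f hf z (h0 _ hz ((hco _).1 hz0))
  · intro z hz hz0
    rw [hTfun]
    rw [hTadd] at hz0
    exact hbij _ (hf.add hg) z (h1 _ hz ((hco _).1 hz0))

/-- A function which is smooth on an open set agrees near a compact subset with a function which
is smooth everywhere. -/
theorem exists_contDiff_eventuallyEq {F : Type*} [NormedAddCommGroup F] [NormedSpace ℝ F]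
    {f : E → F} {T C : Set E} (hT : IsOpen T) (hf : ContDiffOn ℝ ∞ f T) (hC : IsCompact C)
    (hCT : C ⊆ T) : ∃ g : E → F, ContDiff ℝ ∞ g ∧ ∀ x ∈ C, g =ᶠ[𝓝 x] f := by
  obtain ⟨K, hK, hCK, hKT⟩ := exists_compact_between hC hT hCT
  obtain ⟨K', hK', hKK', hKT'⟩ := exists_compact_between hK hT hKT
  obtain ⟨η, hη0, hη1, -⟩ := exists_contMDiffMap_zero_one_of_isClosed 𝓘(ℝ, E) (n := ⊤)
    (s := (interior K')ᶜ) (t := K) isOpen_interior.isClosed_compl hK.isClosed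
    (disjoint_left.2 fun x hx hxK => hx (hKK' hxK))
  have hηs : ContDiff ℝ ∞ η := η.contMDiff.contDiff
  refine ⟨fun x => η x • f x, contDiff_iff_contDiffAt.2 fun x => ?_, fun x hx => ?_⟩
  · by_cases hx : x ∈ T
    · exact hηs.contDiffAt.smul ((hf x hx).contDiffAt (hT.mem_nhds hx))
    · have hx' : x ∈ K'ᶜ := fun h => hx (hKT' h)
      refine (contDiffAt_const (c := (0 : F))).congr_of_eventuallyEq ?_
      filter_upwards [hK'.isClosed.isOpen_compl.mem_nhds hx'] with y hy
      have : η y = 0 := hη0 (fun h => hy (interior_subset h))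
      simp [this]
  · filter_upwards [isOpen_interior.mem_nhds (hCK hx)] with y hy
    have : η y = 1 := hη1 (interior_subset hy)
    simp [this]

end Local

/-! ### The algebraic number of zeros of a `1`-form -/

section Count

/-- All the zeros of the `1`-form `α` in `A` are nondegenerate, i.e. `α` is transverse to the zero
section over `A`. -/
def NondegOn (α : M → E →L[ℝ] ℝ) (A : Set M) : Prop :=
  ∀ a ∈ A, α a = 0 → Function.Bijective (formDeriv α a a)

/-- The algebraic number of zeros of the `1`-form `α` in `A`. -/
def zeroCount (α : M → E →L[ℝ] ℝ) (A : Set M) : ℤ :=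
  ∑ᶠ a ∈ {a | a ∈ A ∧ α a = 0}, (bilSign (formDeriv α a a) : ℤ)

theorem NondegOn.mono {α : M → E →L[ℝ] ℝ} {A B : Set M} (h : NondegOn α A) (hBA : B ⊆ A) :
    NondegOn α B := fun a ha => h a (hBA ha)

/-- A nondegenerate zero is isolated. -/
theorem eventually_ne_zero_of_nondeg {α : M → E →L[ℝ] ℝ} {a : M} (hα : FormSmoothAt α a)
    (hn : Function.Bijective (formDeriv α a a)) : ∃ N ∈ 𝓝 a, ∀ b ∈ N, α b = 0 → b = a := by
  have h1 : HasFDerivAt (locForm α a) (formDeriv α a a) (chartAt E a a) :=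
    (ContDiffAt.differentiableAt hα (by simp)).hasFDerivAt
  obtain ⟨K, -, hK⟩ := LinearMap.exists_antilipschitzWith
    (formDeriv α a a : E →ₗ[ℝ] E →L[ℝ] ℝ) (LinearMap.ker_eq_bot.2 hn.1)
  have h2 := h1.eventually_ne (c := 0) ⟨K, hK⟩
  rw [eventually_nhdsWithin_iff] at h2
  have h3 := ((chartAt E a).continuousAt (mem_chart_source E a)).eventually h2
  refine ⟨_, Filter.inter_mem h3 (chart_source_mem_nhds E a), fun b hb h0 => ?_⟩
  by_contra hba
  refine hb.1 (fun h => hba ?_) ((locForm_eq_zero_iff α hb.2).2 h0)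
  exact (chartAt E a).injOn hb.2 (mem_chart_source E a) h

theorem finite_zeros_form [CompactSpace M] {α : M → E →L[ℝ] ℝ} (hα : ∀ x, FormSmoothAt α x)
    {A : Set M} (hfr : ∀ x ∈ frontier A, α x ≠ 0) (hn : NondegOn α A) :
    {a | a ∈ A ∧ α a = 0}.Finite := by
  have hZ : {a | a ∈ A ∧ α a = 0} = closure A ∩ {a | α a = 0} := by
    ext x
    refine ⟨fun h => ⟨subset_closure h.1, h.2⟩, fun h => ⟨?_, h.2⟩⟩
    by_contra hx
    exact hfr x ⟨h.1, fun hi => hx (interior_subset hi)⟩ h.2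
  refine finite_of_isCompact_of_isolated ?_ fun a ha => ?_
  · rw [hZ]
    exact (isClosed_closure.inter (isClosed_zeros hα)).isCompact
  · obtain ⟨N, hN, hNa⟩ := eventually_ne_zero_of_nondeg (hα a) (hn a ha.1 ha.2)
    exact ⟨N, hN, fun b hb hbZ => hNa b hb hbZ.2⟩

/-- Invariance of the number of zeros in an open set which lies in the domain of a chart. -/
theorem zeroCount_eq_of_chart [T2Space M] [CompactSpace M] {α β : M → E →L[ℝ] ℝ}
    (hα : ∀ x, FormSmoothAt α x) (hβ : ∀ x, FormSmoothAt β x) {c : M} {B : Set M} (hB : IsOpen B)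
    (hBc : closure B ⊆ (chartAt E c).source)
    (hfr : ∀ u ∈ Icc (0 : ℝ) 1, ∀ x ∈ frontier B, α x + u • (β x - α x) ≠ 0)
    (hnα : NondegOn α B) (hnβ : NondegOn β B) : zeroCount α B = zeroCount β B := by
  set φ := chartAt E c with hφ
  have hBs : B ⊆ φ.source := subset_closure.trans hBc
  have hC : IsCompact (φ '' closure B) :=
    isClosed_closure.isCompact.image_of_continuousOn (φ.continuousOn.mono hBc)
  have hCt : φ '' closure B ⊆ φ.target := by
    rintro _ ⟨x, hx, rfl⟩
    exact φ.map_source (hBc hx)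
  obtain ⟨f, hf, hfe⟩ := exists_contDiff_eventuallyEq φ.open_target
    (FormSmoothAt.contDiffOn hα c) hC hCt
  obtain ⟨k, hk, hke⟩ := exists_contDiff_eventuallyEq φ.open_target
    (FormSmoothAt.contDiffOn hβ c) hC hCt
  have hU : IsOpen (φ '' B) := φ.isOpen_image_of_subset_source hB hBs
  have hUC : φ '' B ⊆ φ '' closure B := image_mono subset_closure
  have hfrU : ∀ y ∈ frontier (φ '' B), ∃ x ∈ frontier B, φ x = y := by
    intro y hy
    obtain ⟨x, hx, rfl⟩ := closure_minimal hUC hC.isClosed hy.1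
    refine ⟨x, ⟨hx, fun hi => ?_⟩, rfl⟩
    rw [hU.frontier_eq] at hy
    exact hy.2 ⟨x, interior_subset hi, rfl⟩
  have hz : ∀ {γ : M → E →L[ℝ] ℝ} {F : E → E →L[ℝ] ℝ} (_ : ∀ x, FormSmoothAt γ x)
      (_ : ∀ y ∈ φ '' closure B, F =ᶠ[𝓝 y] locForm γ c), zeroCount γ B =
      ∑ᶠ y ∈ {y | y ∈ φ '' B ∧ F y = 0}, (bilSign (fderiv ℝ F y) : ℤ) := by
    intro γ F hγ hF
    have hval : ∀ x ∈ B, F (φ x) = locForm γ c (φ x) := fun x hx =>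
      (hF _ ⟨x, subset_closure hx, rfl⟩).eq_of_nhds
    refine finsum_mem_eq_of_bijOn φ ⟨fun x hx => ⟨⟨x, hx.1, rfl⟩, ?_⟩,
      φ.injOn.mono fun x hx => hBs hx.1, ?_⟩ fun x hx => ?_
    · rw [hval x hx.1]
      exact (locForm_eq_zero_iff γ (hBs hx.1)).2 hx.2
    · rintro _ ⟨⟨x, hx, rfl⟩, hy⟩
      rw [hval x hx] at hy
      exact ⟨x, ⟨hx, (locForm_eq_zero_iff γ (hBs hx)).1 hy⟩, rfl⟩
    · rw [(hF _ ⟨x, subset_closure hx.1, rfl⟩).fderiv_eq]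
      rw [bilSign_change (hγ x) (mem_chart_source E x) (hBs hx.1) hx.2]
      rfl
  have hnd : ∀ {γ : M → E →L[ℝ] ℝ} {F : E → E →L[ℝ] ℝ} (_ : ∀ x, FormSmoothAt γ x)
      (_ : ∀ y ∈ φ '' closure B, F =ᶠ[𝓝 y] locForm γ c) (_ : NondegOn γ B),
      ∀ y ∈ φ '' B, F y = 0 → Function.Bijective (fderiv ℝ F y) := by
    rintro γ F hγ hF hn _ ⟨x, hx, rfl⟩ h0
    have he := hF _ ⟨x, subset_closure hx, rfl⟩
    rw [he.eq_of_nhds] at h0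
    have h0' := (locForm_eq_zero_iff γ (hBs hx)).1 h0
    rw [he.fderiv_eq]
    exact (formDeriv_bijective_change (hγ x) (mem_chart_source E x) (hBs hx) h0').1 (hn x hx h0')
  have hfk : (fun y => f y + (k y - f y)) = k := by
    funext y
    abel
  have key := finsum_bilSign_eq hf (hk.sub hf) hU (hC.isBounded.subset hUC) ?_
    (hnd hα hfe hnα) ?_
  · rw [hz hα hfe, hz hβ hke, key]
    simp only [add_sub_cancel]
  · intro u hu y hy
    obtain ⟨x, hx, rfl⟩ := hfrU y hy
    have hxs : x ∈ φ.source := hBc hx.1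
    have h1 := hfr u hu x hx
    have hm : φ x ∈ φ '' closure B := ⟨x, hx.1, rfl⟩
    simp only [(hfe _ hm).eq_of_nhds, (hke _ hm).eq_of_nhds]
    have h2 := (locForm_eq_zero_iff (fun x => α x + u • (β x - α x)) hxs).not.2 h1
    intro h3
    refine h2 ?_
    rw [← h3, locForm_apply _ hxs, locForm_apply _ hxs, locForm_apply _ hxs]
    simp [ContinuousLinearMap.add_comp, ContinuousLinearMap.smul_comp,
      ContinuousLinearMap.sub_comp]
  · have := hnd hβ hke hnβ
    intro y hy h0
    simp only [hfk]
    refine this y hy ?_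
    simpa using h0

/-- The algebraic number of zeros in `A` does not change when a `1`-form is modified inside the
domain of a chart, as long as no zero crosses the boundary of `A`. -/
theorem zeroCount_eq_of_eq_off_compact [T2Space M] [CompactSpace M] {α β : M → E →L[ℝ] ℝ}
    (hα : ∀ x, FormSmoothAt α x) (hβ : ∀ x, FormSmoothAt β x) {c : M} {K : Set M}
    (hK : IsClosed K) (hKc : K ⊆ (chartAt E c).source) (hαβ : ∀ x ∉ K, α x = β x)
    {A : Set M} (hA : IsOpen A)
    (hfr : ∀ u ∈ Icc (0 : ℝ) 1, ∀ x ∈ frontier A, α x + u • (β x - α x) ≠ 0)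
    (hnα : NondegOn α A) (hnβ : NondegOn β A) : zeroCount α A = zeroCount β A := by
  have hfinα := finite_zeros_form hα (fun x hx => by simpa using hfr 0 (by simp) x hx) hnα
  have hfinβ := finite_zeros_form hβ (fun x hx => by simpa using hfr 1 (by simp) x hx) hnβ
  obtain ⟨χ, hχ0, hχ1, -⟩ := exists_continuous_zero_one_of_isClosed
    (chartAt E c).open_source.isClosed_compl hK
    (disjoint_left.2 fun x hx hxK => hx (hKc hxK))
  -- a level of `χ` which contains no zero of `α`
  obtain ⟨r, hr, hrZ⟩ : ∃ r ∈ Ioo (0 : ℝ) 1, r ∉ χ '' {a | a ∈ A ∧ α a = 0} :=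
    ((Ioo_infinite one_pos).sdiff (hfinα.image χ)).nonempty
  set V : Set M := {x | r < χ x} with hV
  have hVo : IsOpen V := isOpen_lt continuous_const χ.continuous
  have hKV : K ⊆ V := fun x hx => by
    have : χ x = 1 := hχ1 hx
    change r < χ x
    rw [this]
    exact hr.2
  have hVcl : closure V ⊆ {x | r ≤ χ x} :=
    closure_minimal (fun x (hx : r < χ x) => hx.le) (isClosed_le continuous_const χ.continuous)
  have hVc : closure V ⊆ (chartAt E c).source := by
    intro x hx
    by_contra h
    have h1 : χ x = 0 := hχ0 h
    have h2 : r ≤ χ x := hVcl hx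
    linarith [hr.1]
  have hVfr : ∀ x ∈ frontier V, χ x = r := by
    intro x hx
    refine le_antisymm (not_lt.1 fun h => ?_) (hVcl hx.1)
    rw [hVo.frontier_eq] at hx
    exact hx.2 h
  have h1 : zeroCount α (A ∩ V) = zeroCount β (A ∩ V) := by
    refine zeroCount_eq_of_chart hα hβ (hA.inter hVo)
      ((closure_mono inter_subset_right).trans hVc) ?_ (hnα.mono inter_subset_left)
      (hnβ.mono inter_subset_left)
    intro u hu x hx
    rcases frontier_inter_subset A V hx with h | h
    · exact hfr u hu x h.1
    · by_cases hxA : x ∈ A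
      · have hxr := hVfr x h.2
        have hxK : x ∉ K := fun hxK => by
          have : r < χ x := hKV hxK
          linarith
        rw [← hαβ x hxK, sub_self, smul_zero, add_zero]
        exact fun h0 => hrZ ⟨x, ⟨hxA, h0⟩, hxr⟩
      · refine hfr u hu x ?_
        rw [hA.frontier_eq]
        exact ⟨h.1, hxA⟩
  have h2 : zeroCount α (A \ V) = zeroCount β (A \ V) := by
    have hxK : ∀ x ∈ A \ V, α =ᶠ[𝓝 x] β := fun x hx => by
      filter_upwards [hK.isOpen_compl.mem_nhds fun h => hx.2 (hKV h)] with y hy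
      exact hαβ y hy
    refine finsum_mem_congr ?_ fun x hx => ?_
    · ext x
      refine and_congr_right fun hx => ?_
      rw [(hxK x hx).eq_of_nhds]
    · unfold formDeriv
      rw [(locForm_congr (mem_chart_source E x) (hxK x hx.1)).fderiv_eq]
  have hsplit : ∀ {γ : M → E →L[ℝ] ℝ}, {a | a ∈ A ∧ γ a = 0}.Finite →
      zeroCount γ A = zeroCount γ (A ∩ V) + zeroCount γ (A \ V) := by
    intro γ hγ
    unfold zeroCount
    rw [← finsum_mem_union]
    · refine finsum_mem_congr ?_ fun _ _ => rfl
      ext x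
      simp only [mem_ofPred_eq, mem_union, mem_inter_iff, mem_sdiff]
      tauto
    · exact disjoint_left.2 fun x hx hx' => hx'.1.2 hx.1.2
    · exact hγ.subset fun x hx => ⟨hx.1.1, hx.2⟩
    · exact hγ.subset fun x hx => ⟨hx.1.1, hx.2⟩
  rw [hsplit hfinα, hsplit hfinβ, h1, h2]

end Count

/-! ### Reduced `2`-jets and lifts of `1`-forms -/

section Jets

/-- The coordinates, in the preferred chart at `c`, of a jet at `x` (which is given by its
coordinates in the preferred chart at `x`). -/
def jetCoord (c x : M) (v : JetModel E) : JetModel E :=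
  jetCoordChange (achart E x) (achart E c) x v

theorem jetCoord_fst (c x : M) (v : JetModel E) :
    (jetCoord c x v).1 = v.1.comp (transitionDeriv (achart E x) (achart E c) x) := by
  rfl

theorem jetCoord_snd {c x : M} (hx : x ∈ (chartAt E c).source) (v : JetModel E) (u w : E) :
    (jetCoord c x v).2.toBil u w =
      v.2.toBil (transitionDeriv (achart E x) (achart E c) x u)
        (transitionDeriv (achart E x) (achart E c) x w) +
      v.1 (fderiv ℝ (fderiv ℝ (transition (achart E x) (achart E c))) (chartAt E c x) u w) :=
  jetPull_snd _ _ (transition_symm _ _ (mem_chart_source E x) hx) v u w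

theorem jetCoord_self (x : M) (v : JetModel E) : jetCoord x x v = v :=
  jetCoordChange_self _ x (mem_chart_source E x) v

theorem jetCoord_change {c d x : M} (hc : x ∈ (chartAt E c).source)
    (hd : x ∈ (chartAt E d).source) (v : JetModel E) :
    jetCoordChange (achart E d) (achart E c) x (jetCoord d x v) = jetCoord c x v :=
  jetCoordChange_comp _ _ _ x ⟨⟨mem_chart_source E x, hd⟩, hc⟩ v

theorem jetCoord_injective {c x : M} (hc : x ∈ (chartAt E c).source) :
    Function.Injective (jetCoord (E := E) c x) := by
  intro v w h
  have h1 := jetCoord_change (mem_chart_source E x) hc v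
  have h2 := jetCoord_change (mem_chart_source E x) hc w
  rw [jetCoord_self] at h1 h2
  rw [← h1, ← h2, h]

theorem jetCoord_fst_eq_zero_iff {c x : M} (hc : x ∈ (chartAt E c).source) (v : JetModel E) :
    (jetCoord c x v).1 = 0 ↔ v.1 = 0 := by
  have := locForm_eq_zero_iff (fun _ : M => v.1) hc
  rwa [locForm_apply _ hc] at this

/-- Positive definite quadratic forms. -/
def SymForm.Pos (q : SymForm E) : Prop := ∀ u, u ≠ 0 → 0 < q.toBil u u

theorem jetCoord_snd_pos_iff {c x : M} (hc : x ∈ (chartAt E c).source) {v : JetModel E}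
    (hv : v.1 = 0) : (jetCoord c x v).2.Pos ↔ v.2.Pos := by
  have hb := transitionDeriv_bijective (achart E x) (achart E c) (mem_chart_source E x) hc
  have e : ∀ u, (jetCoord c x v).2.toBil u u =
      v.2.toBil (transitionDeriv (achart E x) (achart E c) x u)
        (transitionDeriv (achart E x) (achart E c) x u) := fun u => by
    rw [jetCoord_snd hc, hv]
    simp
  refine ⟨fun h u hu => ?_, fun h u hu => ?_⟩
  · obtain ⟨w, rfl⟩ := hb.2 u
    rw [← e]
    exact h w fun hw => hu (by rw [hw, map_zero])
  · rw [e]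
    exact h _ fun h0 => hu (hb.1 (by rw [h0, map_zero]))

/-- The canonical lift of a `1`-form `α` to the bundle of reduced `2`-jets: the second derivative
is the symmetrized derivative of `α` in a chart, which does not depend on the chart. -/
def jetOf (α : M → E →L[ℝ] ℝ) (x : M) : JetModel E := (α x, symmetrize E (formDeriv α x x))

theorem jetCoord_jetOf {α : M → E →L[ℝ] ℝ} {c x : M} (hα : FormSmoothAt α x)
    (hc : x ∈ (chartAt E c).source) :
    jetCoord c x (jetOf α x) = (locForm α c (chartAt E c x), symmetrize E (formDeriv α c x)) := by
  refine Prod.ext ?_ (SymForm.ext fun u w => ?_)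
  · rw [jetCoord_fst, locForm_apply α hc]
    rfl
  · rw [jetCoord_snd hc]
    simp only [jetOf, symmetrize_apply]
    rw [formDeriv_change_add hα hc (mem_chart_source E x) u w,
      formDeriv_change_add hα hc (mem_chart_source E x) w u, locForm_self]
    have := transition_symm (achart E x) (achart E c) (mem_chart_source E x) hc u w
    change fderiv ℝ (fderiv ℝ (transition (achart E x) (achart E c))) (chartAt E c x) u w =
      fderiv ℝ (fderiv ℝ (transition (achart E x) (achart E c))) (chartAt E c x) w u at this
    rw [this]
    ring

/-- The differential of a function, as a `1`-form. -/
def dForm (f : M → ℝ) (x : M) : E →L[ℝ] ℝ :=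
  fderiv ℝ (f ∘ (chartAt E x).symm) (chartAt E x x)

theorem locForm_dForm {f : M → ℝ} {c x : M} (hf : ContMDiffAt 𝓘(ℝ, E) 𝓘(ℝ, ℝ) ∞ f x)
    (hc : x ∈ (chartAt E c).source) :
    locForm (dForm f) c (chartAt E c x) = fderiv ℝ (f ∘ (chartAt E c).symm) (chartAt E c x) := by
  rw [locForm_apply _ hc]
  have ht : ContDiffAt ℝ ∞ (transition (achart E x) (achart E c)) (chartAt E c x) :=
    transition_contDiffAt (achart E x) (achart E c) (mem_chart_source E x) hc
  have hval : transition (achart E x) (achart E c) (chartAt E c x) = chartAt E x x := by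
    simp [transition, (chartAt E c).left_inv hc]
  have h1 : f ∘ (chartAt E c).symm =ᶠ[𝓝 (chartAt E c x)]
      (f ∘ (chartAt E x).symm) ∘ transition (achart E x) (achart E c) := by
    have hx : (chartAt E c).symm ⁻¹' (chartAt E x).source ∈ 𝓝 (chartAt E c x) :=
      (chartAt E c).symm.continuousAt ((chartAt E c).map_source hc) (by
        rw [(chartAt E c).left_inv hc]
        exact chart_source_mem_nhds E x)
    filter_upwards [hx] with y hy
    simp only [Function.comp, transition, coe_achart]
    rw [(chartAt E x).left_inv hy]
  have h2 : DifferentiableAt ℝ (f ∘ (chartAt E x).symm) (chartAt E x x) :=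
    (contDiffAt_comp_chart_symm (mem_chart_source E x) hf).differentiableAt (by simp)
  rw [h1.fderiv_eq, fderiv_comp _ (by rw [hval]; exact h2) (ht.differentiableAt (by simp)), hval]
  rfl

theorem locForm_dForm_eventually {f : M → ℝ} {c x : M}
    (hf : ∀ᶠ y in 𝓝 x, ContMDiffAt 𝓘(ℝ, E) 𝓘(ℝ, ℝ) ∞ f y) (hc : x ∈ (chartAt E c).source) :
    locForm (dForm f) c =ᶠ[𝓝 (chartAt E c x)] fderiv ℝ (f ∘ (chartAt E c).symm) := by
  have h1 := ((chartAt E c).symm.continuousAt ((chartAt E c).map_source hc)).eventually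
    (show ∀ᶠ z in 𝓝 ((chartAt E c).symm (chartAt E c x)),
      ContMDiffAt 𝓘(ℝ, E) 𝓘(ℝ, ℝ) ∞ f z by rw [(chartAt E c).left_inv hc]; exact hf)
  filter_upwards [h1, (chartAt E c).open_target.mem_nhds ((chartAt E c).map_source hc)] with y hy ht
  have := locForm_dForm hy ((chartAt E c).map_target ht)
  rwa [(chartAt E c).right_inv ht] at this

theorem formSmoothAt_dForm {f : M → ℝ} {x : M}
    (hf : ∀ᶠ y in 𝓝 x, ContMDiffAt 𝓘(ℝ, E) 𝓘(ℝ, ℝ) ∞ f y) : FormSmoothAt (E := E) (dForm f) x :=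
  ((contDiffAt_comp_chart_symm (mem_chart_source E x) hf.self_of_nhds).fderiv_right
    (by simp)).congr_of_eventuallyEq (locForm_dForm_eventually hf (mem_chart_source E x))

theorem jet2_eq_jetOf {f : M → ℝ} {x : M}
    (hf : ∀ᶠ y in 𝓝 x, ContMDiffAt 𝓘(ℝ, E) 𝓘(ℝ, ℝ) ∞ f y) : jet2 (E := E) f x = jetOf (dForm f) x := by
  unfold jetOf formDeriv
  rw [(locForm_dForm_eventually hf (mem_chart_source E x)).fderiv_eq]
  rfl

theorem formDeriv_dForm_symm {f : M → ℝ} {c x : M}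
    (hf : ∀ᶠ y in 𝓝 x, ContMDiffAt 𝓘(ℝ, E) 𝓘(ℝ, ℝ) ∞ f y) (hc : x ∈ (chartAt E c).source)
    (u v : E) : formDeriv (dForm f) c x u v = formDeriv (dForm f) c x v u := by
  unfold formDeriv
  rw [(locForm_dForm_eventually hf hc).fderiv_eq]
  exact (contDiffAt_comp_chart_symm hc hf.self_of_nhds).isSymmSndFDerivAt
    (by simpa using two_le_infty) u v

theorem jetOf_congr {α β : M → E →L[ℝ] ℝ} {x : M} (h : α =ᶠ[𝓝 x] β) : jetOf α x = jetOf β x := by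
  unfold jetOf formDeriv
  rw [(locForm_congr (mem_chart_source E x) h).fderiv_eq, h.eq_of_nhds]

/-- A section of the jet bundle is smooth at `x` if and only if its coordinates in a chart are. -/
theorem contMDiffAt_section_iff_jetCoord (σ : M → JetModel E) {c x : M}
    (hc : x ∈ (chartAt E c).source) :
    ContMDiffAt 𝓘(ℝ, E) (𝓘(ℝ, E).prod 𝓘(ℝ, JetModel E)) ∞
      (fun x => (⟨x, σ x⟩ : (jetCore E M).TotalSpace)) x ↔
    ContMDiffAt 𝓘(ℝ, E) 𝓘(ℝ, JetModel E) ∞ (fun y => jetCoord c y (σ y)) x :=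
  haveI : MemTrivializationAtlas ((jetCore E M).localTriv (achart E c)) := ⟨⟨_, rfl⟩⟩
  Bundle.Trivialization.contMDiffAt_section_iff (E := (jetCore E M).Fiber) (s := fun x => (σ x : (jetCore E M).Fiber x))
    ((jetCore E M).localTriv (achart E c)) hc

theorem continuousAt_jetCoord {Z : Type*} [TopologicalSpace Z] {p : Z → M} {σ : Z → JetModel E}
    (h : Continuous fun z => (⟨p z, σ z⟩ : (jetCore E M).TotalSpace)) {c : M} {z : Z}
    (hz : p z ∈ (chartAt E c).source) : ContinuousAt (fun z => jetCoord c (p z) (σ z)) z := by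
  have h1 : (⟨p z, σ z⟩ : (jetCore E M).TotalSpace) ∈
      ((jetCore E M).localTriv (achart E c)).source := by
    rw [Bundle.Trivialization.mem_source]
    exact hz
  have h2 := (((jetCore E M).localTriv (achart E c)).continuousAt h1).comp
    (f := fun z => (⟨p z, σ z⟩ : (jetCore E M).TotalSpace)) h.continuousAt
  exact continuous_snd.continuousAt.comp h2

/-- The canonical lift of a smooth `1`-form is a smooth section of the jet bundle. -/
theorem contMDiff_jetOf {α : M → E →L[ℝ] ℝ} (hα : ∀ x, FormSmoothAt α x) :
    ContMDiff 𝓘(ℝ, E) (𝓘(ℝ, E).prod 𝓘(ℝ, JetModel E)) ∞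
      fun x => (⟨x, jetOf α x⟩ : (jetCore E M).TotalSpace) := by
  intro x
  rw [contMDiffAt_section_iff_jetCoord _ (mem_chart_source E x)]
  have h1 : (fun y => jetCoord x y (jetOf α y)) =ᶠ[𝓝 x] fun y =>
      (locForm α x (chartAt E x y), symmetrize E (formDeriv α x y)) := by
    filter_upwards [chart_source_mem_nhds E x] with y hy
    exact jetCoord_jetOf (hα y) hy
  refine ContMDiffAt.congr_of_eventuallyEq ?_ h1
  have h2 : ContDiffAt ℝ ∞ (fun z => (locForm α x z, symmetrize E (fderiv ℝ (locForm α x) z)))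
      (chartAt E x x) := by
    have h3 : ContDiff ℝ ∞ (symmetrize E) :=
      ContinuousLinearMap.contDiff (𝕜 := ℝ) (E := Bil E) (F := SymForm E) (symmetrize E)
    have h4 : ContDiffAt ℝ ∞ (locForm α x) (chartAt E x x) := hα x
    exact h4.prodMk (h3.contDiffAt.comp _ (h4.fderiv_right (by simp)))
  exact h2.contMDiffAt.comp x (contMDiffAt_of_mem_maximalAtlas
    (IsManifold.chart_mem_maximalAtlas x) (mem_chart_source E x))

theorem MorseSection.derivForm_eq (s : MorseSection E M) (a : M) :
    s.derivForm a = formDeriv (fun x => (s.jet x).first) a a := by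
  rfl

end Jets

/-! ### Finite atlases and generating functions of the jet bundle -/

section Cover

variable (E M) in
/-- A finite atlas of a compact manifold, with a subordinate smooth partition of unity `part` and
with cutoff functions `cut` which are supported in the charts and equal to `1` near the supports
of the partition of unity. -/
structure ChartCover where
  /-- The number of charts. -/
  N : ℕ
  /-- The points at which the preferred charts are taken. -/
  center : Fin N → M
  /-- The cutoff functions. -/
  cut : Fin N → M → ℝ
  /-- The partition of unity. -/
  part : Fin N → M → ℝ
  cut_smooth : ∀ j, ContMDiff 𝓘(ℝ, E) 𝓘(ℝ, ℝ) ∞ (cut j)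
  part_smooth : ∀ j, ContMDiff 𝓘(ℝ, E) 𝓘(ℝ, ℝ) ∞ (part j)
  tsupport_cut : ∀ j, tsupport (cut j) ⊆ (chartAt E (center j)).source
  cut_eq_one : ∀ j, ∀ x ∈ tsupport (part j), cut j =ᶠ[𝓝 x] 1
  part_nonneg : ∀ j x, 0 ≤ part j x
  part_sum : ∀ x, ∑ j, part j x = 1

theorem exists_chartCover [T2Space M] [CompactSpace M] : Nonempty (ChartCover E M) := by
  let b : ∀ x : M, SmoothBumpFunction 𝓘(ℝ, E) x := fun x => Classical.choice inferInstance
  have hb : ∀ x : M, {y | b x y = 1} ∈ 𝓝 x := fun x => (b x).eventuallyEq_one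
  obtain ⟨t, -, ht⟩ := isCompact_univ.elim_nhds_subcover (fun x : M => interior {y | b x y = 1})
    fun x _ => interior_mem_nhds.2 (hb x)
  let c : Fin t.card → M := fun j => (t.equivFin.symm j : M)
  obtain ⟨f, hf⟩ := SmoothPartitionOfUnity.exists_isSubordinate 𝓘(ℝ, E) (s := (univ : Set M))
    isClosed_univ (fun j : Fin t.card => interior {y | b (c j) y = 1}) (fun _ => isOpen_interior)
    (by
      intro x hx
      obtain ⟨z, hz, hxz⟩ := mem_iUnion₂.1 (ht hx)
      refine mem_iUnion.2 ⟨t.equivFin ⟨z, hz⟩, ?_⟩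
      have e : c (t.equivFin ⟨z, hz⟩) = z := by simp [c]
      exact (congrArg (fun w => interior {y | b w y = 1}) e).symm ▸ hxz)
  refine ⟨⟨t.card, c, fun j => b (c j), fun j => f j, fun j => (b (c j)).contMDiff,
    fun j => (f j).contMDiff, fun j => (b (c j)).tsupport_subset_chartAt_source, fun j x hx => ?_,
    fun j x => f.nonneg j x, fun x => ?_⟩⟩
  · exact mem_interior_iff_mem_nhds.1 (hf j hx)
  · rw [← finsum_eq_sum_of_fintype]
    exact f.sum_eq_one (mem_univ x)

/-- The polynomial of degree two with linear part `q.1` and quadratic part `½ q.2`. -/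
def polyFun (q : JetModel E) (y : E) : ℝ := q.1 y + (1 / 2 : ℝ) * q.2.toBil y y

theorem contDiff_polyFun (q : JetModel E) : ContDiff ℝ ∞ (polyFun q) :=
  q.1.contDiff.add (contDiff_const.mul ((q.2.toBil.contDiff).clm_apply contDiff_id))

/-- The `2`-jet at `y` of the polynomial `polyFun q`. -/
def polyJet (y : E) (q : JetModel E) : JetModel E := (q.1 + q.2.toBil y, q.2)

/-- The polynomial with a given `2`-jet at `y`. -/
def polyOfJet (y : E) (v : JetModel E) : JetModel E := (v.1 - v.2.toBil y, v.2)

theorem polyJet_polyOfJet (y : E) (v : JetModel E) : polyJet y (polyOfJet y v) = v := by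
  simp [polyJet, polyOfJet]

theorem fderiv_polyFun (q : JetModel E) : fderiv ℝ (polyFun q) = fun y => q.1 + q.2.toBil y := by
  funext y
  have h1 : HasFDerivAt (fun y => q.2.toBil y y) _ y :=
    (q.2.toBil.hasFDerivAt).clm_apply (hasFDerivAt_id y)
  have h2 := q.1.hasFDerivAt.add (x := y) (h1.const_mul (1 / 2 : ℝ))
  have h3 : fderiv ℝ (polyFun q) y = _ := h2.fderiv
  rw [h3]
  ext v
  simp [q.2.symm v y]
  ring

theorem fderiv_fderiv_polyFun (q : JetModel E) (y : E) :
    fderiv ℝ (fderiv ℝ (polyFun q)) y = q.2.toBil := by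
  rw [fderiv_polyFun, fderiv_const_add]
  exact q.2.toBil.fderiv

variable (C : ChartCover E M)

namespace ChartCover

/-- The index set of the generating functions of a cover. -/
abbrev Index : Type := Fin C.N × Fin (Module.finrank ℝ (JetModel E))

/-- The generating functions of a cover: their `2`-jets span all the reduced `2`-jets. -/
def genFun (k : C.Index) (x : M) : ℝ :=
  C.cut k.1 x * polyFun (Module.finBasis ℝ (JetModel E) k.2) (chartAt E (C.center k.1) x)

theorem contMDiff_genFun (k : C.Index) : ContMDiff 𝓘(ℝ, E) 𝓘(ℝ, ℝ) ∞ (C.genFun k) := by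
  refine contMDiff_of_tsupport fun x hx => ?_
  have hx' : x ∈ (chartAt E (C.center k.1)).source := by
    refine C.tsupport_cut k.1 (closure_mono (fun y hy => ?_) hx)
    exact left_ne_zero_of_mul hy
  refine (C.cut_smooth k.1 x).mul ?_
  exact ((contDiff_polyFun _).contMDiff _).comp x (contMDiffAt_of_mem_maximalAtlas
    (IsManifold.chart_mem_maximalAtlas _) hx')

theorem contMDiffAt_genFun (k : C.Index) (x : M) :
    ∀ᶠ y in 𝓝 x, ContMDiffAt 𝓘(ℝ, E) 𝓘(ℝ, ℝ) ∞ (C.genFun k) y :=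
  Filter.Eventually.of_forall fun y => C.contMDiff_genFun k y

/-- The differential of the linear combination of the generating functions with the
coefficients `p`. -/
def form (p : C.Index → ℝ) (x : M) : E →L[ℝ] ℝ := ∑ k, p k • dForm (C.genFun k) x

/-- The reduced `2`-jet of the linear combination of the generating functions with the
coefficients `p`. -/
def toJet (p : C.Index → ℝ) (x : M) : JetModel E := ∑ k, p k • jetOf (dForm (C.genFun k)) x

theorem toJet_fst (p : C.Index → ℝ) (x : M) : (C.toJet p x).1 = C.form p x := by
  simp [toJet, form, Prod.fst_sum, jetOf]

theorem form_add (p q : C.Index → ℝ) (x : M) : C.form (p + q) x = C.form p x + C.form q x := by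
  simp [form, add_smul, Finset.sum_add_distrib]

theorem form_smul (r : ℝ) (p : C.Index → ℝ) (x : M) : C.form (r • p) x = r • C.form p x := by
  simp [form, Finset.smul_sum, smul_smul]

theorem formSmoothAt_dForm_genFun (k : C.Index) (x : M) :
    FormSmoothAt (E := E) (dForm (C.genFun k)) x :=
  formSmoothAt_dForm (C.contMDiffAt_genFun k x)

theorem locForm_sum {K : Type*} (s : Finset K) (α : K → M → E →L[ℝ] ℝ) (c : M) (y : E) :
    locForm (fun x => ∑ k ∈ s, α k x) c y = ∑ k ∈ s, locForm (α k) c y := by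
  simp only [locForm]
  ext v
  simp

theorem locForm_form (w : M → C.Index → ℝ) (c : M) (y : E) :
    locForm (fun x => C.form (w x) x) c y =
      ∑ k, w ((chartAt E c).symm y) k • locForm (dForm (C.genFun k)) c y := by
  unfold form
  rw [locForm_sum]
  exact Finset.sum_congr rfl fun k _ => locForm_smul (fun x => w x k) _ c y

theorem formSmoothAt_form {w : M → C.Index → ℝ} {x : M}
    (hw : ContMDiffAt 𝓘(ℝ, E) 𝓘(ℝ, C.Index → ℝ) ∞ w x) :
    FormSmoothAt (fun x => C.form (w x) x) x := by
  unfold FormSmoothAt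
  rw [show locForm (fun x => C.form (w x) x) x = _ from funext (C.locForm_form w x)]
  refine ContDiffAt.sum fun k _ => ?_
  have h1 : ContDiffAt ℝ ∞ (fun y => w ((chartAt E x).symm y) k) (chartAt E x x) :=
    contDiffAt_comp_chart_symm (g := fun x => w x k) (mem_chart_source E x)
      (contMDiffAt_pi_space.1 hw k)
  have h2 : ContDiffAt ℝ ∞ (locForm (dForm (C.genFun k)) x) (chartAt E x x) :=
    C.formSmoothAt_dForm_genFun k x
  exact h1.smul h2

/-- The coefficients of the generating functions of the `j`-th chart which give a polynomial. -/
def single (j : Fin C.N) (q : JetModel E) : C.Index → ℝ :=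
  fun k => if k.1 = j then (Module.finBasis ℝ (JetModel E)).repr q k.2 else 0

theorem genFun_comp_symm_eventually {k : C.Index} {x : M} (hx : C.cut k.1 =ᶠ[𝓝 x] 1)
    (hxs : x ∈ (chartAt E (C.center k.1)).source) :
    C.genFun k ∘ (chartAt E (C.center k.1)).symm =ᶠ[𝓝 (chartAt E (C.center k.1) x)]
      polyFun (Module.finBasis ℝ (JetModel E) k.2) := by
  have h1 := ((chartAt E (C.center k.1)).symm.continuousAt
    ((chartAt E (C.center k.1)).map_source hxs)).eventually
    (show ∀ᶠ z in 𝓝 ((chartAt E (C.center k.1)).symm (chartAt E (C.center k.1) x)),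
      C.cut k.1 z = 1 by rw [(chartAt E (C.center k.1)).left_inv hxs]; exact hx)
  filter_upwards [h1, (chartAt E (C.center k.1)).open_target.mem_nhds
    ((chartAt E (C.center k.1)).map_source hxs)] with y hy hyt
  simp [genFun, hy, (chartAt E (C.center k.1)).right_inv hyt]

theorem mem_source_of_cut {j : Fin C.N} {x : M} (hx : C.cut j =ᶠ[𝓝 x] 1) :
    x ∈ (chartAt E (C.center j)).source :=
  C.tsupport_cut j (subset_tsupport _ (by
    rw [Function.mem_support, hx.eq_of_nhds]
    exact one_ne_zero))

theorem locForm_genFun_eventually {k : C.Index} {x : M} (hx : C.cut k.1 =ᶠ[𝓝 x] 1) :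
    locForm (dForm (C.genFun k)) (C.center k.1) =ᶠ[𝓝 (chartAt E (C.center k.1) x)]
      fun y => (polyJet y (Module.finBasis ℝ (JetModel E) k.2)).1 := by
  have hxs := C.mem_source_of_cut hx
  have h1 := locForm_dForm_eventually (E := E) (C.contMDiffAt_genFun k x) hxs
  have h2 := (C.genFun_comp_symm_eventually hx hxs).fderiv (𝕜 := ℝ)
  refine (h1.trans h2).trans (Filter.EventuallyEq.of_eq ?_)
  rw [fderiv_polyFun]
  rfl

theorem jetCoord_jetOf_genFun {k : C.Index} {x : M} (hx : C.cut k.1 =ᶠ[𝓝 x] 1) :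
    jetCoord (C.center k.1) x (jetOf (dForm (C.genFun k)) x) =
      polyJet (chartAt E (C.center k.1) x) (Module.finBasis ℝ (JetModel E) k.2) := by
  have hxs := C.mem_source_of_cut hx
  rw [jetCoord_jetOf (C.formSmoothAt_dForm_genFun k x) hxs]
  have h1 := C.locForm_genFun_eventually hx
  refine Prod.ext h1.eq_of_nhds (SymForm.ext fun u v => ?_)
  have h2 : formDeriv (dForm (C.genFun k)) (C.center k.1) x =
      ((Module.finBasis ℝ (JetModel E)) k.2).2.toBil := by
    unfold formDeriv
    rw [h1.fderiv_eq]
    have := fderiv_fderiv_polyFun ((Module.finBasis ℝ (JetModel E)) k.2)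
      (chartAt E (C.center k.1) x)
    rwa [fderiv_polyFun] at this
  rw [h2, symmetrize_coe _ fun u v => SymForm.symm _ u v]
  rfl

theorem polyJet_sum_smul {K : Type*} (s : Finset K) (y : E) (r : K → ℝ) (q : K → JetModel E) :
    polyJet y (∑ k ∈ s, r k • q k) = ∑ k ∈ s, r k • polyJet y (q k) := by
  let L : JetModel E →ₗ[ℝ] JetModel E :=
    { toFun := polyJet y
      map_add' := fun a b => by
        refine Prod.ext ?_ rfl
        ext v
        change (a.1 v + b.1 v) + (a.2.toBil y v + b.2.toBil y v) =
          (a.1 v + a.2.toBil y v) + (b.1 v + b.2.toBil y v)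
        ring
      map_smul' := fun r a => by
        refine Prod.ext ?_ rfl
        ext v
        change r * a.1 v + r * a.2.toBil y v = r * (a.1 v + a.2.toBil y v)
        ring }
  have : ∀ q, polyJet y q = L q := fun _ => rfl
  simp only [this, map_sum, map_smul]

/-- The generating functions of the `j`-th chart realize all the jets at the points where the
cutoff function is `1`. -/
theorem jetCoord_toJet_single {j : Fin C.N} {x : M} (hx : C.cut j =ᶠ[𝓝 x] 1) (q : JetModel E) :
    jetCoord (C.center j) x (C.toJet (C.single j q) x) =
      polyJet (chartAt E (C.center j) x) q := by
  have h1 : C.toJet (C.single j q) x =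
      ∑ i, (Module.finBasis ℝ (JetModel E)).repr q i • jetOf (dForm (C.genFun (j, i))) x := by
    unfold toJet single
    rw [Fintype.sum_prod_type, Finset.sum_eq_single j]
    · simp
    · intro l _ hl
      simp [hl]
    · simp
  rw [h1]
  unfold jetCoord
  rw [map_sum]
  simp only [map_smul]
  have h2 : ∀ i, jetCoordChange (achart E x) (achart E (C.center j)) x
      (jetOf (dForm (C.genFun (j, i))) x) =
      polyJet (chartAt E (C.center j) x) (Module.finBasis ℝ (JetModel E) i) := fun i =>
    C.jetCoord_jetOf_genFun (k := (j, i)) hx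
  simp only [h2]
  rw [← polyJet_sum_smul, (Module.finBasis ℝ (JetModel E)).sum_repr]

theorem toJet_smul (r : ℝ) (p : C.Index → ℝ) (x : M) :
    C.toJet (r • p) x = r • C.toJet p x := by
  simp [toJet, Finset.smul_sum, smul_smul]

theorem toJet_sum {K : Type*} (s : Finset K) (p : K → C.Index → ℝ) (x : M) :
    C.toJet (∑ k ∈ s, p k) x = ∑ k ∈ s, C.toJet (p k) x := by
  simp only [toJet, Finset.sum_apply, Finset.sum_smul]
  rw [Finset.sum_comm]

/-- Coefficients with which the generating functions represent the jet `v` at `x`; they depend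
linearly on `v` and smoothly on `x`. -/
def coeff (x : M) (v : JetModel E) : C.Index → ℝ :=
  ∑ j, C.part j x • C.single j (polyOfJet (chartAt E (C.center j) x) (jetCoord (C.center j) x v))

theorem toJet_coeff (x : M) (v : JetModel E) : C.toJet (C.coeff x v) x = v := by
  unfold coeff
  rw [toJet_sum]
  have h : ∀ j, C.toJet (C.part j x • C.single j (polyOfJet (chartAt E (C.center j) x)
      (jetCoord (C.center j) x v))) x = C.part j x • v := by
    intro j
    rw [toJet_smul]
    by_cases h0 : C.part j x = 0
    · simp [h0]
    · have hx := C.cut_eq_one j x (subset_tsupport _ h0)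
      congr 1
      refine jetCoord_injective (C.mem_source_of_cut hx) ?_
      rw [C.jetCoord_toJet_single hx, polyJet_polyOfJet]
  simp only [h, ← Finset.sum_smul, C.part_sum, one_smul]

/-- `ChartCover.single`, as a continuous linear map. -/
def singleL (j : Fin C.N) : JetModel E →L[ℝ] (C.Index → ℝ) :=
  LinearMap.toContinuousLinearMap
    { toFun := C.single j
      map_add' := fun a b => by
        funext k
        by_cases h : k.1 = j <;> simp [single, h]
      map_smul' := fun r a => by
        funext k
        by_cases h : k.1 = j <;> simp [single, h] }

/-- The map `(y, v) ↦ polyOfJet y v` is smooth. -/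
theorem contDiff_polyOfJet : ContDiff ℝ ∞ fun z : E × JetModel E => polyOfJet z.1 z.2 := by
  let B : SymForm E →L[ℝ] Bil E := LinearMap.toContinuousLinearMap (E := SymForm E) (F' := Bil E)
    { toFun := fun q : SymForm E => q.toBil
      map_add' := fun _ _ => rfl
      map_smul' := fun _ _ => rfl }
  have h1 : ContDiff ℝ ∞ fun z : E × JetModel E => z.2.2 := contDiff_snd.comp contDiff_snd
  have hB : ContDiff ℝ ∞ B :=
    ContinuousLinearMap.contDiff (𝕜 := ℝ) (E := SymForm E) (F := Bil E) B
  have h2 : ContDiff ℝ ∞ fun z : E × JetModel E => B z.2.2 z.1 :=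
    (hB.comp h1).clm_apply contDiff_fst
  exact ((contDiff_fst.comp contDiff_snd).sub h2).prodMk h1

theorem mem_source_of_part {j : Fin C.N} {x : M} (hx : x ∈ tsupport (C.part j)) :
    x ∈ (chartAt E (C.center j)).source := C.mem_source_of_cut (C.cut_eq_one j x hx)

theorem continuous_coeff {Z : Type*} [TopologicalSpace Z] {p : Z → M} {σ : Z → JetModel E}
    (hp : Continuous p) (h : Continuous fun z => (⟨p z, σ z⟩ : (jetCore E M).TotalSpace)) :
    Continuous fun z => C.coeff (p z) (σ z) := by
  refine continuous_finsetSum _ fun j _ => continuous_iff_continuousAt.2 fun z => ?_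
  by_cases hz : p z ∈ tsupport (C.part j)
  · have hs := C.mem_source_of_part hz
    refine ((C.part_smooth j).continuous.comp hp).continuousAt.smul ?_
    refine (C.singleL j).continuous.continuousAt.comp ?_
    exact contDiff_polyOfJet.continuous.continuousAt.comp
      ((((chartAt E (C.center j)).continuousAt hs).comp hp.continuousAt).prodMk
        (continuousAt_jetCoord h hs))
  · have : ∀ᶠ y in 𝓝 z, p y ∉ tsupport (C.part j) :=
      hp.continuousAt.eventually ((isClosed_tsupport _).isOpen_compl.mem_nhds hz)
    refine (continuousAt_const (y := (0 : C.Index → ℝ))).congr ?_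
    filter_upwards [this] with y hy
    rw [image_eq_zero_of_notMem_tsupport hy, zero_smul]

theorem contMDiff_coeff {σ : M → JetModel E}
    (h : ContMDiff 𝓘(ℝ, E) (𝓘(ℝ, E).prod 𝓘(ℝ, JetModel E)) ∞
      fun x => (⟨x, σ x⟩ : (jetCore E M).TotalSpace)) :
    ContMDiff 𝓘(ℝ, E) 𝓘(ℝ, C.Index → ℝ) ∞ fun x => C.coeff x (σ x) := by
  refine contMDiff_finsetSum fun j _ x => ?_
  by_cases hx : x ∈ tsupport (C.part j)
  · have hs := C.mem_source_of_part hx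
    refine (C.part_smooth j x).smul ?_
    refine ((C.singleL j).contDiff.contMDiff _).comp x ?_
    have h1 := (contMDiffAt_section_iff_jetCoord σ hs).1 (h x)
    have h2 : ContMDiffAt 𝓘(ℝ, E) 𝓘(ℝ, E) ∞ (chartAt E (C.center j)) x :=
      contMDiffAt_of_mem_maximalAtlas (IsManifold.chart_mem_maximalAtlas _) hs
    exact (contDiff_polyOfJet.contMDiff _).comp x (h2.prodMk_space h1)
  · refine (contMDiffAt_const (c := (0 : C.Index → ℝ))).congr_of_eventuallyEq ?_
    filter_upwards [(isClosed_tsupport _).isOpen_compl.mem_nhds hx] with y hy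
    rw [image_eq_zero_of_notMem_tsupport hy, zero_smul]

end ChartCover

end Cover

/-! ### Generic transversality -/

section Generic

theorem isOpen_bijective : IsOpen {B : Bil E | Function.Bijective B} := by
  have h : {B : Bil E | Function.Bijective B} = {B : Bil E |
      (LinearMap.BilinForm.toMatrix (Module.finBasis ℝ E) B.toBilinForm).det ≠ 0} := by
    ext B
    change Function.Bijective B ↔ _
    rw [← bilSign_ne_zero_iff, bilSign, Ne, sign_eq_zero_iff]
    rfl
  rw [h]
  refine isOpen_ne_fun (Continuous.matrix_det ?_) continuous_const
  refine continuous_matrix fun i j => ?_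
  simp only [LinearMap.BilinForm.toMatrix_apply, ContinuousLinearMap.toBilinForm_apply]
  fun_prop

/-- The critical values of a smooth map from an open subset of a vector space to the dual form a
set with a dense complement (Sard's theorem in equal dimensions). -/
theorem dense_regularValues {g : E → E →L[ℝ] ℝ} {T : Set E} (hT : IsOpen T)
    (hg : ContDiffOn ℝ ∞ g T) :
    Dense {ξ : E →L[ℝ] ℝ | ∀ y ∈ T, g y = ξ → Function.Bijective (fderiv ℝ g y)} := by
  let _ : MeasurableSpace E := borel E
  have _ : BorelSpace E := ⟨rfl⟩
  let e : (E →L[ℝ] ℝ) ≃L[ℝ] E := ContinuousLinearEquiv.ofFinrankEq finrank_dual_clm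
  set S : Set E := {y | y ∈ T ∧ ¬ Function.Bijective (fderiv ℝ g y)} with hS
  have hd : ∀ y ∈ S, HasFDerivWithinAt (fun y => e (g y))
      ((e : (E →L[ℝ] ℝ) →L[ℝ] E).comp (fderiv ℝ g y)) S y := fun y hy =>
    (e.hasFDerivAt.comp y (((hg y hy.1).contDiffAt
      (hT.mem_nhds hy.1)).differentiableAt (by simp)).hasFDerivAt).hasFDerivWithinAt
  have hnull := MeasureTheory.addHaar_image_eq_zero_of_det_fderivWithin_eq_zero
    MeasureTheory.Measure.addHaar hd (fun y hy => by
      by_contra h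
      refine hy.2 ?_
      have h1 := (LinearMap.equivOfDetNeZero _ h).bijective
      have h2 : ⇑(fderiv ℝ g y) = e.symm ∘ fun v => e (fderiv ℝ g y v) := by
        funext v
        simp
      rw [h2]
      exact e.symm.bijective.comp h1)
  have hdense : Dense ((fun y => e (g y)) '' S)ᶜ :=
    interior_eq_empty_iff_dense_compl.1
      (MeasureTheory.Measure.addHaar.interior_eq_empty_of_null hnull)
  have h3 : {ξ : E →L[ℝ] ℝ | ∀ y ∈ T, g y = ξ → Function.Bijective (fderiv ℝ g y)} =
      e ⁻¹' ((fun y => e (g y)) '' S)ᶜ := by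
    ext ξ
    refine ⟨fun h => ?_, fun h y hy hyξ => ?_⟩
    · rintro ⟨y, hy, hyξ⟩
      exact hy.2 (h y hy.1 (e.injective hyξ))
    · by_contra hb
      exact h ⟨y, ⟨hy, hb⟩, congrArg e hyξ⟩
  rw [h3]
  exact hdense.preimage e.toHomeomorph.isOpenMap

namespace ChartCover

variable (C : ChartCover E M)

theorem formSmoothAt_add_form {α : M → E →L[ℝ] ℝ} (hα : ∀ x, FormSmoothAt α x) {g : M → ℝ}
    (hg : ContMDiff 𝓘(ℝ, E) 𝓘(ℝ, ℝ) ∞ g) (p : C.Index → ℝ) (x : M) :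
    FormSmoothAt (fun x => α x + g x • C.form p x) x :=
  (hα x).add ((C.formSmoothAt_form (w := fun _ => p) contMDiffAt_const).smul (hg x))

theorem locForm_add_form (α : M → E →L[ℝ] ℝ) (g : M → ℝ) (p : C.Index → ℝ) (c : M) (y : E) :
    locForm (fun x => α x + g x • C.form p x) c y = locForm α c y +
      ∑ k, p k • locForm (fun x => g x • dForm (C.genFun k) x) c y := by
  have h1 := locForm_add α (fun x => g x • C.form p x) c y
  have h2 : (fun x => g x • C.form p x) = fun x => ∑ k, p k • (g x • dForm (C.genFun k) x) := by
    funext x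
    simp only [form, Finset.smul_sum]
    exact Finset.sum_congr rfl fun k _ => smul_comm _ _ _
  change locForm (α + fun x => g x • C.form p x) c y = _
  rw [h1, h2, locForm_sum]
  congr 1

/-- Being transverse to the zero section over a closed set is an open condition. -/
theorem isOpen_nondegOn [CompactSpace M] {α : M → E →L[ℝ] ℝ} (hα : ∀ x, FormSmoothAt α x)
    {g : M → ℝ} (hg : ContMDiff 𝓘(ℝ, E) 𝓘(ℝ, ℝ) ∞ g) {K : Set M} (hK : IsClosed K) :
    IsOpen {p : C.Index → ℝ | NondegOn (fun x => α x + g x • C.form p x) K} := by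
  refine isOpen_iff_mem_nhds.2 fun p hp => ?_
  set β : (C.Index → ℝ) → M → E →L[ℝ] ℝ := fun p x => α x + g x • C.form p x with hβ
  have hβs : ∀ p x, FormSmoothAt (β p) x := fun p x => C.formSmoothAt_add_form hα hg p x
  set γ : C.Index → M → E →L[ℝ] ℝ := fun k x => g x • dForm (C.genFun k) x with hγ
  have hγs : ∀ k x, FormSmoothAt (γ k) x := fun k x => (C.formSmoothAt_dForm_genFun k x).smul (hg x)
  have key : ∀ x ∈ (univ : Set M), ∀ᶠ z : (C.Index → ℝ) × M in 𝓝 (p, x),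
      z.2 ∈ K → β z.1 z.2 = 0 → Function.Bijective (formDeriv (β z.1) z.2 z.2) := by
    intro x _
    by_cases hxK : x ∈ K
    swap
    · filter_upwards [continuous_snd.continuousAt.eventually
        (show ∀ᶠ y in 𝓝 (p, x).2, y ∉ K from hK.isOpen_compl.mem_nhds hxK)] with z hz h
      exact absurd h hz
    have hsrc : ∀ᶠ z : (C.Index → ℝ) × M in 𝓝 (p, x), z.2 ∈ (chartAt E x).source :=
      continuous_snd.continuousAt.eventually (chart_source_mem_nhds E x)
    have hφ : ContinuousAt (fun z : (C.Index → ℝ) × M => chartAt E x z.2) (p, x) :=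
      ContinuousAt.comp (g := chartAt E x) ((chartAt E x).continuousAt (mem_chart_source E x))
        continuousAt_snd
    have hp' : ∀ k, ContinuousAt (fun z : (C.Index → ℝ) × M => z.1 k) (p, x) := fun k =>
      ((continuous_apply k).comp continuous_fst).continuousAt
    by_cases h0 : β p x = 0
    · have hb := hp x hxK h0
      have hc : ContinuousAt (fun z : (C.Index → ℝ) × M => formDeriv α x z.2 +
          ∑ k, z.1 k • formDeriv (γ k) x z.2) (p, x) := by
        have h1 : ∀ {δ : M → E →L[ℝ] ℝ} (_ : FormSmoothAt δ x), ContinuousAt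
            (fun z : (C.Index → ℝ) × M => formDeriv δ x z.2) (p, x) := fun {δ} hδ =>
          ContinuousAt.comp (g := fderiv ℝ (locForm δ x))
            (ContDiffAt.fderiv_right (m := 0) hδ (by simp)).continuousAt hφ
        have _ : ContinuousAdd (Bil E) := 
          (SeminormedAddCommGroup.toIsTopologicalAddGroup (E := Bil E)).toContinuousAdd
        exact (h1 (hα x)).add (tendsto_finsetSum _ fun k _ => (hp' k).smul (h1 (hγs k x)))
      have he : ∀ z : (C.Index → ℝ) × M, z.2 ∈ (chartAt E x).source →
          formDeriv (β z.1) x z.2 = formDeriv α x z.2 + ∑ k, z.1 k • formDeriv (γ k) x z.2 := by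
        intro z hz
        have h2 : HasFDerivAt (fun y => locForm α x y + ∑ k, z.1 k • locForm (γ k) x y)
            (formDeriv α x z.2 + ∑ k, z.1 k • formDeriv (γ k) x z.2) (chartAt E x z.2) :=
          (((hα z.2).chart hz).differentiableAt (by simp)).hasFDerivAt.add
            (HasFDerivAt.fun_sum fun k _ => ((((hγs k z.2).chart hz).differentiableAt
              (by simp)).hasFDerivAt.const_smul (z.1 k)))
        rw [← h2.fderiv]
        unfold formDeriv
        congr 1
        funext y
        exact C.locForm_add_form α g z.1 x y
      have hb' : formDeriv α x x + ∑ k, p k • formDeriv (γ k) x x ∈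
          {B : Bil E | Function.Bijective B} := by
        rw [← he (p, x) (mem_chart_source E x)]
        exact hb
      filter_upwards [hsrc, hc.eventually (isOpen_bijective.mem_nhds hb')] with z hz hzb _ hz0
      rw [formDeriv_bijective_change (hβs _ _) (mem_chart_source E z.2) hz hz0, he z hz]
      exact hzb
    · have hc : ContinuousAt (fun z : (C.Index → ℝ) × M => locForm α x (chartAt E x z.2) +
          ∑ k, z.1 k • locForm (γ k) x (chartAt E x z.2)) (p, x) := by
        have h1 : ∀ {δ : M → E →L[ℝ] ℝ} (_ : FormSmoothAt δ x), ContinuousAt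
            (fun z : (C.Index → ℝ) × M => locForm δ x (chartAt E x z.2)) (p, x) := fun {δ} hδ =>
          ContinuousAt.comp (g := locForm δ x) (ContDiffAt.continuousAt hδ) hφ
        exact (h1 (hα x)).add (tendsto_finsetSum _ fun k _ => (hp' k).smul (h1 (hγs k x)))
      have hne : locForm α x (chartAt E x x) + ∑ k, p k • locForm (γ k) x (chartAt E x x) ≠ 0 := by
        rw [← C.locForm_add_form α g p x]
        exact (locForm_eq_zero_iff (β p) (mem_chart_source E x)).not.2 h0
      filter_upwards [hsrc, hc.eventually_ne hne] with z hz hzn _ hz0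
      refine absurd ?_ hzn
      rw [← C.locForm_add_form α g z.1 x]
      exact (locForm_eq_zero_iff (β z.1) hz).2 hz0
  filter_upwards [isCompact_univ.eventually_forall_of_forall_eventually
    (P := fun (q : C.Index → ℝ) (x : M) =>
      x ∈ K → β q x = 0 → Function.Bijective (formDeriv (β q) x x)) key] with q hq
  exact fun x hx h0 => hq x (mem_univ x) hx h0

/-- Adding the constant covector `ξ` in the `j`-th chart. -/
theorem locForm_single_eventually {j : Fin C.N} {x : M} (hx : C.cut j =ᶠ[𝓝 x] 1)
    (ξ : E →L[ℝ] ℝ) :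
    locForm (C.form (C.single j (ξ, 0))) (C.center j) =ᶠ[𝓝 (chartAt E (C.center j) x)]
      fun _ => ξ := by
  have hxs := C.mem_source_of_cut hx
  have h1 := ((chartAt E (C.center j)).symm.continuousAt
    ((chartAt E (C.center j)).map_source hxs)).eventually
    (show ∀ᶠ z in 𝓝 ((chartAt E (C.center j)).symm (chartAt E (C.center j) x)),
      C.cut j =ᶠ[𝓝 z] 1 by
        rw [(chartAt E (C.center j)).left_inv hxs]; exact hx.eventuallyEq_nhds)
  filter_upwards [h1, (chartAt E (C.center j)).open_target.mem_nhds
    ((chartAt E (C.center j)).map_source hxs)] with y hy hyt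
  have h2 := C.jetCoord_toJet_single hy (ξ, 0)
  have h3 := congrArg Prod.fst h2
  rw [jetCoord_fst, C.toJet_fst] at h3
  unfold locForm
  rw [h3]
  simp only [polyJet]
  ext v
  change ξ v + 0 = ξ v
  rw [add_zero]

/-- Over the support of the `j`-th function of the partition of unity, constant covectors in the
`j`-th chart belong to the perturbations, so that Sard's theorem applies in this chart. -/
theorem dense_nondegOn_tsupport {α : M → E →L[ℝ] ℝ} (hα : ∀ x, FormSmoothAt α x) (j : Fin C.N) :
    Dense {p : C.Index → ℝ |
      NondegOn (fun x => α x + (1 : ℝ) • C.form p x) (tsupport (C.part j))} := by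
  intro p
  have hβs : ∀ p x, FormSmoothAt (fun x => α x + (1 : ℝ) • C.form p x) x := fun p x =>
    C.formSmoothAt_add_form hα (g := fun _ => 1) contMDiff_const p x
  set β : (C.Index → ℝ) → M → E →L[ℝ] ℝ := fun p x => α x + (1 : ℝ) • C.form p x with hβ
  have hd := dense_regularValues (chartAt E (C.center j)).open_target
    (FormSmoothAt.contDiffOn (hβs p) (C.center j))
  refine mem_closure_iff_nhds.2 fun U hU => ?_
  have hc : Continuous fun ξ : E →L[ℝ] ℝ => p - C.singleL j (ξ, 0) := by fun_prop
  have hU' : (fun ξ : E →L[ℝ] ℝ => p - C.singleL j (ξ, 0)) ⁻¹' U ∈ 𝓝 (0 : E →L[ℝ] ℝ) := by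
    refine hc.continuousAt.preimage_mem_nhds ?_
    have : p - C.singleL j ((0 : E →L[ℝ] ℝ), 0) = p := by
      rw [show ((0 : E →L[ℝ] ℝ), (0 : SymForm E)) = 0 from rfl, map_zero, sub_zero]
    rwa [this]
  obtain ⟨ξ, hξU, hξ⟩ := mem_closure_iff_nhds.1 (hd 0) _ hU'
  refine ⟨_, hξU, fun x hx h0 => ?_⟩
  have hcut := C.cut_eq_one j x hx
  have hxs := C.mem_source_of_cut hcut
  rw [formDeriv_bijective_change (hβs _ x) (mem_chart_source E x) hxs h0]
  have he : locForm (β (p - C.singleL j (ξ, 0))) (C.center j) =ᶠ[𝓝 (chartAt E (C.center j) x)]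
      fun y => locForm (β p) (C.center j) y - ξ := by
    filter_upwards [C.locForm_single_eventually hcut ξ] with y hy
    have h1 : β (p - C.singleL j (ξ, 0)) =
        β p + fun x => (-1 : ℝ) • C.form (C.single j (ξ, 0)) x := by
      funext x
      have e1 : p - C.singleL j (ξ, 0) = p + (-1 : ℝ) • C.single j (ξ, 0) := by
        rw [neg_one_smul, ← sub_eq_add_neg]
        rfl
      simp only [hβ, Pi.add_apply]
      rw [e1, C.form_add, C.form_smul, one_smul, one_smul, add_assoc]
    have h2 := locForm_smul (fun _ => (-1 : ℝ)) (C.form (C.single j (ξ, 0))) (C.center j) y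
    rw [h1, locForm_add, h2, hy]
    ext v
    change _ + (-1 : ℝ) * ξ v = _ - ξ v
    ring
  have h0' := (locForm_eq_zero_iff (β (p - C.singleL j (ξ, 0))) hxs).2 h0
  rw [he.eq_of_nhds] at h0'
  unfold formDeriv
  rw [he.fderiv_eq, fderiv_sub_const]
  exact hξ _ ((chartAt E (C.center j)).map_source hxs) (sub_eq_zero.1 h0')

/-- A generic perturbation by the differential of a linear combination of the generating functions
makes countably many `1`-forms simultaneously transverse to the zero section. -/
theorem dense_nondegOn [CompactSpace M] {ι : Type*} [Countable ι] {α : ι → M → E →L[ℝ] ℝ}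
    (hα : ∀ i x, FormSmoothAt (α i) x) :
    Dense {p : C.Index → ℝ | ∀ i, NondegOn (fun x => α i x + C.form p x) univ} := by
  have h := dense_iInter_of_isOpen (ι := ι × Fin C.N)
    (f := fun i => {p : C.Index → ℝ |
      NondegOn (fun x => α i.1 x + (1 : ℝ) • C.form p x) (tsupport (C.part i.2))})
    (fun i => C.isOpen_nondegOn (hα i.1) (g := fun _ => 1) contMDiff_const (isClosed_tsupport _))
    (fun i => C.dense_nondegOn_tsupport (hα i.1) i.2)
  refine h.mono fun p hp i x _ h0 => ?_
  obtain ⟨j, hj⟩ : ∃ j, C.part j x ≠ 0 := by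
    by_contra! hne
    have := C.part_sum x
    simp [hne] at this
  have h1 := mem_iInter.1 hp (i, j)
  simp only [one_smul] at h1
  exact h1 x (subset_tsupport _ hj) h0

end ChartCover

end Generic

/-! ### Invariance of the number of zeros on a closed manifold -/

section Chain

namespace ChartCover

variable (C : ChartCover E M)

/-- The sum of the first `k` functions of the partition of unity. -/
def partialSum (k : ℕ) (x : M) : ℝ := ∑ j with j.val < k, C.part j x

theorem contMDiff_partialSum (k : ℕ) : ContMDiff 𝓘(ℝ, E) 𝓘(ℝ, ℝ) ∞ (C.partialSum k) :=
  contMDiff_finsetSum fun j _ => C.part_smooth j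

theorem partialSum_zero (x : M) : C.partialSum 0 x = 0 := by
  simp [partialSum]

theorem partialSum_card (x : M) : C.partialSum C.N x = 1 := by
  simp [partialSum, C.part_sum]

theorem partialSum_succ (j : Fin C.N) (x : M) :
    C.partialSum (j + 1) x = C.partialSum j x + C.part j x := by
  unfold partialSum
  have : (Finset.univ.filter fun i : Fin C.N => i.val < j + 1) =
      insert j (Finset.univ.filter fun i : Fin C.N => i.val < j) := by
    ext i
    simp only [Finset.mem_filter, Finset.mem_univ, true_and, Finset.mem_insert, Fin.ext_iff]
    omega
  rw [this, Finset.sum_insert (by simp), add_comm]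

theorem partialSum_nonneg (k : ℕ) (x : M) : 0 ≤ C.partialSum k x :=
  Finset.sum_nonneg fun j _ => C.part_nonneg j x

theorem partialSum_le_one (k : ℕ) (x : M) : C.partialSum k x ≤ 1 := by
  rw [← C.part_sum x]
  exact Finset.sum_le_sum_of_subset_of_nonneg (Finset.filter_subset _ _)
    fun j _ _ => C.part_nonneg j x

/-- Interpolation between `w` and `w'`: over the union of the supports of the first `k` functions
of the partition of unity, `w` has been replaced by `w'` as much as they allow. -/
def chain (w w' : M → C.Index → ℝ) (k : ℕ) (x : M) : C.Index → ℝ :=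
  w x + C.partialSum k x • (w' x - w x)

theorem contMDiff_chain {w w' : M → C.Index → ℝ} (hw : ContMDiff 𝓘(ℝ, E) 𝓘(ℝ, C.Index → ℝ) ∞ w)
    (hw' : ContMDiff 𝓘(ℝ, E) 𝓘(ℝ, C.Index → ℝ) ∞ w') (k : ℕ) :
    ContMDiff 𝓘(ℝ, E) 𝓘(ℝ, C.Index → ℝ) ∞ (C.chain w w' k) :=
  hw.add ((C.contMDiff_partialSum k).smul (hw'.sub hw))

variable [T2Space M] [CompactSpace M]

/-- If all the members of the chain are transverse to the zero section, the number of zeros is the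
same at both ends, because consecutive members differ in one chart only. -/
theorem zeroCount_chain {w w' : M → C.Index → ℝ}
    (hw : ContMDiff 𝓘(ℝ, E) 𝓘(ℝ, C.Index → ℝ) ∞ w)
    (hw' : ContMDiff 𝓘(ℝ, E) 𝓘(ℝ, C.Index → ℝ) ∞ w') {A : Set M} (hA : IsOpen A)
    (hfr : ∀ x ∈ frontier A, ∀ u ∈ Icc (0 : ℝ) 1, C.form (w x + u • (w' x - w x)) x ≠ 0)
    (hn : ∀ k ≤ C.N, NondegOn (fun x => C.form (C.chain w w' k x) x) A) :
    zeroCount (fun x => C.form (w x) x) A = zeroCount (fun x => C.form (w' x) x) A := by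
  have hs : ∀ k x, FormSmoothAt (fun x => C.form (C.chain w w' k x) x) x := fun k x =>
    C.formSmoothAt_form (C.contMDiff_chain hw hw' k x)
  have hstep : ∀ k ≤ C.N, zeroCount (fun x => C.form (C.chain w w' 0 x) x) A =
      zeroCount (fun x => C.form (C.chain w w' k x) x) A := by
    intro k
    induction k with
    | zero => exact fun _ => rfl
    | succ k ih =>
      intro hk
      rw [ih (by omega)]
      have hsucc : ∀ x, C.partialSum (k + 1) x = C.partialSum k x + C.part ⟨k, hk⟩ x :=
        fun x => C.partialSum_succ ⟨k, hk⟩ x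
      refine zeroCount_eq_of_eq_off_compact (hs k) (hs (k + 1)) (isClosed_tsupport
        (C.part ⟨k, hk⟩)) (fun x hx => C.mem_source_of_part hx) (fun x hx => ?_) hA ?_
        (hn k (by omega)) (hn (k + 1) hk)
      · simp only [chain, hsucc, image_eq_zero_of_notMem_tsupport hx, add_zero]
      · intro u hu x hx
        have e : C.form (C.chain w w' k x) x +
            u • (C.form (C.chain w w' (k + 1) x) x - C.form (C.chain w w' k x) x) =
            C.form (w x + (C.partialSum k x + u * C.part ⟨k, hk⟩ x) • (w' x - w x)) x := by
          simp only [chain, hsucc, C.form_add, C.form_smul]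
          module
        rw [e]
        refine hfr x hx _ ⟨add_nonneg (C.partialSum_nonneg k x)
          (mul_nonneg hu.1 (C.part_nonneg _ x)), ?_⟩
        calc C.partialSum k x + u * C.part ⟨k, hk⟩ x
            ≤ C.partialSum k x + C.part ⟨k, hk⟩ x := by
              gcongr
              exact mul_le_of_le_one_left (C.part_nonneg _ x) hu.2
          _ = C.partialSum (k + 1) x := (hsucc x).symm
          _ ≤ 1 := C.partialSum_le_one _ x
  have h := hstep C.N le_rfl
  simpa only [chain, C.partialSum_zero, C.partialSum_card, zero_smul, add_zero, one_smul,
    add_sub_cancel] using h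

/-- Homotopy invariance of the number of zeros in an open set, for an affine homotopy which has
no zeros on the boundary. -/
theorem zeroCount_eq {w w' : M → C.Index → ℝ}
    (hw : ContMDiff 𝓘(ℝ, E) 𝓘(ℝ, C.Index → ℝ) ∞ w)
    (hw' : ContMDiff 𝓘(ℝ, E) 𝓘(ℝ, C.Index → ℝ) ∞ w') {A : Set M} (hA : IsOpen A) {ε : ℝ}
    (hε : 0 < ε)
    (hfr : ∀ x ∈ frontier A, ∀ u ∈ Icc (0 : ℝ) 1, ∀ v, ‖v‖ < ε →
      C.form (w x + u • (w' x - w x) + v) x ≠ 0)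
    (hn : NondegOn (fun x => C.form (w x) x) A) (hn' : NondegOn (fun x => C.form (w' x) x) A) :
    zeroCount (fun x => C.form (w x) x) A = zeroCount (fun x => C.form (w' x) x) A := by
  -- `p` is a small constant perturbation: it makes the chain from `w + p` to `w' + p` transverse, and
  -- the chains from `w` to `w + p` and from `w'` to `w' + p` remain transverse because `p` is small
  have hclos : ∀ {γ : M → E →L[ℝ] ℝ}, NondegOn γ A → (∀ x ∈ frontier A, γ x ≠ 0) →
      NondegOn γ (closure A) := by
    intro γ h1 h2 x hx h0
    by_cases hxA : x ∈ A
    · exact h1 x hxA h0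
    · exact absurd h0 (h2 x (by rw [hA.frontier_eq]; exact ⟨hx, hxA⟩))
  have hfr0 : ∀ x ∈ frontier A, ∀ v, ‖v‖ < ε → C.form (w x + v) x ≠ 0 := fun x hx v hv => by
    simpa using hfr x hx 0 (by simp) v hv
  have hfr1 : ∀ x ∈ frontier A, ∀ v, ‖v‖ < ε → C.form (w' x + v) x ≠ 0 := fun x hx v hv => by
    simpa using hfr x hx 1 (by simp) v hv
  have hopen : ∀ {v : M → C.Index → ℝ} (_ : ContMDiff 𝓘(ℝ, E) 𝓘(ℝ, C.Index → ℝ) ∞ v)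
      (_ : NondegOn (fun x => C.form (v x) x) A)
      (_ : ∀ x ∈ frontier A, ∀ z, ‖z‖ < ε → C.form (v x + z) x ≠ 0),
      ∀ᶠ p : C.Index → ℝ in 𝓝 0, ∀ k ∈ Finset.range (C.N + 1),
        NondegOn (fun x => C.form (v x) x + C.partialSum k x • C.form p x) (closure A) := by
    intro v hv hnv hfv
    refine (Filter.eventually_all_finset _).2 fun k _ => ?_
    refine (C.isOpen_nondegOn (fun x => C.formSmoothAt_form (hv x)) (C.contMDiff_partialSum k)
      isClosed_closure).mem_nhds ?_
    have h0 : ∀ x, C.form (0 : C.Index → ℝ) x = 0 := fun x => by simp [form]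
    simp only [mem_ofPred_eq, h0, smul_zero, add_zero]
    exact hclos hnv fun x hx => by simpa using hfv x hx 0 (by simpa using hε)
  have hball : ∀ᶠ p : C.Index → ℝ in 𝓝 0, ‖p‖ < ε := by
    filter_upwards [Metric.ball_mem_nhds (0 : C.Index → ℝ) hε] with p hp
    simpa using hp
  have hdense := C.dense_nondegOn (α := fun (k : ℕ) x => C.form (C.chain w w' k x) x)
    fun k x => C.formSmoothAt_form (C.contMDiff_chain hw hw' k x)
  obtain ⟨p, ⟨hp1, hp2, hp3⟩, hp4⟩ := mem_closure_iff_nhds.1 (hdense 0) _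
    ((hopen hw hn hfr0).and ((hopen hw' hn' hfr1).and hball))
  have hwp : ∀ {v : M → C.Index → ℝ}, ContMDiff 𝓘(ℝ, E) 𝓘(ℝ, C.Index → ℝ) ∞ v →
      ContMDiff 𝓘(ℝ, E) 𝓘(ℝ, C.Index → ℝ) ∞ fun x => v x + p := fun hv =>
    hv.add contMDiff_const
  have hend : ∀ {v : M → C.Index → ℝ} (_ : ContMDiff 𝓘(ℝ, E) 𝓘(ℝ, C.Index → ℝ) ∞ v)
      (_ : ∀ x ∈ frontier A, ∀ z, ‖z‖ < ε → C.form (v x + z) x ≠ 0)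
      (_ : ∀ k ∈ Finset.range (C.N + 1),
        NondegOn (fun x => C.form (v x) x + C.partialSum k x • C.form p x) (closure A)),
      zeroCount (fun x => C.form (v x) x) A = zeroCount (fun x => C.form (v x + p) x) A := by
    intro v hv hfv hk
    refine C.zeroCount_chain hv (hwp hv) hA (fun x hx u hu => ?_) fun k hkN => ?_
    · rw [add_sub_cancel_left]
      refine hfv x hx _ ?_
      rw [norm_smul, Real.norm_of_nonneg hu.1]
      exact (mul_le_of_le_one_left (norm_nonneg p) hu.2).trans_lt hp3
    · simp only [chain, add_sub_cancel_left, C.form_add, C.form_smul]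
      exact (hk k (Finset.mem_range.2 (by omega))).mono subset_closure
  rw [hend hw hfr0 hp1, hend hw' hfr1 hp2]
  refine C.zeroCount_chain (hwp hw) (hwp hw') hA (fun x hx u hu => ?_) fun k hkN => ?_
  · have := hfr x hx u hu p hp3
    rwa [add_sub_add_right_eq_sub, add_right_comm]
  · have h := (hp4 k).mono (subset_univ A)
    simp only [chain, add_sub_add_right_eq_sub, add_right_comm (w _) p, C.form_add] at h ⊢
    exact h

end ChartCover

end Chain

/-! ### Positive definite forms -/

section Pos

theorem SymForm.Pos.nondeg {q : SymForm E} (h : q.Pos) : q.Nondeg := by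
  intro u hu
  by_contra h0
  exact (h u h0).ne' (hu u)

/-- A nondegenerate positive semidefinite form is positive definite (by the Cauchy–Schwarz
inequality). -/
theorem SymForm.Nondeg.pos {q : SymForm E} (h : q.Nondeg) (h0 : ∀ u, 0 ≤ q.toBil u u) :
    q.Pos := by
  intro u hu
  refine lt_of_le_of_ne (h0 u) fun he => hu (h u fun v => ?_)
  -- `0 ≤ q(v + r u, v + r u) = q(v, v) + 2 r q(u, v)` for all `r`
  by_contra hv
  have e : ∀ r : ℝ, q.toBil (v + r • u) (v + r • u) = q.toBil v v + 2 * r * q.toBil u v := by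
    intro r
    simp only [map_add, map_smul, add_apply, smul_apply, smul_eq_mul, ← he, q.symm v u]
    ring
  have h1 := h0 (v + (-(q.toBil v v + 1) / (2 * q.toBil u v)) • u)
  have h2 : 2 * (-(q.toBil v v + 1) / (2 * q.toBil u v)) * q.toBil u v = -(q.toBil v v + 1) := by
    field_simp
  rw [e, h2] at h1
  linarith

theorem isOpen_pos : IsOpen {q : SymForm E | q.Pos} := by
  have hB : Continuous (fun q : SymForm E => (q.toBil : Bil E)) := continuous_subtype_val
  have hev : Continuous fun z : SymForm E × E => z.1.toBil z.2 z.2 := by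
    have h1 : Continuous fun z : SymForm E × E => (z.1.toBil : E →L[ℝ] E →L[ℝ] ℝ) :=
      hB.comp continuous_fst
    exact (h1.clm_apply continuous_snd).clm_apply continuous_snd
  refine isOpen_iff_mem_nhds.2 fun q hq => ?_
  have h := (isCompact_sphere (0 : E) 1).eventually_forall_of_forall_eventually
    (P := fun (q : SymForm E) (u : E) => 0 < q.toBil u u) (x₀ := q) fun u hu => by
      refine hev.continuousAt.eventually (lt_mem_nhds (hq u ?_))
      rintro rfl
      simp at hu
  filter_upwards [h] with r hr u hu
  have hn : 0 < ‖u‖ := norm_pos_iff.2 hu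
  have h1 := hr (‖u‖⁻¹ • u) (by simp [norm_smul, hn.ne'])
  have h2 : r.toBil (‖u‖⁻¹ • u) (‖u‖⁻¹ • u) = ‖u‖⁻¹ * (‖u‖⁻¹ * r.toBil u u) := by
    simp
  rw [h2] at h1
  have h3 : 0 < ‖u‖⁻¹ := inv_pos.2 hn
  exact (mul_pos_iff_of_pos_left h3).1 ((mul_pos_iff_of_pos_left h3).1 h1)

end Pos

/-! ### Homotopy invariance of the intersection number of index `0` -/

section Stability

namespace ChartCover

variable (C : ChartCover E M)

theorem jetCoord_toJet (c x : M) (v : C.Index → ℝ) :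
    jetCoord c x (C.toJet v x) = ∑ k, v k • jetCoord c x (jetOf (dForm (C.genFun k)) x) := by
  unfold jetCoord toJet
  rw [map_sum]
  simp only [map_smul]

theorem continuousAt_jetCoord_toJet (x : M) (v : C.Index → ℝ) :
    ContinuousAt (fun z : M × (C.Index → ℝ) => jetCoord x z.1 (C.toJet z.2 z.1)) (x, v) := by
  simp only [jetCoord_toJet]
  refine tendsto_finsetSum _ fun k _ => ?_
  refine ((continuous_apply k).comp continuous_snd).continuousAt.smul ?_
  refine ContinuousAt.comp (g := fun y => jetCoord x y (jetOf (dForm (C.genFun k)) y))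
    (x := (x, v)) ?_ continuousAt_fst
  have hs := C.formSmoothAt_dForm_genFun k
  have h1 : ContinuousAt (fun y => (locForm (dForm (C.genFun k)) x (chartAt E x y),
      symmetrize E (formDeriv (dForm (C.genFun k)) x y))) x := by
    have hφ := (chartAt E x).continuousAt (mem_chart_source E x)
    refine ContinuousAt.prodMk (ContinuousAt.comp (g := locForm (dForm (C.genFun k)) x)
      (ContDiffAt.continuousAt (hs x)) hφ) ?_
    refine (symmetrize E).continuous.continuousAt.comp ?_
    exact ContinuousAt.comp (g := fderiv ℝ (locForm (dForm (C.genFun k)) x))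
      (ContDiffAt.fderiv_right (m := 0) (hs x) (by simp)).continuousAt hφ
  refine h1.congr ?_
  filter_upwards [chart_source_mem_nhds E x] with y hy
  exact (jetCoord_jetOf (hs y) hy).symm

/-- Among the Morse jets, those which are critical of index `0` and those which are critical of
positive index both form closed sets: a critical Morse jet which is not positive definite takes a
negative value. -/
theorem eventually_isMin {x : M} {v : C.Index → ℝ}
    (hm : (C.toJet v x).1 = 0 → (C.toJet v x).2.Nondeg) :
    (¬ ((C.toJet v x).1 = 0 ∧ ¬ (C.toJet v x).2.Pos) →
      ∀ᶠ z : M × (C.Index → ℝ) in 𝓝 (x, v),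
        ¬ ((C.toJet z.2 z.1).1 = 0 ∧ ¬ (C.toJet z.2 z.1).2.Pos)) ∧
    (¬ ((C.toJet v x).1 = 0 ∧ (C.toJet v x).2.Pos) →
      ∀ᶠ z : M × (C.Index → ℝ) in 𝓝 (x, v),
        ¬ ((C.toJet z.2 z.1).1 = 0 ∧ (C.toJet z.2 z.1).2.Pos)) := by
  have hc := C.continuousAt_jetCoord_toJet x v
  have hsrc : ∀ᶠ z : M × (C.Index → ℝ) in 𝓝 (x, v), z.1 ∈ (chartAt E x).source :=
    continuous_fst.continuousAt.eventually (chart_source_mem_nhds E x)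
  by_cases h0 : (C.toJet v x).1 = 0
  · by_cases hp : (C.toJet v x).2.Pos
    · refine ⟨fun _ => ?_, fun h => absurd ⟨h0, hp⟩ h⟩
      have h1 := (continuous_snd.continuousAt.comp hc).eventually (isOpen_pos.mem_nhds (by
        simp only [Function.comp, jetCoord_self]
        exact hp))
      filter_upwards [h1, hsrc] with z hz hzs hz0
      exact hz0.2 ((jetCoord_snd_pos_iff hzs hz0.1).1 hz)
    · refine ⟨fun h => absurd ⟨h0, hp⟩ h, fun _ => ?_⟩
      obtain ⟨u, hu⟩ : ∃ u, (C.toJet v x).2.toBil u u < 0 := by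
        by_contra! h
        exact hp ((hm h0).pos h)
      have hev : Continuous fun w : JetModel E => w.2.toBil u u := by
        have hB : Continuous (fun w : JetModel E => (w.2.toBil : E →L[ℝ] E →L[ℝ] ℝ)) :=
          continuous_subtype_val.comp continuous_snd
        exact (hB.clm_apply continuous_const).clm_apply continuous_const
      have h1 := (hev.continuousAt.comp hc).eventually ((isOpen_Iio (a := (0 : ℝ))).mem_nhds (by
        rw [mem_Iio]
        simpa only [Function.comp, jetCoord_self] using hu))
      filter_upwards [h1, hsrc] with z hz hzs hz0
      have h2 := (jetCoord_snd_pos_iff hzs hz0.1).2 hz0.2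
      have hune : u ≠ 0 := by
        rintro rfl
        simp at hu
      exact absurd (h2 u hune) (not_lt.2 (le_of_lt hz))
  · have h1 := (continuous_fst.continuousAt.comp hc).eventually_ne (y := 0) (by
      simp only [Function.comp, jetCoord_self]
      exact h0)
    have h2 : ∀ᶠ z : M × (C.Index → ℝ) in 𝓝 (x, v), (C.toJet z.2 z.1).1 ≠ 0 := by
      filter_upwards [h1, hsrc] with z hz hzs
      exact (jetCoord_fst_eq_zero_iff hzs _).not.1 hz
    exact ⟨fun _ => h2.mono fun z hz h => hz h.1, fun _ => h2.mono fun z hz h => hz h.1⟩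

/-- The section given by the coefficients `w` takes values in the set of Morse jets. -/
def MorseCoeff (w : M → C.Index → ℝ) : Prop :=
  ∀ x, (C.toJet (w x) x).1 = 0 → (C.toJet (w x) x).2.Nondeg

/-- The points where the section given by the coefficients `w` meets the set of critical jets of
index `0`. -/
def minSet (w : M → C.Index → ℝ) : Set M :=
  {x | (C.toJet (w x) x).1 = 0 ∧ (C.toJet (w x) x).2.Pos}

/-- The algebraic number of intersections with the set of critical jets of index `0`. -/
def minCount (w : M → C.Index → ℝ) : ℤ :=
  ∑ᶠ a ∈ C.minSet w, (bilSign (formDeriv (fun x => C.form (w x) x) a a) : ℤ)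

/-- Transversality to the set of critical jets of index `0`. -/
def MinTransverse (w : M → C.Index → ℝ) : Prop :=
  ∀ a ∈ C.minSet w, Function.Bijective (formDeriv (fun x => C.form (w x) x) a a)

variable [T2Space M] [CompactSpace M]

/-- An isolating open set for the intersections of index `0`: it contains all those, and only
those, zeros of every section near `w`. -/
theorem exists_isolating {w : M → C.Index → ℝ} (hw : Continuous w) (hm : C.MorseCoeff w) :
    ∃ A : Set M, IsOpen A ∧ ∃ ε > 0, ∀ x v, ‖v‖ < ε →
      (x ∈ closure A → ¬ ((C.toJet (w x + v) x).1 = 0 ∧ ¬ (C.toJet (w x + v) x).2.Pos)) ∧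
      (x ∉ A → ¬ ((C.toJet (w x + v) x).1 = 0 ∧ (C.toJet (w x + v) x).2.Pos)) := by
  have hg : ∀ x, ContinuousAt (fun y => (y, w y)) x := fun x =>
    continuousAt_id.prodMk hw.continuousAt
  have hZ0 : IsClosed {x | (C.toJet (w x) x).1 = 0 ∧ (C.toJet (w x) x).2.Pos} :=
    isOpen_compl_iff.1 (isOpen_iff_mem_nhds.2 fun x hx =>
      (hg x).eventually ((C.eventually_isMin (hm x)).2 hx))
  have hZ1 : IsClosed {x | (C.toJet (w x) x).1 = 0 ∧ ¬ (C.toJet (w x) x).2.Pos} :=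
    isOpen_compl_iff.1 (isOpen_iff_mem_nhds.2 fun x hx =>
      (hg x).eventually ((C.eventually_isMin (hm x)).1 hx))
  obtain ⟨A, hA, hZA, hAZ⟩ := normal_exists_closure_subset hZ0 hZ1.isOpen_compl
    fun x hx hx' => hx'.2 hx.2
  refine ⟨A, hA, ?_⟩
  have hgz : ∀ x, Filter.Tendsto (fun z : (C.Index → ℝ) × M => (z.2, w z.2 + z.1))
      (𝓝 (0, x)) (𝓝 (x, w x)) := fun x => by
    have : Continuous fun z : (C.Index → ℝ) × M => (z.2, w z.2 + z.1) := by fun_prop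
    simpa using this.tendsto (0, x)
  have key : ∀ x ∈ (univ : Set M), ∀ᶠ z : (C.Index → ℝ) × M in 𝓝 (0, x),
      (z.2 ∈ closure A →
        ¬ ((C.toJet (w z.2 + z.1) z.2).1 = 0 ∧ ¬ (C.toJet (w z.2 + z.1) z.2).2.Pos)) ∧
      (z.2 ∉ A → ¬ ((C.toJet (w z.2 + z.1) z.2).1 = 0 ∧ (C.toJet (w z.2 + z.1) z.2).2.Pos)) := by
    intro x _
    refine Filter.Eventually.and ?_ ?_
    · by_cases hx : x ∈ closure A
      · exact ((hgz x).eventually ((C.eventually_isMin (hm x)).1 (hAZ hx))).mono fun z hz _ => hz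
      · filter_upwards [continuous_snd.continuousAt.eventually
          (show ∀ᶠ y in 𝓝 ((0 : C.Index → ℝ), x).2, y ∉ closure A from
            isClosed_closure.isOpen_compl.mem_nhds hx)] with z hz h
        exact absurd h hz
    · by_cases hx : x ∈ A
      · filter_upwards [continuous_snd.continuousAt.eventually
          (show ∀ᶠ y in 𝓝 ((0 : C.Index → ℝ), x).2, y ∈ A from hA.mem_nhds hx)] with z hz h
        exact absurd hz h
      · exact ((hgz x).eventually ((C.eventually_isMin (hm x)).2 fun h => hx (hZA h))).mono
          fun z hz _ => hz
  have h := isCompact_univ.eventually_forall_of_forall_eventually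
    (P := fun (v : C.Index → ℝ) (x : M) => (x ∈ closure A →
        ¬ ((C.toJet (w x + v) x).1 = 0 ∧ ¬ (C.toJet (w x + v) x).2.Pos)) ∧
      (x ∉ A → ¬ ((C.toJet (w x + v) x).1 = 0 ∧ (C.toJet (w x + v) x).2.Pos))) key
  obtain ⟨ε, hε, hball⟩ := Metric.eventually_nhds_iff.1 h
  exact ⟨ε, hε, fun x v hv => hball (by simpa using hv) x (mem_univ x)⟩

/-- The number of intersections of index `0` is locally constant, with respect to the uniform
topology on sections. -/
theorem exists_minCount_eq {w₀ : M → C.Index → ℝ} (hw₀ : Continuous w₀) (hm : C.MorseCoeff w₀) :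
    ∃ ε > 0, ∀ w w' : M → C.Index → ℝ, ContMDiff 𝓘(ℝ, E) 𝓘(ℝ, C.Index → ℝ) ∞ w →
      ContMDiff 𝓘(ℝ, E) 𝓘(ℝ, C.Index → ℝ) ∞ w' → (∀ x, ‖w x - w₀ x‖ < ε) →
      (∀ x, ‖w' x - w₀ x‖ < ε) → C.MinTransverse w → C.MinTransverse w' →
      C.minCount w = C.minCount w' := by
  obtain ⟨A, hA, ε, hε, h⟩ := C.exists_isolating hw₀ hm
  have hset : ∀ {w : M → C.Index → ℝ}, (∀ x, ‖w x - w₀ x‖ < ε / 2) →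
      C.minSet w = {x | x ∈ A ∧ C.form (w x) x = 0} := by
    intro w hw
    ext x
    have h1 := h x (w x - w₀ x) ((hw x).trans (half_lt_self hε))
    rw [add_sub_cancel] at h1
    simp only [minSet, mem_ofPred_eq, ← C.toJet_fst]
    refine ⟨fun hx => ⟨by_contra fun hxA => h1.2 hxA hx, hx.1⟩, fun hx => ⟨hx.2, ?_⟩⟩
    by_contra hp
    exact h1.1 (subset_closure hx.1) ⟨hx.2, hp⟩
  refine ⟨ε / 2, half_pos hε, fun w w' hw hw' hwε hwε' ht ht' => ?_⟩
  have hcount : ∀ {w : M → C.Index → ℝ}, (∀ x, ‖w x - w₀ x‖ < ε / 2) →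
      C.minCount w = zeroCount (fun x => C.form (w x) x) A := by
    intro w hw
    unfold minCount zeroCount
    rw [hset hw]
  have hnd : ∀ {w : M → C.Index → ℝ}, (∀ x, ‖w x - w₀ x‖ < ε / 2) → C.MinTransverse w →
      NondegOn (fun x => C.form (w x) x) A := by
    intro w hw ht a ha h0
    refine ht a ?_
    rw [hset hw]
    exact ⟨ha, h0⟩
  rw [hcount hwε, hcount hwε']
  refine C.zeroCount_eq hw hw' hA (half_pos hε) (fun x hx u hu v hv => ?_) (hnd hwε ht)
    (hnd hwε' ht')
  have hconv : ‖u • (w' x - w₀ x) + (1 - u) • (w x - w₀ x)‖ ≤ ε / 2 := by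
    have h3 := (convex_closedBall (0 : C.Index → ℝ) (ε / 2))
      (x := w' x - w₀ x) (by simpa using (hwε' x).le) (y := w x - w₀ x)
      (by simpa using (hwε x).le) hu.1 (sub_nonneg.2 hu.2) (by ring)
    simpa using h3
  have hv' : ‖u • (w' x - w₀ x) + (1 - u) • (w x - w₀ x) + v‖ < ε := by
    have := norm_add_le (u • (w' x - w₀ x) + (1 - u) • (w x - w₀ x)) v
    linarith
  have h4 := h x _ hv'
  have e : w₀ x + (u • (w' x - w₀ x) + (1 - u) • (w x - w₀ x) + v) =
      w x + u • (w' x - w x) + v := by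
    module
  rw [e] at h4
  rw [hA.frontier_eq] at hx
  rw [← C.toJet_fst]
  intro h0
  by_cases hp : (C.toJet (w x + u • (w' x - w x) + v) x).2.Pos
  · exact h4.2 hx.2 ⟨h0, hp⟩
  · exact h4.1 hx.1 ⟨h0, hp⟩

/-- Approximation of a continuous section by smooth transverse ones. -/
theorem exists_smooth_transverse {w₀ : M → C.Index → ℝ} (hw₀ : Continuous w₀) {ε : ℝ}
    (hε : 0 < ε) : ∃ w : M → C.Index → ℝ, ContMDiff 𝓘(ℝ, E) 𝓘(ℝ, C.Index → ℝ) ∞ w ∧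
      (∀ x, ‖w x - w₀ x‖ < ε) ∧ NondegOn (fun x => C.form (w x) x) univ := by
  obtain ⟨g, hg⟩ := hw₀.exists_contMDiff_approx 𝓘(ℝ, E) ⊤ (ε := fun _ => ε / 2)
    continuous_const (fun _ => half_pos hε)
  have hd := C.dense_nondegOn (α := fun (_ : Unit) x => C.form (g x) x)
    fun _ x => C.formSmoothAt_form (g.contMDiff x)
  obtain ⟨p, hp1, hp2⟩ := mem_closure_iff_nhds.1 (hd 0) _
    (Metric.ball_mem_nhds (0 : C.Index → ℝ) (half_pos hε))
  refine ⟨fun x => g x + p, g.contMDiff.add contMDiff_const, fun x => ?_, ?_⟩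
  · have h1 : ‖g x - w₀ x‖ < ε / 2 := by
      rw [← dist_eq_norm]
      exact hg.1 x
    have h2 : ‖p‖ < ε / 2 := by simpa using hp1
    calc ‖g x + p - w₀ x‖ = ‖(g x - w₀ x) + p‖ := by congr 1; abel
      _ ≤ ‖g x - w₀ x‖ + ‖p‖ := norm_add_le _ _
      _ < ε := by linarith
  · simpa only [C.form_add] using hp2 ()

/-- Homotopy invariance of the number of intersections of index `0`. -/
theorem minCount_eq_of_homotopy {h : unitInterval × M → C.Index → ℝ} (hh : Continuous h)
    (hm : ∀ τ, C.MorseCoeff fun x => h (τ, x))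
    (h0 : ContMDiff 𝓘(ℝ, E) 𝓘(ℝ, C.Index → ℝ) ∞ fun x => h (0, x))
    (h1 : ContMDiff 𝓘(ℝ, E) 𝓘(ℝ, C.Index → ℝ) ∞ fun x => h (1, x))
    (ht0 : C.MinTransverse fun x => h (0, x)) (ht1 : C.MinTransverse fun x => h (1, x)) :
    C.minCount (fun x => h (0, x)) = C.minCount fun x => h (1, x) := by
  have hc : ∀ τ, Continuous fun x => h (τ, x) := fun τ => hh.comp (by fun_prop)
  choose ε hε hεP using fun τ => C.exists_minCount_eq (hc τ) (hm τ)
  choose w hw hwε hwt using fun τ => C.exists_smooth_transverse (hc τ) (hε τ)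
  have hmt : ∀ {v : M → C.Index → ℝ}, NondegOn (fun x => C.form (v x) x) univ →
      C.MinTransverse v := fun {v} hv a ha => hv a (mem_univ a)
    ((C.toJet_fst (v a) a).symm.trans ha.1)
  have hloc : IsLocallyConstant fun τ => C.minCount (w τ) := by
    refine (IsLocallyConstant.iff_eventually_eq _).2 fun τ => ?_
    have hcont : ∀ x ∈ (univ : Set M), ∀ᶠ z : unitInterval × M in 𝓝 (τ, x),
        ‖h (z.1, z.2) - h (τ, z.2)‖ < ε τ / 2 := by
      intro x _
      have hcn : Continuous fun z : unitInterval × M => ‖h (z.1, z.2) - h (τ, z.2)‖ := by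
        fun_prop
      refine hcn.continuousAt.eventually (gt_mem_nhds ?_)
      simpa using half_pos (hε τ)
    filter_upwards [isCompact_univ.eventually_forall_of_forall_eventually
      (P := fun (σ : unitInterval) (x : M) => ‖h (σ, x) - h (τ, x)‖ < ε τ / 2) hcont] with σ hσ
    obtain ⟨v, hv, hvε, hvt⟩ := C.exists_smooth_transverse (hc σ)
      (lt_min (hε σ) (half_pos (hε τ)))
    rw [hεP σ (w σ) v (hw σ) hv (hwε σ) (fun x => (hvε x).trans_le (min_le_left _ _))
      (hmt (hwt σ)) (hmt hvt)]
    refine hεP τ v (w τ) hv (hw τ) (fun x => ?_) (hwε τ) (hmt hvt) (hmt (hwt τ))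
    have h2 := (hvε x).trans_le (min_le_right _ _)
    have h3 := norm_sub_le_norm_sub_add_norm_sub (v x) (h (σ, x)) (h (τ, x))
    linarith [hσ x (mem_univ x)]
  have hconst := hloc.apply_eq_of_preconnectedSpace 0 1
  rwa [hεP 0 (w 0) _ (hw 0) h0 (hwε 0) (fun x => by simpa using hε 0) (hmt (hwt 0)) ht0,
    hεP 1 (w 1) _ (hw 1) h1 (hwε 1) (fun x => by simpa using hε 1) (hmt (hwt 1)) ht1] at hconst

end ChartCover

end Stability

/-! ### Index `0` and positivity -/

section Index

theorem SymForm.toQuadraticMap_apply (q : SymForm E) (u : E) :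
    q.toBil.toBilinForm.toQuadraticMap u = q.toBil u u := by
  rfl

theorem SymForm.Pos.index_eq_zero {q : SymForm E} (h : q.Pos) : q.index = 0 := by
  obtain ⟨V, hV, hn⟩ := exists_finrank_eq_sigNeg_and_negDef q.toBil.toBilinForm.toQuadraticMap
  rw [SymForm.index, ← hV, Submodule.finrank_eq_zero]
  refine (Submodule.eq_bot_iff V).2 fun u hu => ?_
  by_contra h0
  have h1 : 0 < -(q.toBil u u) := hn ⟨u, hu⟩ fun he => h0 (congrArg Subtype.val he)
  linarith [h u h0]

theorem SymForm.Nondeg.pos_of_index_eq_zero {q : SymForm E} (h : q.Nondeg) (h0 : q.index = 0) :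
    q.Pos := by
  refine h.pos fun u => ?_
  by_contra! hu
  have hune : u ≠ 0 := by
    rintro rfl
    simp at hu
  have h1 : ((-q.toBil.toBilinForm.toQuadraticMap).restrict (Submodule.span ℝ {u})).PosDef := by
    rintro ⟨v, hv⟩ hv0
    obtain ⟨r, rfl⟩ := Submodule.mem_span_singleton.1 hv
    change 0 < -(q.toBil (r • u) (r • u))
    have hr : r ≠ 0 := by
      rintro rfl
      exact hv0 (Subtype.ext (zero_smul ℝ u))
    have e : q.toBil (r • u) (r • u) = r ^ 2 * q.toBil u u := by
      simp
      ring
    rw [e]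
    nlinarith [pow_pos (abs_pos.2 hr) 2, sq_abs r]
  have h2 := le_sigNeg_of_negDef _ h1
  rw [finrank_span_singleton hune] at h2
  rw [SymForm.index] at h0
  omega

theorem isCritical_zero_iff {x : M} {j : Jet E x} :
    j.IsCritical 0 ↔ j.first = 0 ∧ j.second.Pos :=
  ⟨fun h => ⟨h.1, h.2.1.pos_of_index_eq_zero h.2.2⟩, fun h => ⟨h.1, h.2.nondeg, h.2.index_eq_zero⟩⟩

theorem SymForm.Pos.bilSign_eq_one {q : SymForm E} (h : q.Pos) : bilSign q.toBil = 1 := by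
  have h1 := (LinearMap.BilinForm.posDef_toQuadraticMap_iff_matrix (Module.finBasis ℝ E)
    q.toBil.toBilinForm ⟨fun u v => q.symm u v⟩).1 fun u hu => h u hu
  exact sign_pos h1.det_pos

end Index

/-! ### Intersection numbers of sections of Morse jets -/

section Invariance

variable [T2Space M] [CompactSpace M]

theorem signedCount_zero (s : MorseSection E M) : s.signedCount 0 =
    ∑ᶠ a ∈ {a : M | (s.jet a).first = 0 ∧ (s.jet a).second.Pos},
      (bilSign (formDeriv (fun x => (s.jet x).first) a a) : ℤ) := by
  unfold MorseSection.signedCount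
  refine finsum_mem_congr ?_ fun a _ => ?_
  · ext a
    exact isCritical_zero_iff
  · rw [MorseSection.intersectionSign, pow_zero, one_mul, s.derivForm_eq]
    rfl

/-- The algebraic intersection number with the set of critical jets of index `0` is a homotopy
invariant of the sections of `𝓜`. -/
theorem signedCount_eq_of_homotopic {s t : MorseSection E M} (h : s.Homotopic t) (hs : s.Smooth)
    (ht : t.Smooth) (hs0 : s.TransverseTo 0) (ht0 : t.TransverseTo 0) :
    s.signedCount 0 = t.signedCount 0 := by
  obtain ⟨H, rfl, rfl, hH⟩ := h
  obtain ⟨C⟩ := exists_chartCover (E := E) (M := M)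
  have hjet : ∀ τ x, C.toJet (C.coeff x ((H τ).jet x)) x = (H τ).jet x := fun τ x =>
    C.toJet_coeff x _
  have hform : ∀ τ, (fun x => C.form (C.coeff x ((H τ).jet x)) x) = fun x => ((H τ).jet x).first :=
    fun τ => funext fun x => by
      rw [← C.toJet_fst, hjet]
      rfl
  have hset : ∀ τ, C.minSet (fun x => C.coeff x ((H τ).jet x)) =
      {a : M | ((H τ).jet a).first = 0 ∧ ((H τ).jet a).second.Pos} := fun τ => by
    unfold ChartCover.minSet
    simp only [hjet]
    rfl
  have hcount : ∀ τ, (H τ).signedCount 0 = C.minCount fun x => C.coeff x ((H τ).jet x) :=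
    fun τ => by rw [signedCount_zero, ChartCover.minCount, hset, hform]
  have htr : ∀ τ, (H τ).TransverseTo 0 →
      C.MinTransverse fun x => C.coeff x ((H τ).jet x) := by
    intro τ hτ a ha
    rw [hset] at ha
    rw [hform]
    exact hτ a (isCritical_zero_iff.2 ha)
  rw [hcount, hcount]
  refine C.minCount_eq_of_homotopy (h := fun z => C.coeff z.2 ((H z.1).jet z.2))
    (C.continuous_coeff continuous_snd hH) (fun τ x h0 => ?_) (C.contMDiff_coeff hs)
    (C.contMDiff_coeff ht) (htr 0 hs0) (htr 1 ht0)
  simp only [hjet] at h0 ⊢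
  exact (H τ).isMorse x h0

theorem homotopic_refl (s : MorseSection E M) : s.Homotopic s :=
  ⟨fun _ => s, rfl, rfl, s.continuous_jet.comp continuous_snd⟩

/-- A smooth section which avoids the critical jets of index `0` has the pairing `0` with `μ₀`. -/
theorem isPairing_zero_of_forall_not {s : MorseSection E M} (hs : s.Smooth)
    (h : ∀ a, ¬ (s.jet a).IsCritical 0) : MorseSection.IsPairing 0 s 0 := by
  have ht : s.TransverseTo 0 := fun a ha => absurd ha (h a)
  refine ⟨⟨s, homotopic_refl s, hs, ht⟩, fun t hst hts htt => ?_⟩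
  rw [← signedCount_eq_of_homotopic hst hs hts ht htt, MorseSection.signedCount]
  exact finsum_mem_eq_zero_of_forall_eq_zero fun a ha => absurd ha (h a)

end Invariance

/-! ### Holonomic sections have minima -/

section Holonomic

/-- The second order necessary condition at a local minimum. -/
theorem fderiv_fderiv_nonneg_of_isLocalMin {g : E → ℝ} {y : E} (hg : ContDiffAt ℝ ∞ g y)
    (hm : IsLocalMin g y) (u : E) : 0 ≤ fderiv ℝ (fderiv ℝ g) y u u := by
  by_contra! hneg
  set l : ℝ → E := fun r => y + r • u with hl
  have hl0 : l 0 = y := by simp [hl]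
  have hld : ∀ r, HasDerivAt l u r := fun r => by
    have h := ((hasDerivAt_id r).smul_const u).const_add y
    rwa [one_smul] at h
  have hlc : ContinuousAt l 0 := (hld 0).continuousAt
  have hd : ∀ᶠ r in 𝓝 (0 : ℝ), HasDerivAt (g ∘ l) (fderiv ℝ g (l r) u) r := by
    have h1 : ∀ᶠ z in 𝓝 (l 0), ContDiffAt ℝ 1 g z := by
      rw [hl0]
      exact (hg.of_le (by exact_mod_cast le_top)).eventually (by simp)
    filter_upwards [hlc.eventually h1] with r hr
    exact (hr.differentiableAt (by simp)).hasFDerivAt.comp_hasDerivAt r (hld r)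
  have hder : deriv (g ∘ l) =ᶠ[𝓝 0] fun r => fderiv ℝ g (l r) u := hd.mono fun r hr => hr.deriv
  have hdd : HasDerivAt (fun r => fderiv ℝ g (l r) u) (fderiv ℝ (fderiv ℝ g) y u u) 0 := by
    have h2 : HasFDerivAt (fderiv ℝ g) (fderiv ℝ (fderiv ℝ g) y) (l 0) := by
      rw [hl0]
      exact ((hg.fderiv_right (m := 1) two_le_infty).differentiableAt
        (by simp)).hasFDerivAt
    exact (h2.comp_hasDerivAt 0 (hld 0)).clm_apply (hasDerivAt_const 0 u) |>.congr_deriv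
      (by simp)
  have hdd' : deriv (deriv (g ∘ l)) 0 = fderiv ℝ (fderiv ℝ g) y u u := by
    rw [hder.deriv_eq, hdd.deriv]
  have hmin : IsLocalMin (g ∘ l) 0 := by
    have : IsLocalMin g (l 0) := by rwa [hl0]
    exact this.comp_continuous hlc
  have hmax : IsLocalMax (g ∘ l) 0 := isLocalMax_of_deriv_deriv_neg (by rw [hdd']; exact hneg)
    hmin.deriv_eq_zero hd.self_of_nhds.continuousAt
  -- the function is locally constant, so that its second derivative vanishes
  have hconst : g ∘ l =ᶠ[𝓝 0] fun _ => (g ∘ l) 0 := by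
    filter_upwards [hmin, hmax] with r h1 h2
    exact le_antisymm h2 h1
  have hzero : deriv (deriv (g ∘ l)) 0 = 0 := by
    rw [hconst.deriv.deriv_eq]
    simp
  rw [hdd'] at hzero
  exact hneg.ne hzero

variable [T2Space M] [CompactSpace M]

/-- At a minimum of `f`, the jet of `f` is critical and its second derivative is positive
semidefinite, hence positive definite because the jet is Morse. -/
theorem MorseSection.IsHolonomic.exists_isCritical_zero [Nonempty M] {t : MorseSection E M}
    (h : t.IsHolonomic) : ∃ a, (t.jet a).IsCritical 0 := by
  obtain ⟨f, hf, hjet⟩ := h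
  obtain ⟨a, -, ha⟩ := isCompact_univ.exists_isMinOn univ_nonempty hf.continuous.continuousOn
  have hmin : IsLocalMin (f ∘ (chartAt E a).symm) (chartAt E a a) := by
    refine Filter.Eventually.of_forall fun y => ?_
    simp only [Function.comp, (chartAt E a).left_inv (mem_chart_source E a)]
    exact ha (mem_univ _)
  have hg : ContDiffAt ℝ ∞ (f ∘ (chartAt E a).symm) (chartAt E a a) :=
    contDiffAt_comp_chart_symm (mem_chart_source E a) (hf a)
  have h1 : (t.jet a).first = 0 := by
    rw [hjet]
    exact hmin.fderiv_eq_zero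
  refine ⟨a, isCritical_zero_iff.2 ⟨h1, (t.isMorse a h1).pos fun u => ?_⟩⟩
  rw [hjet]
  change 0 ≤ (symmetrize E _).toBil u u
  rw [symmetrize_apply]
  have := fderiv_fderiv_nonneg_of_isLocalMin hg hmin u
  linarith

/-- At a critical point, the derivative of the `1`-form underlying a holonomic section is the
Hessian. -/
theorem MorseSection.derivForm_eq_second {t : MorseSection E M} {f : M → ℝ}
    (hf : ContMDiff 𝓘(ℝ, E) 𝓘(ℝ, ℝ) ∞ f) (h : ∀ x, t.jet x = jet2 f x) (a : M) :
    t.derivForm a = (t.jet a).second.toBil := by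
  have hfe : ∀ x, ∀ᶠ y in 𝓝 x, ContMDiffAt 𝓘(ℝ, E) 𝓘(ℝ, ℝ) ∞ f y :=
    fun x => Filter.Eventually.of_forall hf
  have h1 : (fun x => (t.jet x).first) = dForm f := by
    funext x
    rw [h]
    rfl
  have h2 : (t.jet a).second = symmetrize E (formDeriv (dForm f) a a) := by
    rw [h, jet2_eq_jetOf (hfe a)]
    rfl
  rw [t.derivForm_eq, h1, h2, symmetrize_coe]
  exact fun u v => formDeriv_dForm_symm (hfe a) (mem_chart_source E a) u v

theorem SymForm.Nondeg.bijective {q : SymForm E} (h : q.Nondeg) : Function.Bijective q.toBil :=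
  bijective_iff_separating.2 h

/-- A holonomic section `t` is smooth and transverse to the critical jets of index `0`, so it is one of
the representatives by which the pairing is computed; its signed count is the number of minima. -/
theorem not_isPairing_zero_of_isHolonomic [Nonempty M] {s t : MorseSection E M}
    (hst : s.Homotopic t) (ht : t.IsHolonomic) : ¬ MorseSection.IsPairing 0 s 0 := by
  intro hp
  obtain ⟨a, ha⟩ := ht.exists_isCritical_zero
  obtain ⟨f, hf, hjet⟩ := ht
  have hfe : ∀ x, ∀ᶠ y in 𝓝 x, ContMDiffAt 𝓘(ℝ, E) 𝓘(ℝ, ℝ) ∞ f y :=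
    fun x => Filter.Eventually.of_forall hf
  have hα : ∀ x, FormSmoothAt (E := E) (dForm f) x := fun x => formSmoothAt_dForm (hfe x)
  have hfirst : (fun x => (t.jet x).first) = dForm f := by
    funext x
    rw [hjet]
    rfl
  have hsm : t.Smooth := by
    have h1 := contMDiff_jetOf hα
    have h2 : (fun x => (⟨x, t.jet x⟩ : (jetCore E M).TotalSpace)) =
        fun x => ⟨x, jetOf (dForm f) x⟩ := by
      funext x
      rw [hjet, jet2_eq_jetOf (hfe x)]
    unfold MorseSection.Smooth
    rw [h2]
    exact h1
  have hbij : ∀ a, (t.jet a).first = 0 → Function.Bijective (t.derivForm a) := fun a ha => by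
    rw [t.derivForm_eq_second hf hjet a]
    exact (t.isMorse a ha).bijective
  have hcount := hp.2 t hst hsm fun a ha => hbij a ha.1
  have hfin : {a : M | (t.jet a).first = 0 ∧ (t.jet a).second.Pos}.Finite := by
    refine (finite_zeros_form hα (A := univ) (by simp) fun a _ h0 => ?_).subset fun a ha => ?_
    · have h1 := hbij a (by rw [← h0]; exact congrFun hfirst a)
      rwa [t.derivForm_eq, hfirst] at h1
    · exact ⟨mem_univ a, (congrFun hfirst a).symm.trans ha.1⟩
  rw [signedCount_zero, finsum_mem_eq_finite_toFinset_sum _ hfin,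
    Finset.sum_congr rfl (g := fun _ => (1 : ℤ)) fun b hb => ?_, Finset.sum_const, nsmul_one,
    Nat.cast_eq_zero, Finset.card_eq_zero] at hcount
  · have h1 : a ∈ hfin.toFinset := hfin.mem_toFinset.2 (isCritical_zero_iff.1 ha)
    rw [hcount] at h1
    exact absurd h1 (Finset.notMem_empty a)
  · rw [← t.derivForm_eq, t.derivForm_eq_second hf hjet b, (hfin.mem_toFinset.1 hb).2.bilSign_eq_one]
    rfl

end Holonomic

/-! ### Linearization of a `1`-form at a zero -/

section Modify

/-- A `1`-form can be modified arbitrarily in a compact subset of the domain of a chart. -/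
theorem exists_form_of_locForm [T2Space M] {α : M → E →L[ℝ] ℝ} (hα : ∀ x, FormSmoothAt α x)
    {c : M} {K : Set E} (hK : IsCompact K) (hKt : K ⊆ (chartAt E c).target)
    {l : E → E →L[ℝ] ℝ} (hl : ContDiffOn ℝ ∞ l (chartAt E c).target)
    (hle : ∀ y ∈ (chartAt E c).target, y ∉ K → l y = locForm α c y) :
    ∃ α' : M → E →L[ℝ] ℝ, (∀ x, FormSmoothAt α' x) ∧
      (∀ x ∉ (chartAt E c).symm '' K, α' x = α x) ∧
      ∀ y ∈ (chartAt E c).target, locForm α' c y = l y := by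
  classical
  set α' : M → E →L[ℝ] ℝ := fun x => if x ∈ (chartAt E c).source then
    (l (chartAt E c x)).comp (transitionDeriv (achart E c) (achart E x) x) else α x with hα'
  have hloc : ∀ y ∈ (chartAt E c).target, locForm α' c y = l y := by
    intro y hy
    have hx := (chartAt E c).map_target hy
    have h1 := locForm_apply α' hx
    rw [(chartAt E c).right_inv hy] at h1
    rw [h1, hα']
    simp only [if_pos hx]
    rw [ContinuousLinearMap.comp_assoc, transitionDeriv_comp_symm _ _ hx (mem_chart_source E _),
      (chartAt E c).right_inv hy]
    rfl
  have hoff : ∀ x ∉ (chartAt E c).symm '' K, α' x = α x := by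
    intro x hx
    by_cases hxs : x ∈ (chartAt E c).source
    · have h1 : chartAt E c x ∉ K := fun h => hx ⟨_, h, (chartAt E c).left_inv hxs⟩
      have h2 := hle _ ((chartAt E c).map_source hxs) h1
      rw [hα']
      simp only [if_pos hxs]
      rw [h2, locForm_apply α hxs, ContinuousLinearMap.comp_assoc,
        transitionDeriv_comp_symm _ _ (mem_chart_source E x) hxs]
      rfl
    · exact if_neg hxs
  refine ⟨α', fun x => ?_, hoff, hloc⟩
  by_cases hxs : x ∈ (chartAt E c).source
  · rw [formSmoothAt_iff hxs]
    have ht := (chartAt E c).open_target.mem_nhds ((chartAt E c).map_source hxs)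
    refine (hl.contDiffAt ht).congr_of_eventuallyEq ?_
    filter_upwards [ht] with y hy
    exact hloc y hy
  · have hKc : IsClosed ((chartAt E c).symm '' K) :=
      (hK.image_of_continuousOn ((chartAt E c).continuousOn_symm.mono hKt)).isClosed
    refine (hα x).congr ?_
    filter_upwards [hKc.isOpen_compl.mem_nhds (by
      rintro ⟨y, hy, rfl⟩
      exact hxs ((chartAt E c).map_target (hKt hy)))] with z hz
    exact hoff z hz

/-- The segment between two bilinear forms consists of nondegenerate forms. -/
def NondegSegment (B B' : Bil E) : Prop :=
  ∀ t ∈ Icc (0 : ℝ) 1, Function.Bijective (B + t • (B' - B) : Bil E)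

/-- By compactness, the forms of a nondegenerate segment are uniformly injective. -/
theorem NondegSegment.exists_lower_bound {B B' : Bil E} (h : NondegSegment B B') :
    ∃ c > 0, ∀ t ∈ Icc (0 : ℝ) 1, ∀ v, c * ‖v‖ ≤ ‖B v + t • (B' v - B v)‖ := by
  have hcont : Continuous fun z : ℝ × E => ‖B z.2 + z.1 • (B' z.2 - B z.2)‖ := by
    fun_prop
  obtain ⟨c, hc, hcb⟩ := ((isCompact_Icc (a := (0 : ℝ)) (b := 1)).prod
    (isCompact_sphere (0 : E) 1)).exists_forall_le' hcont.continuousOn (a := 0) (by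
      rintro ⟨t, v⟩ ⟨ht, hv⟩
      rw [norm_pos_iff]
      intro h0
      have h1 : v = 0 := (h t ht).1 (by
        rw [map_zero]
        exact h0)
      rw [h1] at hv
      simp at hv)
  refine ⟨c, hc, fun t ht v => ?_⟩
  by_cases hv : v = 0
  · simp [hv]
  · have hn : 0 < ‖v‖ := norm_pos_iff.2 hv
    have h1 := hcb (t, ‖v‖⁻¹ • v) ⟨ht, by simp [norm_smul, hn.ne']⟩
    have h2 : B (‖v‖⁻¹ • v) + t • (B' (‖v‖⁻¹ • v) - B (‖v‖⁻¹ • v)) =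
        ‖v‖⁻¹ • (B v + t • (B' v - B v)) := by
      simp only [map_smul]
      module
    simp only [h2] at h1
    rw [norm_smul, norm_inv, norm_norm, ← div_eq_inv_mul, le_div_iff₀ hn] at h1
    exact h1

/-- Near a nondegenerate zero, a `1`-form can be deformed so that it becomes linear in the chart
with a derivative which is joined to the original one by a segment of nondegenerate forms. No
zeros are created. -/
theorem exists_form_linear_of_segment [T2Space M] {α : M → E →L[ℝ] ℝ}
    (hα : ∀ x, FormSmoothAt α x) {a : M} (h0 : α a = 0) {B' : Bil E}
    (hseg : NondegSegment (formDeriv α a a) B') :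
    ∃ α' : M → E →L[ℝ] ℝ, (∀ x, FormSmoothAt α' x) ∧ (∀ x, α' x = 0 ↔ α x = 0) ∧
      (∀ x, x ≠ a → α x = 0 → α' =ᶠ[𝓝 x] α) ∧
      locForm α' a =ᶠ[𝓝 (chartAt E a a)] fun y => B' (y - chartAt E a a) := by
  obtain ⟨c, hc, hcb⟩ := hseg.exists_lower_bound
  set φ := chartAt E a with hφ
  set y₀ := φ a with hy₀
  set B := formDeriv α a a with hB
  have hy₀t : y₀ ∈ φ.target := φ.map_source (mem_chart_source E a)
  have hl0 : locForm α a y₀ = 0 := (locForm_eq_zero_iff α (mem_chart_source E a)).2 h0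
  have hder : HasFDerivAt (locForm α a) B y₀ :=
    (ContDiffAt.differentiableAt (hα a) (by simp)).hasFDerivAt
  have hsmall : ∀ᶠ y in 𝓝 y₀, ‖locForm α a y - B (y - y₀)‖ ≤ c / 2 * ‖y - y₀‖ := by
    have := (hasFDerivAt_iff_isLittleO.1 hder).def (half_pos hc)
    simpa only [hl0, sub_zero] using this
  obtain ⟨r, hr, hball⟩ := Metric.nhds_basis_closedBall.mem_iff.1
    (Filter.inter_mem (φ.open_target.mem_nhds hy₀t) hsmall)
  let b : ContDiffBump y₀ := ⟨r / 2, r, half_pos hr, half_lt_self hr⟩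
  set l : E → E →L[ℝ] ℝ := fun y => (B (y - y₀) + b y • (B' (y - y₀) - B (y - y₀))) +
    (1 - b y) • (locForm α a y - B (y - y₀)) with hl
  have hb : ContDiff ℝ ∞ b := b.contDiff
  have hlin : ∀ D : Bil E, ContDiff ℝ ∞ fun y => D (y - y₀) := fun D =>
    D.contDiff.comp (contDiff_id.sub contDiff_const)
  have hls : ContDiffOn ℝ ∞ l φ.target :=
    (((hlin B).add (hb.smul ((hlin B').sub (hlin B)))).contDiffOn).add
      ((contDiff_const.sub hb).contDiffOn.smul
        ((FormSmoothAt.contDiffOn hα a).sub (hlin B).contDiffOn))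
  have hloff : ∀ y ∈ φ.target, y ∉ Metric.closedBall y₀ r → l y = locForm α a y := by
    intro y _ hy
    have hb0 : b y = 0 := b.zero_of_le_dist (by
      rw [Metric.mem_closedBall, not_le] at hy
      exact hy.le)
    simp [hl, hb0]
  have hne : ∀ y ∈ Metric.closedBall y₀ r, y ≠ y₀ → l y ≠ 0 ∧ locForm α a y ≠ 0 := by
    intro y hy hyne
    have hpos : 0 < ‖y - y₀‖ := norm_pos_iff.2 (sub_ne_zero.2 hyne)
    have hsm : ‖locForm α a y - B (y - y₀)‖ ≤ c / 2 * ‖y - y₀‖ := (hball hy).2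
    have hcp : 0 < c * ‖y - y₀‖ := mul_pos hc hpos
    refine ⟨fun h => ?_, fun h => ?_⟩
    · have h1 := hcb (b y) ⟨b.nonneg, b.le_one⟩ (y - y₀)
      rw [eq_neg_of_add_eq_zero_left h, norm_neg, norm_smul,
        Real.norm_of_nonneg (sub_nonneg.2 b.le_one)] at h1
      have h2 : (1 - b y) * ‖locForm α a y - B (y - y₀)‖ ≤ ‖locForm α a y - B (y - y₀)‖ :=
        mul_le_of_le_one_left (norm_nonneg _) (by linarith [b.nonneg (x := y)])
      linarith
    · have h1 := hcb 0 (by simp) (y - y₀)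
      rw [h, zero_sub, norm_neg] at hsm
      rw [zero_smul, add_zero] at h1
      linarith
  have hl0' : l y₀ = 0 := by simp [hl, hl0]
  have hKt : Metric.closedBall y₀ r ⊆ φ.target := fun y hy => (hball hy).1
  obtain ⟨α', hα', hoff, hloc⟩ := exists_form_of_locForm hα
    (isCompact_closedBall y₀ r) hKt hls hloff
  have hKc : IsClosed (φ.symm '' Metric.closedBall y₀ r) :=
    ((isCompact_closedBall y₀ r).image_of_continuousOn (φ.continuousOn_symm.mono hKt)).isClosed
  refine ⟨α', hα', fun x => ?_, fun x hxa hx0 => ?_, ?_⟩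
  · by_cases hx : x ∈ φ.symm '' Metric.closedBall y₀ r
    · obtain ⟨y, hy, rfl⟩ := hx
      have hys := φ.map_target (hKt hy)
      rw [← locForm_eq_zero_iff α' hys, ← locForm_eq_zero_iff α hys]
      rw [← hφ, φ.right_inv (hKt hy), hloc y (hKt hy)]
      by_cases hyy : y = y₀
      · rw [hyy, hl0', hl0]
      · exact iff_of_false (hne y hy hyy).1 (hne y hy hyy).2
    · rw [hoff x hx]
  · have hx : x ∉ φ.symm '' Metric.closedBall y₀ r := by
      rintro ⟨y, hy, rfl⟩
      have hys := φ.map_target (hKt hy)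
      rw [← locForm_eq_zero_iff α hys, ← hφ, φ.right_inv (hKt hy)] at hx0
      refine hxa ?_
      by_contra hne'
      refine (hne y hy fun h => hne' ?_).2 hx0
      rw [h, hy₀, φ.left_inv (mem_chart_source E a)]
    filter_upwards [hKc.isOpen_compl.mem_nhds hx] with z hz
    exact hoff z hz
  · filter_upwards [φ.open_target.mem_nhds hy₀t, b.eventuallyEq_one] with y hy hby
    have hby1 : b y = 1 := hby
    rw [hloc y hy]
    simp [hl, hby1]

theorem formDeriv_eq_of_linear {α : M → E →L[ℝ] ℝ} {a : M} {B : Bil E}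
    (h : locForm α a =ᶠ[𝓝 (chartAt E a a)] fun y => B (y - chartAt E a a)) :
    formDeriv α a a = B := by
  unfold formDeriv
  rw [h.fderiv_eq]
  exact (B.hasFDerivAt.comp (chartAt E a a)
    ((hasFDerivAt_id (chartAt E a a)).sub_const (chartAt E a a))).fderiv

/-- Near a nondegenerate zero, a `1`-form can be deformed so that it becomes linear in the chart with
a derivative joined to the original one by a broken line of nondegenerate forms. -/
theorem exists_form_linear_of_reflTransGen [T2Space M] {α : M → E →L[ℝ] ℝ}
    (hα : ∀ x, FormSmoothAt α x) {a : M} (h0 : α a = 0)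
    (hn : Function.Bijective (formDeriv α a a)) {B' : Bil E}
    (hseg : Relation.ReflTransGen NondegSegment (formDeriv α a a) B') :
    ∃ α' : M → E →L[ℝ] ℝ, (∀ x, FormSmoothAt α' x) ∧ (∀ x, α' x = 0 ↔ α x = 0) ∧
      (∀ x, x ≠ a → α x = 0 → α' =ᶠ[𝓝 x] α) ∧
      locForm α' a =ᶠ[𝓝 (chartAt E a a)] fun y => B' (y - chartAt E a a) := by
  induction hseg with
  | refl =>
    refine exists_form_linear_of_segment hα h0 fun t _ => ?_
    have e : formDeriv α a a + t • (formDeriv α a a - formDeriv α a a) = formDeriv α a a := by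
      ext u v
      change formDeriv α a a u v + t * (formDeriv α a a u v - formDeriv α a a u v) = _
      ring
    rw [e]
    exact hn
  | tail _ hseg ih =>
    obtain ⟨β, hβ, hz, hβα, hlin⟩ := ih
    rw [← formDeriv_eq_of_linear hlin] at hseg
    obtain ⟨γ, hγ, hz', hγβ, hlin'⟩ := exists_form_linear_of_segment hβ ((hz a).2 h0) hseg
    exact ⟨γ, hγ, fun x => (hz' x).trans (hz x), fun x hxa hx0 =>
      (hγβ x hxa ((hz x).2 hx0)).trans (hβα x hxa hx0), hlin'⟩

end Modify

/-! ### Paths of nondegenerate bilinear forms -/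

section Rotation

variable {ι : Type*} [Fintype ι] [DecidableEq ι]

/-- The coordinate functions given by a linear isomorphism `E ≃ ℝ^ι`. -/
def coordL (e : E ≃L[ℝ] (ι → ℝ)) (i : ι) : E →L[ℝ] ℝ :=
  (ContinuousLinearMap.proj i).comp (e : E →L[ℝ] (ι → ℝ))

theorem coordL_apply (e : E ≃L[ℝ] (ι → ℝ)) (i : ι) (u : E) : coordL e i u = e u i := by
  rfl

/-- The coordinates of the image of a vector by the linear map which is `(x, y) ↦ (c x - s y,
s x + c y)` on the plane of the coordinates `p`, `q`, and which preserves the other coordinates. -/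
def rotCoord (e : E ≃L[ℝ] (ι → ℝ)) (p q : ι) (c s : ℝ) (i : ι) : E →L[ℝ] ℝ :=
  if i = p then c • coordL e p - s • coordL e q
  else if i = q then c • coordL e q + s • coordL e p else coordL e i

/-- The bilinear form `∑ wᵢ xᵢ yᵢ` composed, in the first variable, with the linear map of
`rotCoord`. -/
def rotBil (e : E ≃L[ℝ] (ι → ℝ)) (w : ι → ℝ) (p q : ι) (c s : ℝ) : Bil E :=
  ∑ i, w i • (rotCoord e p q c s i).smulRight (coordL e i)

theorem rotBil_apply (e : E ≃L[ℝ] (ι → ℝ)) (w : ι → ℝ) (p q : ι) (c s : ℝ) (u v : E) :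
    rotBil e w p q c s u v = ∑ i, w i * (rotCoord e p q c s i u * e v i) := by
  simp [rotBil, coordL_apply]

/-- The diagonal quadratic form `∑ wᵢ xᵢ²`. -/
def diagForm (e : E ≃L[ℝ] (ι → ℝ)) (w : ι → ℝ) : SymForm E :=
  (⟨∑ i, w i • (coordL e i).smulRight (coordL e i), fun u v => by
    simp only [sum_apply, smul_apply, ContinuousLinearMap.smulRight_apply, smul_eq_mul]
    exact Finset.sum_congr rfl fun i _ => by ring⟩ : SymBil E)

theorem diagForm_apply (e : E ≃L[ℝ] (ι → ℝ)) (w : ι → ℝ) (u v : E) :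
    (diagForm e w).toBil u v = ∑ i, w i * (e u i * e v i) := by
  change (∑ i, w i • (coordL e i).smulRight (coordL e i) : Bil E) u v = _
  simp [coordL_apply]

theorem index_diagForm (e : E ≃L[ℝ] (ι → ℝ)) (w : ι → ℝ) :
    (diagForm e w).index = {i | w i < 0}.ncard := by
  refine QuadraticForm.sigNeg_of_equiv_weightedSumSquares ⟨⟨e.toLinearEquiv, fun u => ?_⟩⟩
  rw [QuadraticMap.weightedSumSquares_apply, SymForm.toQuadraticMap_apply, diagForm_apply]
  rfl

theorem rotBil_bijective (e : E ≃L[ℝ] (ι → ℝ)) {w : ι → ℝ} (hw : ∀ i, w i ≠ 0) {p q : ι}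
    (hpq : p ≠ q) {c s : ℝ} (hcs : c ^ 2 + s ^ 2 ≠ 0) :
    Function.Bijective (rotBil e w p q c s) := by
  refine bijective_iff_separating.2 fun u hu => ?_
  have h1 : ∀ i, rotCoord e p q c s i u = 0 := by
    intro i
    have := hu (e.symm (Pi.single i 1))
    rw [rotBil_apply, Finset.sum_eq_single i (fun j _ hj => by simp [hj]) (by simp)] at this
    simpa [hw i] using this
  have hp : c * e u p - s * e u q = 0 := by
    have := h1 p
    rwa [rotCoord, if_pos rfl] at this
  have hq : c * e u q + s * e u p = 0 := by
    have := h1 q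
    rwa [rotCoord, if_neg hpq.symm, if_pos rfl] at this
  have hp0 : e u p = 0 :=
    (mul_eq_zero.1 (by linear_combination c * hp + s * hq :
      (c ^ 2 + s ^ 2) * e u p = 0)).resolve_left hcs
  have hq0 : e u q = 0 :=
    (mul_eq_zero.1 (by linear_combination c * hq - s * hp :
      (c ^ 2 + s ^ 2) * e u q = 0)).resolve_left hcs
  refine e.injective ?_
  rw [map_zero]
  funext i
  by_cases hip : i = p
  · rw [hip, hp0]
    rfl
  by_cases hiq : i = q
  · rw [hiq, hq0]
    rfl
  have := h1 i
  rwa [rotCoord, if_neg hip, if_neg hiq] at this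

theorem nondegSegment_rotBil (e : E ≃L[ℝ] (ι → ℝ)) {w : ι → ℝ} (hw : ∀ i, w i ≠ 0) {p q : ι}
    (hpq : p ≠ q) {c s c' s' : ℝ}
    (h : ∀ t ∈ Icc (0 : ℝ) 1, (c + t * (c' - c)) ^ 2 + (s + t * (s' - s)) ^ 2 ≠ 0) :
    NondegSegment (rotBil e w p q c s) (rotBil e w p q c' s') := by
  intro t ht
  have : rotBil e w p q c s + t • (rotBil e w p q c' s' - rotBil e w p q c s) =
      rotBil e w p q (c + t * (c' - c)) (s + t * (s' - s)) := by
    ext u v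
    change rotBil e w p q c s u v + t * (rotBil e w p q c' s' u v - rotBil e w p q c s u v) = _
    simp only [rotBil_apply]
    rw [← Finset.sum_sub_distrib, Finset.mul_sum, ← Finset.sum_add_distrib]
    refine Finset.sum_congr rfl fun i _ => ?_
    unfold rotCoord
    split_ifs
    · change w i * ((c * e u p - s * e u q) * e v i) + t * (w i * ((c' * e u p - s' * e u q) *
        e v i) - w i * ((c * e u p - s * e u q) * e v i)) = w i * (((c + t * (c' - c)) * e u p -
        (s + t * (s' - s)) * e u q) * e v i)
      ring
    · change w i * ((c * e u q + s * e u p) * e v i) + t * (w i * ((c' * e u q + s' * e u p) *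
        e v i) - w i * ((c * e u q + s * e u p) * e v i)) = w i * (((c + t * (c' - c)) * e u q +
        (s + t * (s' - s)) * e u p) * e v i)
      ring
    · ring
  rw [this]
  exact rotBil_bijective e hw hpq (h t ht)

/-- The signs of two coordinates of a diagonal form can be changed by a rotation of the plane of
these coordinates, which is a path made of two segments. -/
theorem reflTransGen_flip (e : E ≃L[ℝ] (ι → ℝ)) {w : ι → ℝ} (hw : ∀ i, w i ≠ 0) {p q : ι}
    (hpq : p ≠ q) : Relation.ReflTransGen NondegSegment (diagForm e w).toBil
      (diagForm e fun i => if i = p ∨ i = q then -w i else w i).toBil := by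
  have h1 : (diagForm e w).toBil = rotBil e w p q 1 0 := by
    ext u v
    rw [diagForm_apply, rotBil_apply]
    refine Finset.sum_congr rfl fun i _ => ?_
    unfold rotCoord
    split_ifs with hp hq
    · simp [coordL_apply, hp]
    · simp [coordL_apply, hq]
    · rfl
  have h2 : (diagForm e fun i => if i = p ∨ i = q then -w i else w i).toBil =
      rotBil e w p q (-1) 0 := by
    ext u v
    rw [diagForm_apply, rotBil_apply]
    refine Finset.sum_congr rfl fun i _ => ?_
    unfold rotCoord
    by_cases hp : i = p
    · simp [coordL_apply, hp]
    by_cases hq : i = q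
    · simp [coordL_apply, hq, hpq.symm]
    simp [coordL_apply, hp, hq]
  rw [h1, h2]
  refine (Relation.ReflTransGen.single (nondegSegment_rotBil e hw hpq (c' := 0) (s' := 1)
    fun t ht => ?_)).tail (nondegSegment_rotBil e hw hpq fun t ht => ?_)
  · nlinarith [sq_nonneg (2 * t - 1)]
  · nlinarith [sq_nonneg (2 * t - 1)]

theorem nondeg_diagForm (e : E ≃L[ℝ] (ι → ℝ)) {w : ι → ℝ} (hw : ∀ i, w i ≠ 0) :
    (diagForm e w).Nondeg := by
  intro u hu
  refine e.injective ?_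
  rw [map_zero]
  funext i
  have := hu (e.symm (Pi.single i 1))
  rw [diagForm_apply, Finset.sum_eq_single i (fun j _ hj => by simp [hj]) (by simp)] at this
  simpa [hw i] using this

/-- In dimension at least two, a nondegenerate diagonal form can be joined to a diagonal form of
index `1` or `2` among nondegenerate bilinear forms: the parity of the index is the only
obstruction. -/
theorem exists_reflTransGen_diagForm (hι : 1 < Fintype.card ι) (e : E ≃L[ℝ] (ι → ℝ)) (k : ℕ) :
    ∀ w : ι → ℝ, (∀ i, w i ≠ 0) → {i | w i < 0}.ncard = k →
      ∃ Q : SymForm E, Q.Nondeg ∧ (Q.index = 1 ∨ Q.index = 2) ∧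
        Relation.ReflTransGen NondegSegment (diagForm e w).toBil Q.toBil := by
  induction k using Nat.strong_induction_on with
  | _ k ih =>
    intro w hw hk
    have hflip : ∀ {p q : ι}, ∀ i, (if i = p ∨ i = q then -w i else w i) ≠ 0 := fun i => by
      split_ifs
      · exact neg_ne_zero.2 (hw i)
      · exact hw i
    rcases Nat.lt_or_ge k 3 with hk3 | hk3
    · rcases Nat.eq_zero_or_pos k with h0 | h0
      · obtain ⟨p, q, hpq⟩ := Fintype.exists_pair_of_one_lt_card hι
        refine ⟨_, nondeg_diagForm e hflip, Or.inr ?_, reflTransGen_flip e hw hpq⟩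
        rw [index_diagForm, ← Set.ncard_pair hpq]
        congr 1
        rw [h0, Set.ncard_eq_zero] at hk
        have hpos : ∀ i, ¬ w i < 0 := fun i hi => (Set.ext_iff.1 hk i).1 hi
        ext i
        simp only [mem_ofPred_eq, mem_insert_iff, mem_singleton_iff]
        split_ifs with h
        · exact iff_of_true (neg_lt_zero.2 (lt_of_le_of_ne (not_lt.1 (hpos i)) (hw i).symm)) h
        · exact iff_of_false (hpos i) h
      · refine ⟨_, nondeg_diagForm e hw, ?_, .refl⟩
        rw [index_diagForm, hk]
        omega
    · obtain ⟨p, hp, q, hq, hpq⟩ := (Set.one_lt_ncard (s := {i | w i < 0})).1 (by omega)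
      have hset : {i | (if i = p ∨ i = q then -w i else w i) < 0} =
          {i | w i < 0} \ {p, q} := by
        ext i
        simp only [mem_ofPred_eq, mem_sdiff, mem_insert_iff, mem_singleton_iff]
        split_ifs with h
        · have : w i < 0 := by
            rcases h with rfl | rfl
            · exact hp
            · exact hq
          refine iff_of_false (by linarith) fun h' => h'.2 h
        · exact ⟨fun h' => ⟨h', h⟩, fun h' => h'.1⟩
      have hcard : {i | (if i = p ∨ i = q then -w i else w i) < 0}.ncard = k - 2 := by
        rw [hset, Set.ncard_sdiff (by
          rintro i (rfl | rfl)
          · exact hp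
          · exact hq), Set.ncard_pair hpq, hk]
      obtain ⟨Q, hQ, hQi, hQr⟩ := ih (k - 2) (by omega) _ hflip hcard
      exact ⟨Q, hQ, hQi, (reflTransGen_flip e hw hpq).trans hQr⟩

/-- A nondegenerate symmetric form is diagonal in an orthogonal basis, so it can be joined to a form
of index `1` or `2` through nondegenerate bilinear forms. -/
theorem exists_reflTransGen_of_symm (hE : 2 ≤ Module.finrank ℝ E) {q : SymForm E}
    (hq : q.Nondeg) : ∃ Q : SymForm E, Q.Nondeg ∧ (Q.index = 1 ∨ Q.index = 2) ∧
      Relation.ReflTransGen NondegSegment q.toBil Q.toBil := by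
  have _ : Invertible (2 : ℝ) := invertibleOfNonzero two_ne_zero
  obtain ⟨b, hb⟩ := LinearMap.BilinForm.exists_orthogonal_basis (B := q.toBil.toBilinForm)
    ⟨fun u v => q.symm u v⟩
  have hb' : ∀ i j, i ≠ j → q.toBil (b i) (b j) = 0 := fun i j hij => hb hij
  have hsum : ∀ u, u = ∑ i, b.equivFunL u i • b i := fun u => (b.sum_equivFun u).symm
  have he : ∀ u v, q.toBil u v =
      ∑ i, q.toBil (b i) (b i) * (b.equivFunL u i * b.equivFunL v i) := by
    intro u v
    conv_lhs => rw [hsum u, hsum v]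
    simp only [map_sum, map_smul, sum_apply, smul_apply, smul_eq_mul]
    refine Finset.sum_congr rfl fun i _ => ?_
    rw [Finset.sum_eq_single i (fun j _ hj => by rw [hb' _ _ hj]; ring) (by simp)]
    ring
  have hq' : q = diagForm b.equivFunL fun i => q.toBil (b i) (b i) :=
    SymForm.ext fun u v => by rw [diagForm_apply, he]
  have hw : ∀ i, q.toBil (b i) (b i) ≠ 0 := by
    intro i h0
    refine b.ne_zero i (hq (b i) fun v => ?_)
    rw [hsum v, map_sum]
    refine Finset.sum_eq_zero fun j _ => ?_
    rw [map_smul]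
    by_cases hij : i = j
    · rw [← hij, h0, smul_zero]
    · rw [hb' i j hij, smul_zero]
  obtain ⟨Q, hQ, hQi, hQr⟩ := exists_reflTransGen_diagForm (by rw [Fintype.card_fin]; omega)
    b.equivFunL _ _ hw rfl
  rw [← hq'] at hQr
  exact ⟨Q, hQ, hQi, hQr⟩

end Rotation

/-! ### `1`-forms with zeros of index `1` or `2` -/

section Existence

/-- Near the zero `a`, the `1`-form `α` is, in the chart at `a`, the differential of a
nondegenerate quadratic form of index `1` or `2`. -/
def IsModelAt (α : M → E →L[ℝ] ℝ) (a : M) : Prop :=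
  ∃ Q : SymForm E, Q.Nondeg ∧ (Q.index = 1 ∨ Q.index = 2) ∧
    locForm α a =ᶠ[𝓝 (chartAt E a a)] fun y => Q.toBil (y - chartAt E a a)

variable [T2Space M] [CompactSpace M]

theorem formSmoothAt_zero (x : M) : FormSmoothAt (fun _ : M => (0 : E →L[ℝ] ℝ)) x := by
  have : locForm (fun _ : M => (0 : E →L[ℝ] ℝ)) x = fun _ => 0 := by
    funext y
    exact ContinuousLinearMap.zero_comp _
  unfold FormSmoothAt
  rw [this]
  exact contDiffAt_const

variable (E M) in
/-- The required form is a modification, near its zeros, of the differential of a generic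
combination of the generating functions. -/
theorem exists_form_isModelAt (hE : 2 ≤ Module.finrank ℝ E) :
    ∃ α : M → E →L[ℝ] ℝ, (∀ x, FormSmoothAt α x) ∧ ∀ a, α a = 0 → IsModelAt α a := by
  classical
  obtain ⟨C⟩ := exists_chartCover (E := E) (M := M)
  obtain ⟨p, hp⟩ := (C.dense_nondegOn (α := fun (_ : Unit) (_ : M) => (0 : E →L[ℝ] ℝ))
    fun _ => formSmoothAt_zero).nonempty
  have hn := hp ()
  simp only [zero_add] at hn
  have hs : ∀ x, FormSmoothAt (C.form p) x := fun x =>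
    C.formSmoothAt_form (w := fun _ => p) contMDiffAt_const
  have hfin := finite_zeros_form hs (A := univ) (by simp) hn
  -- the derivative at a zero of the differential of a function is symmetric
  have hsymm : ∀ x, C.form p x = 0 → ∃ q : SymForm E, q.toBil = formDeriv (C.form p) x x := by
    intro x _
    refine ⟨symmetrize E (formDeriv (C.form p) x x), symmetrize_coe _ fun u v => ?_⟩
    have h1 : formDeriv (C.form p) x x = ∑ k, p k • formDeriv (dForm (C.genFun k)) x x := by
      have h2 : HasFDerivAt (fun y => ∑ k, p k • locForm (dForm (C.genFun k)) x y)
          (∑ k, p k • formDeriv (dForm (C.genFun k)) x x) (chartAt E x x) :=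
        HasFDerivAt.fun_sum fun k _ => ((ContDiffAt.differentiableAt
          (C.formSmoothAt_dForm_genFun k x) (by simp)).hasFDerivAt.const_smul (p k))
      rw [← h2.fderiv]
      unfold formDeriv
      congr 1
      funext y
      exact C.locForm_form (fun _ => p) x y
    rw [h1]
    simp only [sum_apply, smul_apply]
    exact Finset.sum_congr rfl fun k _ => by
      rw [formDeriv_dForm_symm (C.contMDiffAt_genFun k x) (mem_chart_source E x) u v]
  -- the zeros are modified one after the other
  have key : ∀ S : Finset M, (∀ a ∈ S, C.form p a = 0) →
      ∃ α : M → E →L[ℝ] ℝ, (∀ x, FormSmoothAt α x) ∧ (∀ x, α x = 0 ↔ C.form p x = 0) ∧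
        (∀ a ∉ S, C.form p a = 0 → α =ᶠ[𝓝 a] C.form p) ∧ ∀ a ∈ S, IsModelAt α a := by
    intro S
    induction S using Finset.induction_on with
    | empty => exact fun _ => ⟨C.form p, hs, fun _ => Iff.rfl, fun a _ _ => .rfl, by simp⟩
    | insert a S haS ih =>
      intro hS
      obtain ⟨α, hα, hz, hoff, hmod⟩ := ih fun b hb => hS b (Finset.mem_insert_of_mem hb)
      have ha0 := hS a (Finset.mem_insert_self a S)
      have hαa := hoff a haS ha0
      have hder : formDeriv α a a = formDeriv (C.form p) a a :=
        (locForm_congr (mem_chart_source E a) hαa).fderiv_eq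
      obtain ⟨q, hq⟩ := hsymm a ha0
      have hbij := hn a (mem_univ a) ha0
      obtain ⟨Q, hQ, hQi, hQr⟩ := exists_reflTransGen_of_symm hE (q := q) (by
        rw [← hq] at hbij
        exact bijective_iff_separating.1 hbij)
      rw [hq, ← hder] at hQr
      rw [← hder] at hbij
      obtain ⟨β, hβ, hzβ, hβα, hlin⟩ :=
        exists_form_linear_of_reflTransGen hα ((hz a).2 ha0) hbij hQr
      refine ⟨β, hβ, fun x => (hzβ x).trans (hz x), fun b hb hb0 => ?_, fun b hb => ?_⟩
      · rw [Finset.mem_insert, not_or] at hb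
        exact (hβα b hb.1 ((hz b).2 hb0)).trans (hoff b hb.2 hb0)
      · rcases Finset.mem_insert.1 hb with rfl | hb'
        · exact ⟨Q, hQ, hQi, hlin⟩
        · obtain ⟨Q', hQ', hQi', hlin'⟩ := hmod b hb'
          have hba : b ≠ a := by
            rintro rfl
            exact haS hb'
          exact ⟨Q', hQ', hQi', (locForm_congr (mem_chart_source E b)
            (hβα b hba ((hz b).2 (hS b hb)))).trans hlin'⟩
  obtain ⟨α, hα, hz, -, hmod⟩ := key hfin.toFinset fun a ha => ((hfin.mem_toFinset).1 ha).2
  exact ⟨α, hα, fun a ha => hmod a ((hfin.mem_toFinset).2 ⟨mem_univ a, (hz a).1 ha⟩)⟩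

end Existence

/-! ### Sections of Morse jets from `1`-forms -/

section Section

theorem locForm_injective {α β : M → E →L[ℝ] ℝ} {c x : M} (hc : x ∈ (chartAt E c).source)
    (h : locForm α c (chartAt E c x) = locForm β c (chartAt E c x)) : α x = β x := by
  rw [← locForm_self α x, ← locForm_self β x, locForm_change α (mem_chart_source E x) hc,
    locForm_change β (mem_chart_source E x) hc, h]

/-- Near a zero at which it has a model, a `1`-form is the differential of a function. -/
theorem exists_eq_jet2_of_linear {α : M → E →L[ℝ] ℝ} {a : M} {Q : SymForm E}
    (h : locForm α a =ᶠ[𝓝 (chartAt E a a)] fun y => Q.toBil (y - chartAt E a a)) :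
    ∃ (U : Set M) (f : M → ℝ), IsOpen U ∧ a ∈ U ∧ ContMDiffOn 𝓘(ℝ, E) 𝓘(ℝ, ℝ) ∞ f U ∧
      ∀ x ∈ U, jetOf α x = jet2 f x := by
  set φ := chartAt E a with hφ
  obtain ⟨T, hTl, hT, haT⟩ := eventually_nhds_iff.1 h
  set v : JetModel E := (-Q.toBil (φ a), Q) with hv
  -- up to a constant, `g y = ½ Q (y - φ a, y - φ a)`
  set g : E → ℝ := polyFun v with hg
  have hdg : ∀ y, fderiv ℝ g y = Q.toBil (y - φ a) := fun y => by
    rw [hg, fderiv_polyFun, map_sub]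
    change -Q.toBil (φ a) + Q.toBil y = _
    rw [neg_add_eq_sub]
  set U : Set M := φ.source ∩ φ ⁻¹' T with hU
  have hUo : IsOpen U := φ.isOpen_inter_preimage hT
  set f : M → ℝ := fun x => g (φ x) with hf
  have hfs : ∀ x ∈ φ.source, ContMDiffAt 𝓘(ℝ, E) 𝓘(ℝ, ℝ) ∞ f x := fun x hx =>
    ((contDiff_polyFun v).contMDiff _).comp x (contMDiffAt_of_mem_maximalAtlas
      (IsManifold.chart_mem_maximalAtlas _) hx)
  have hfe : ∀ x ∈ φ.source, ∀ᶠ z in 𝓝 x, ContMDiffAt 𝓘(ℝ, E) 𝓘(ℝ, ℝ) ∞ f z := fun x hx => by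
    filter_upwards [φ.open_source.mem_nhds hx] with z hz
    exact hfs z hz
  have hd : ∀ x ∈ U, α x = dForm f x := by
    intro x hx
    refine locForm_injective hx.1 ?_
    rw [hTl _ hx.2, locForm_dForm (hfs x hx.1) hx.1]
    refine (hdg (φ x)).symm.trans ?_
    refine (Filter.EventuallyEq.fderiv_eq ?_).symm
    filter_upwards [φ.open_target.mem_nhds (φ.map_source hx.1)] with y hy
    change g (φ (φ.symm y)) = g y
    rw [φ.right_inv hy]
  refine ⟨U, f, hUo, ⟨mem_chart_source E a, haT⟩, fun x hx => (hfs x hx.1).contMDiffWithinAt,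
    fun x hx => ?_⟩
  rw [jet2_eq_jetOf (hfe x hx.1)]
  refine jetOf_congr ?_
  filter_upwards [hUo.mem_nhds hx] with z hz
  exact hd z hz

variable [T2Space M] [CompactSpace M]

/-- The lift of such a `1`-form is a section of Morse jets without critical jets of index `0`. It is
holonomic near the zeros, but not elsewhere if `α` is not closed. -/
theorem exists_section_of_form {α : M → E →L[ℝ] ℝ} (hα : ∀ x, FormSmoothAt α x)
    (hm : ∀ a, α a = 0 → IsModelAt α a) :
    ∃ s : MorseSection E M, s.Smooth ∧
      (∀ a : M, (s.jet a).first = 0 →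
        Function.Bijective (s.derivForm a) ∧
        ((s.jet a).IsCritical 1 ∨ (s.jet a).IsCritical 2) ∧
        ∃ (U : Set M) (f : M → ℝ), IsOpen U ∧ a ∈ U ∧
          ContMDiffOn 𝓘(ℝ, E) 𝓘(ℝ, ℝ) ∞ f U ∧
          ∀ x ∈ U, s.jet x = jet2 f x) ∧
      MorseSection.IsPairing 0 s 0 := by
  have hsec : ∀ {a : M} {Q : SymForm E}, (locForm α a =ᶠ[𝓝 (chartAt E a a)]
      fun y => Q.toBil (y - chartAt E a a)) → (jetOf α a).2 = Q := by
    intro a Q hQ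
    refine SymForm.ext fun u v => ?_
    change (symmetrize E (formDeriv α a a)).toBil u v = _
    rw [formDeriv_eq_of_linear hQ, symmetrize_coe _ fun u v => Q.symm u v]
  let s : MorseSection E M :=
    { jet := jetOf α
      continuous_jet := (contMDiff_jetOf hα).continuous
      isMorse := fun a h0 => by
        obtain ⟨Q, hQ, -, hl⟩ := hm a h0
        change (jetOf α a).2.Nondeg
        rwa [hsec hl] }
  have hs : s.Smooth := contMDiff_jetOf hα
  have hcrit : ∀ a, (s.jet a).first = 0 →
      (s.jet a).IsCritical 1 ∨ (s.jet a).IsCritical 2 := by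
    intro a h0
    obtain ⟨Q, hQ, hQi, hl⟩ := hm a h0
    have h2 : (s.jet a).second = Q := hsec hl
    unfold Jet.IsCritical
    rw [h2]
    rcases hQi with h | h
    · exact Or.inl ⟨h0, hQ, h⟩
    · exact Or.inr ⟨h0, hQ, h⟩
  refine ⟨s, hs, fun a h0 => ⟨?_, hcrit a h0, ?_⟩, isPairing_zero_of_forall_not hs fun a ha => ?_⟩
  · obtain ⟨Q, hQ, -, hl⟩ := hm a h0
    rw [s.derivForm_eq]
    change Function.Bijective (formDeriv α a a)
    rw [formDeriv_eq_of_linear hl]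
    exact hQ.bijective
  · obtain ⟨Q, -, -, hl⟩ := hm a h0
    exact exists_eq_jet2_of_linear hl
  · rcases hcrit a ha.1 with h | h
    · exact absurd (ha.2.2.symm.trans h.2.2) (by norm_num)
    · exact absurd (ha.2.2.symm.trans h.2.2) (by norm_num)

end Section

/-! ### Modification of `1`-forms in dimension one -/

section OneDim

theorem covector_eq_smul (e : E ≃L[ℝ] ℝ) (ξ : E →L[ℝ] ℝ) :
    ξ = ξ (e.symm 1) • (e : E →L[ℝ] ℝ) := by
  ext u
  have h : u = e u • e.symm 1 := by
    rw [← map_smul, smul_eq_mul, mul_one, e.symm_apply_apply]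
  conv_lhs => rw [h, map_smul]
  simp [mul_comm]

/-- In dimension one, a `1`-form can be replaced over an interval of a chart by any `1`-form which
has the same signs at the ends, up to a modification near these ends which creates no zeros. -/
theorem exists_form_replace [T2Space M] (e : E ≃L[ℝ] ℝ) {α : M → E →L[ℝ] ℝ}
    (hα : ∀ x, FormSmoothAt α x) {c : M} {t₀ R : ℝ} (hR : 0 < R)
    (hK : e ⁻¹' Metric.closedBall t₀ R ⊆ (chartAt E c).target) {m : ℝ → ℝ} (hm : ContDiff ℝ ∞ m)
    (hl : 0 < m (t₀ - R) * locForm α c (e.symm (t₀ - R)) (e.symm 1))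
    (hr : 0 < m (t₀ + R) * locForm α c (e.symm (t₀ + R)) (e.symm 1)) :
    ∃ α' : M → E →L[ℝ] ℝ, (∀ x, FormSmoothAt α' x) ∧
      (∀ x ∉ (chartAt E c).symm '' (e ⁻¹' Metric.closedBall t₀ R), α' =ᶠ[𝓝 x] α) ∧
      ∀ t ∈ Metric.closedBall t₀ R, (locForm α' c (e.symm t) = 0 ↔ m t = 0) ∧
        (m t = 0 → locForm α' c =ᶠ[𝓝 (e.symm t)] fun y => m (e y) • (e : E →L[ℝ] ℝ)) := by
  set φ := chartAt E c with hφ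
  set h : ℝ → ℝ := fun t => locForm α c (e.symm t) (e.symm 1) with hh
  have hlc : ∀ t ∈ Metric.closedBall t₀ R, ContinuousAt h t := by
    intro t ht
    have ht' : e.symm t ∈ φ.target := hK (by simpa using ht)
    have h1 : ContinuousAt (locForm α c) (e.symm t) :=
      ((FormSmoothAt.contDiffOn hα c).contDiffAt (φ.open_target.mem_nhds ht')).continuousAt
    have h2 : ContinuousAt (fun t => locForm α c (e.symm t)) t :=
      ContinuousAt.comp (g := locForm α c) h1 e.symm.continuous.continuousAt
    exact h2.clm_apply continuousAt_const
  have hends : ∀ t ∈ Metric.closedBall t₀ R, 0 < m t * h t →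
      ∀ᶠ δ : ℝ in 𝓝[>] 0, ∀ z, dist z t < δ → 0 < m z * h z := by
    intro t ht hp
    obtain ⟨δ, hδ, hδb⟩ := Metric.eventually_nhds_iff.1
      ((hm.continuous.continuousAt.mul (hlc t ht)).eventually (lt_mem_nhds hp))
    filter_upwards [Ioo_mem_nhdsGT hδ] with δ' hδ' z hz
    exact hδb (hz.trans hδ'.2)
  have hlm : t₀ - R ∈ Metric.closedBall t₀ R := by
    rw [Metric.mem_closedBall, Real.dist_eq, sub_sub_cancel_left, abs_neg, abs_of_pos hR]
  have hrm : t₀ + R ∈ Metric.closedBall t₀ R := by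
    rw [Metric.mem_closedBall, Real.dist_eq, add_sub_cancel_left, abs_of_pos hR]
  obtain ⟨δ, hδl, hδr, hδ0, hδR⟩ := ((hends _ hlm hl).and ((hends _ hrm hr).and
    (Ioo_mem_nhdsGT hR))).exists
  have hδin : ∀ t ∈ Metric.closedBall t₀ R, R - δ < dist t t₀ → 0 < m t * h t := by
    intro t ht htδ
    rw [Metric.mem_closedBall] at ht
    rw [Real.dist_eq] at ht htδ
    rcases le_total 0 (t - t₀) with h0 | h0
    · rw [abs_of_nonneg h0] at ht htδ
      refine hδr t ?_
      rw [Real.dist_eq, abs_lt]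
      constructor <;> linarith
    · rw [abs_of_nonpos h0] at ht htδ
      refine hδl t ?_
      rw [Real.dist_eq, abs_lt]
      constructor <;> linarith
  let b : ContDiffBump t₀ := ⟨R - δ / 2, R, by linarith, by linarith⟩
  have hb : ContDiff ℝ ∞ b := b.contDiff
  have he : ContDiff ℝ ∞ e := e.contDiff
  have hbe : ContDiff ℝ ∞ fun y => b (e y) := hb.comp he
  set l : E → E →L[ℝ] ℝ := fun y => (b (e y) * m (e y)) • (e : E →L[ℝ] ℝ) +
    (1 - b (e y)) • locForm α c y with hldef
  have hls : ContDiffOn ℝ ∞ l φ.target :=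
    ((hbe.mul (hm.comp he)).smul contDiff_const).contDiffOn.add
      ((contDiff_const.sub hbe).contDiffOn.smul (FormSmoothAt.contDiffOn hα c))
  have hKc : IsCompact (e ⁻¹' Metric.closedBall t₀ R) :=
    e.toHomeomorph.isCompact_preimage.2 (isCompact_closedBall t₀ R)
  obtain ⟨α', hα', hoff, hloc⟩ := exists_form_of_locForm hα hKc hK hls (by
    intro y _ hy
    have hb0 : b (e y) = 0 := b.zero_of_le_dist (by
      rw [mem_preimage, Metric.mem_closedBall, not_le] at hy
      exact hy.le)
    simp [hldef, hb0])
  have hKcl : IsClosed (φ.symm '' (e ⁻¹' Metric.closedBall t₀ R)) :=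
    (hKc.image_of_continuousOn (φ.continuousOn_symm.mono hK)).isClosed
  refine ⟨α', hα', fun x hx => ?_, fun t ht => ?_⟩
  · filter_upwards [hKcl.isOpen_compl.mem_nhds hx] with z hz
    exact hoff z hz
  have htt : e.symm t ∈ φ.target := hK (by simpa using ht)
  by_cases htδ : R - δ < dist t t₀
  · have hpos := hδin t ht htδ
    have hmt : m t ≠ 0 := left_ne_zero_of_mul hpos.ne'
    refine ⟨iff_of_false (fun h0 => ?_) hmt, fun h0 => absurd h0 hmt⟩
    rw [hloc _ htt] at h0
    have h1 : b t * m t + (1 - b t) * h t = 0 := by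
      have := congrArg (fun ξ : E →L[ℝ] ℝ => ξ (e.symm 1)) h0
      simpa [hldef] using this
    -- `m t * (b m + (1 - b) h) > 0`
    have h2 : 0 < m t * m t := mul_self_pos.2 hmt
    have h3 : 0 ≤ 1 - b t := sub_nonneg.2 b.le_one
    have h4 : 0 ≤ b t := b.nonneg
    have h5 : b t * (m t * m t) + (1 - b t) * (m t * h t) = 0 := by
      linear_combination m t * h1
    rcases h4.eq_or_lt with h6 | h6
    · rw [← h6] at h5
      linarith
    · nlinarith [mul_pos h6 h2, mul_nonneg h3 hpos.le]
  · have hev : locForm α' c =ᶠ[𝓝 (e.symm t)] fun y => m (e y) • (e : E →L[ℝ] ℝ) := by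
      have h1 : ∀ᶠ y in 𝓝 (e.symm t), e y ∈ Metric.ball t₀ (R - δ / 2) := by
        refine e.continuous.continuousAt.eventually (Metric.isOpen_ball.mem_nhds ?_)
        rw [e.apply_symm_apply, Metric.mem_ball]
        linarith [not_lt.1 htδ]
      filter_upwards [h1, φ.open_target.mem_nhds htt] with y hy hyt
      have hb1 : b (e y) = 1 := b.one_of_mem_closedBall (Metric.ball_subset_closedBall hy)
      rw [hloc y hyt]
      simp [hldef, hb1]
    refine ⟨?_, fun _ => hev⟩
    rw [hev.eq_of_nhds, e.apply_symm_apply, smul_eq_zero]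
    refine or_iff_left fun h0 => ?_
    have := congrArg (fun ξ : E →L[ℝ] ℝ => ξ (e.symm 1)) h0
    simp at this

end OneDim

/-! ### Transverse `1`-forms with the fewest zeros -/

section Minimal

/-- The smooth `1`-forms which are transverse to the zero section. -/
def TransverseForm (α : M → E →L[ℝ] ℝ) : Prop := (∀ x, FormSmoothAt α x) ∧ NondegOn α univ

variable [T2Space M] [CompactSpace M]

theorem TransverseForm.finite {α : M → E →L[ℝ] ℝ} (h : TransverseForm α) :
    {x | α x = 0}.Finite := by
  have := finite_zeros_form h.1 (A := univ) (by simp) h.2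
  simpa using this

/-- If `α` has the smallest possible number of zeros, then an interval contains at most one zero
of `α`, and such a zero can be moved anywhere in the interval. -/
theorem exists_form_move (e : E ≃L[ℝ] ℝ) {α : M → E →L[ℝ] ℝ} (hα : TransverseForm α)
    (hmin : ∀ β : M → E →L[ℝ] ℝ, TransverseForm β →
      {x | α x = 0}.ncard ≤ {x | β x = 0}.ncard) {c : M} {t₀ R : ℝ} (hR : 0 < R)
    (hK : e ⁻¹' Metric.closedBall t₀ R ⊆ (chartAt E c).target)
    (hl : locForm α c (e.symm (t₀ - R)) ≠ 0) (hr : locForm α c (e.symm (t₀ + R)) ≠ 0)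
    {q : M} (hq : α q = 0) (hqK : q ∈ (chartAt E c).symm '' (e ⁻¹' Metric.closedBall t₀ R))
    {s : ℝ} (hs : s ∈ Metric.ball t₀ R) :
    (∀ x ∈ (chartAt E c).symm '' (e ⁻¹' Metric.closedBall t₀ R), α x = 0 → x = q) ∧
    ∃ β : M → E →L[ℝ] ℝ, TransverseForm β ∧
      {x | β x = 0} = insert ((chartAt E c).symm (e.symm s)) ({x | α x = 0} \ {q}) := by
  set φ := chartAt E c with hφ
  set J := φ.symm '' (e ⁻¹' Metric.closedBall t₀ R) with hJ
  set h : ℝ → ℝ := fun t => locForm α c (e.symm t) (e.symm 1) with hh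
  have hne : ∀ {t : ℝ}, locForm α c (e.symm t) ≠ 0 → h t ≠ 0 := fun {t} ht h0 => ht (by
    rw [covector_eq_smul e (locForm α c (e.symm t))]
    change h t • _ = _
    rw [h0, zero_smul])
  have hJt : ∀ x ∈ J, ∃ t ∈ Metric.closedBall t₀ R, e.symm t ∈ φ.target ∧ φ.symm (e.symm t) = x := by
    rintro _ ⟨y, hy, rfl⟩
    exact ⟨e y, hy, by rw [e.symm_apply_apply]; exact hK hy, by rw [e.symm_apply_apply]⟩
  have hzero : ∀ (β : M → E →L[ℝ] ℝ) {t : ℝ}, e.symm t ∈ φ.target →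
      (locForm β c (e.symm t) = 0 ↔ β (φ.symm (e.symm t)) = 0) := fun β t ht => by
    rw [← locForm_eq_zero_iff β (φ.map_target ht), ← hφ, φ.right_inv ht]
  -- the number of zeros outside of the interval
  have hcard : {x | α x = 0}.ncard = ({x | α x = 0} ∩ J).ncard + ({x | α x = 0} \ J).ncard :=
    (ncard_inter_add_ncard_sdiff_eq_ncard _ _ hα.finite).symm
  have hqpos : 0 < ({x | α x = 0} ∩ J).ncard :=
    (ncard_pos (hα.finite.subset inter_subset_left)).2 ⟨q, hq, hqK⟩
  have hnd : ∀ {β : M → E →L[ℝ] ℝ}, (∀ x ∉ J, β =ᶠ[𝓝 x] α) → ∀ x ∉ J, β x = 0 →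
      Function.Bijective (formDeriv β x x) := by
    intro β hβ x hx hx0
    have h1 : formDeriv β x x = formDeriv α x x :=
      (locForm_congr (mem_chart_source E x) (hβ x hx)).fderiv_eq
    rw [h1]
    exact hα.2 x (mem_univ x) ((hβ x hx).eq_of_nhds.symm.trans hx0)
  rcases lt_or_gt_of_ne (mul_ne_zero (hne hl) (hne hr)) with hneg | hpos
  · obtain ⟨hsl, hsr⟩ : t₀ - R < s ∧ s < t₀ + R := by
      rw [Metric.mem_ball, Real.dist_eq, abs_lt] at hs
      constructor <;> linarith [hs.1, hs.2]
    obtain ⟨β, hβ, hoff, hin⟩ := exists_form_replace e hα.1 hR hK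
      (m := fun t => h (t₀ - R) * (s - t)) (contDiff_const.mul (contDiff_const.sub contDiff_id))
      (by
        have := mul_pos (mul_self_pos.2 (hne hl)) (sub_pos.2 hsl)
        change 0 < h (t₀ - R) * (s - (t₀ - R)) * h (t₀ - R)
        linarith)
      (by
        have := mul_pos (neg_pos.2 hneg) (sub_pos.2 hsr)
        change 0 < h (t₀ - R) * (s - (t₀ + R)) * h (t₀ + R)
        linarith)
    have hm0 : ∀ t, h (t₀ - R) * (s - t) = 0 ↔ t = s := fun t => by
      rw [mul_eq_zero, or_iff_right (hne hl), sub_eq_zero, eq_comm]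
    have hsK : s ∈ Metric.closedBall t₀ R := Metric.ball_subset_closedBall hs
    have hst : e.symm s ∈ φ.target := hK (by simpa using hsK)
    have hsJ : φ.symm (e.symm s) ∈ J := ⟨_, by simpa using hsK, rfl⟩
    have hz : {x | β x = 0} = insert (φ.symm (e.symm s)) ({x | α x = 0} \ J) := by
      ext x
      by_cases hx : x ∈ J
      · obtain ⟨t, ht, htt, rfl⟩ := hJt x hx
        simp only [mem_ofPred_eq, mem_insert_iff, mem_sdiff, hx, not_true_eq_false, and_false,
          or_false]
        rw [← hzero β htt, (hin t ht).1, hm0]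
        refine ⟨fun h => by rw [h], fun h => ?_⟩
        have := congrArg φ h
        rw [φ.right_inv htt, φ.right_inv hst] at this
        exact e.symm.injective this
      · have hxs : x ≠ φ.symm (e.symm s) := fun h => hx (h ▸ hsJ)
        simp only [mem_ofPred_eq, mem_insert_iff, mem_sdiff, hx, not_false_eq_true, and_true,
          hxs, false_or]
        rw [(hoff x hx).eq_of_nhds]
    have hβn : NondegOn β univ := by
      intro x _ hx0
      by_cases hx : x ∈ J
      · obtain ⟨t, ht, htt, rfl⟩ := hJt x hx
        have hm := (hin t ht).1.1 ((hzero β htt).2 hx0)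
        have hev := (hin t ht).2 hm
        rw [formDeriv_bijective_change (hβ _) (mem_chart_source E _) (φ.map_target htt) hx0]
        unfold formDeriv
        rw [← hφ, φ.right_inv htt, hev.fderiv_eq]
        have h0 : HasFDerivAt (fun y : E => h (t₀ - R) * (s - e y))
            (h (t₀ - R) • (-(e : E →L[ℝ] ℝ))) (e.symm t) :=
          ((e : E →L[ℝ] ℝ).hasFDerivAt.const_sub s).const_mul (h (t₀ - R))
        have h1 := h0.smul_const (e : E →L[ℝ] ℝ)
        rw [h1.fderiv, bijective_iff_separating]
        intro u hu
        have h2 := hu (e.symm 1)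
        have h3 : h (t₀ - R) * -(e u) * e (e.symm 1) = 0 := h2
        rw [e.apply_symm_apply, mul_one, mul_eq_zero, or_iff_right (hne hl), neg_eq_zero] at h3
        exact e.injective (h3.trans (map_zero e).symm)
      · exact hnd hoff x hx hx0
    have hβcard := hmin β ⟨hβ, hβn⟩
    rw [hz, ncard_insert_of_notMem (fun h => h.2 hsJ) (hα.finite.subset sdiff_subset)] at hβcard
    have hone : ({x | α x = 0} ∩ J).ncard = 1 := by omega
    obtain ⟨z, hz1⟩ := ncard_eq_one.1 hone
    have hqz : q = z := by
      have : q ∈ {x | α x = 0} ∩ J := ⟨hq, hqK⟩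
      rw [hz1] at this
      exact this
    have huniq : ∀ x ∈ J, α x = 0 → x = q := fun x hx hx0 => by
      have : x ∈ {x | α x = 0} ∩ J := ⟨hx0, hx⟩
      rw [hz1] at this
      exact this.trans hqz.symm
    refine ⟨huniq, β, ⟨hβ, hβn⟩, ?_⟩
    rw [hz]
    congr 1
    ext x
    refine and_congr_right fun hx0 => ⟨fun h1 h2 => h1 ?_, fun h1 h2 => h1 (huniq x h2 hx0)⟩
    rw [mem_singleton_iff] at h2
    rw [h2]
    exact hqK
  · -- all the zeros in the interval could be removed
    obtain ⟨β, hβ, hoff, hin⟩ := exists_form_replace e hα.1 hR hK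
      (m := fun t => h (t₀ - R)) contDiff_const (mul_self_pos.2 (hne hl)) hpos
    have hz : {x | β x = 0} = {x | α x = 0} \ J := by
      ext x
      by_cases hx : x ∈ J
      · obtain ⟨t, ht, htt, rfl⟩ := hJt x hx
        simp only [mem_ofPred_eq, mem_sdiff, hx, not_true_eq_false, and_false, iff_false]
        rw [← hzero β htt, (hin t ht).1]
        exact hne hl
      · simp only [mem_ofPred_eq, mem_sdiff, hx, not_false_eq_true, and_true]
        rw [(hoff x hx).eq_of_nhds]
    have hβn : NondegOn β univ := fun x _ hx0 => by
      have hx : x ∈ {x | α x = 0} \ J := by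
        rw [← hz]
        exact hx0
      exact hnd hoff x hx.2 hx0
    have hβcard := hmin β ⟨hβ, hβn⟩
    rw [hz] at hβcard
    omega

end Minimal

/-! ### Nowhere vanishing `1`-forms in dimension one -/

section Nonvanishing

variable [T2Space M] [CompactSpace M]

theorem bilSign_neg_one_smul (h1 : Module.finrank ℝ E = 1) (B : Bil E) :
    bilSign ((-1 : ℝ) • B) = -bilSign B := by
  have : LinearMap.BilinForm.toMatrix (Module.finBasis ℝ E) ((-1 : ℝ) • B).toBilinForm =
      -LinearMap.BilinForm.toMatrix (Module.finBasis ℝ E) B.toBilinForm := by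
    ext i j
    simp only [LinearMap.BilinForm.toMatrix_apply, Matrix.neg_apply]
    change (-1 : ℝ) * B _ _ = -(B _ _)
    ring
  have hpow : (-1 : ℝ) ^ Module.finrank ℝ E = -1 := by rw [h1, pow_one]
  unfold bilSign
  rw [this, Matrix.det_neg, Fintype.card_fin, hpow, neg_one_mul, Left.sign_neg]

/-- In dimension one, the algebraic number of zeros of a transverse `1`-form in an open and closed
set vanishes, because it is the same for `α` and `-α`. -/
theorem zeroCount_eq_zero_of_isClopen (h1 : Module.finrank ℝ E = 1) {α : M → E →L[ℝ] ℝ}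
    (hα : TransverseForm α) {S : Set M} (hS : IsClopen S) : zeroCount α S = 0 := by
  obtain ⟨C⟩ := exists_chartCover (E := E) (M := M)
  set w : M → C.Index → ℝ := fun x => C.coeff x (jetOf α x) with hw
  have hws : ContMDiff 𝓘(ℝ, E) 𝓘(ℝ, C.Index → ℝ) ∞ w := C.contMDiff_coeff (contMDiff_jetOf hα.1)
  have hform : (fun x => C.form (w x) x) = α := by
    funext x
    rw [← C.toJet_fst, hw]
    simp only [C.toJet_coeff]
    rfl
  have hform' : (fun x => C.form ((-1 : ℝ) • w x) x) = fun x => (-1 : ℝ) • α x := by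
    funext x
    rw [C.form_smul]
    exact congrArg ((-1 : ℝ) • ·) (congrFun hform x)
  have hder : ∀ x, formDeriv (fun x => (-1 : ℝ) • α x) x x = (-1 : ℝ) • formDeriv α x x := by
    intro x
    have h2 : HasFDerivAt (fun y => (-1 : ℝ) • locForm α x y) ((-1 : ℝ) • formDeriv α x x)
        (chartAt E x x) :=
      (ContDiffAt.differentiableAt (hα.1 x) (by simp)).hasFDerivAt.const_smul (-1 : ℝ)
    rw [← h2.fderiv]
    unfold formDeriv
    congr 1
  have hzero : ∀ x, (-1 : ℝ) • α x = 0 ↔ α x = 0 := fun x => by simp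
  have hn' : NondegOn (fun x => C.form ((-1 : ℝ) • w x) x) S := by
    rw [hform']
    intro a _ ha0
    rw [hder, ← bilSign_ne_zero_iff, bilSign_neg_one_smul h1, Ne, SignType.neg_eq_zero_iff]
    exact bilSign_ne_zero_iff.2 (hα.2 a (mem_univ a) ((hzero a).1 ha0))
  have hn : NondegOn (fun x => C.form (w x) x) S := by
    rw [hform]
    exact hα.2.mono (subset_univ S)
  have hws' : ContMDiff 𝓘(ℝ, E) 𝓘(ℝ, C.Index → ℝ) ∞ fun x => (-1 : ℝ) • w x :=
    ((-1 : ℝ) • ContinuousLinearMap.id ℝ (C.Index → ℝ)).contMDiff.comp hws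
  have key := C.zeroCount_eq hws hws' hS.isOpen one_pos (by simp [hS.frontier_eq]) hn hn'
  rw [hform, hform'] at key
  have hneg : zeroCount (fun x => (-1 : ℝ) • α x) S = -zeroCount α S := by
    unfold zeroCount
    rw [← finsum_mem_neg_distrib _ (hα.finite.subset fun a ha => ha.2)]
    refine finsum_mem_congr (by simp only [hzero]) fun a _ => ?_
    rw [hder, bilSign_neg_one_smul h1]
    exact SignType.coe_neg _
  omega

variable (E M) in
/-- A closed manifold of dimension one has a nowhere vanishing `1`-form. In a transverse `1`-form
with the smallest possible number of zeros, the positions to which a given zero can be moved,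
without changing the other zeros, form an open and closed set, which contains no other zero. -/
theorem exists_form_ne_zero (h1 : Module.finrank ℝ E = 1) :
    ∃ α : M → E →L[ℝ] ℝ, (∀ x, FormSmoothAt α x) ∧ ∀ a, α a ≠ 0 := by
  obtain ⟨C⟩ := exists_chartCover (E := E) (M := M)
  have hex : ∃ α : M → E →L[ℝ] ℝ, TransverseForm α := by
    obtain ⟨p, hp⟩ := (C.dense_nondegOn (α := fun (_ : Unit) (_ : M) => (0 : E →L[ℝ] ℝ))
      fun _ => formSmoothAt_zero).nonempty
    have hn := hp ()
    simp only [zero_add] at hn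
    exact ⟨C.form p, fun x => C.formSmoothAt_form (w := fun _ => p) contMDiffAt_const, hn⟩
  obtain ⟨α, hα, hmin⟩ := (measure fun α : M → E →L[ℝ] ℝ => {x | α x = 0}.ncard).wf.has_min
    {α | TransverseForm α} hex
  have hmin' : ∀ β : M → E →L[ℝ] ℝ, TransverseForm β →
      {x | α x = 0}.ncard ≤ {x | β x = 0}.ncard := fun β hβ => not_lt.1 (hmin β hβ)
  refine ⟨α, hα.1, fun a ha => ?_⟩
  let e : E ≃L[ℝ] ℝ := ContinuousLinearEquiv.ofFinrankEq (by rw [h1, Module.finrank_self])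
  set Z : Set M := {x | α x = 0} \ {a} with hZ
  have hZfin : Z.Finite := hα.finite.subset sdiff_subset
  set S : Set M := {p | p ∉ Z ∧ ∃ β : M → E →L[ℝ] ℝ, TransverseForm β ∧
    {x | β x = 0} = insert p Z} with hS
  -- `S` is the set of the positions of the movable zero; an interval of a chart which meets `S` lies
  -- in `S`
  have hlocal : ∀ p, ∃ V ∈ 𝓝 p, (V ∩ S).Nonempty → V ⊆ S := by
    intro p
    set φ := chartAt E p with hφ
    set t₀ := e (φ p) with ht₀
    have hnhds : e.symm ⁻¹' φ.target ∈ 𝓝 t₀ := by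
      refine e.symm.continuous.continuousAt.preimage_mem_nhds ?_
      rw [ht₀, e.symm_apply_apply]
      exact φ.open_target.mem_nhds (φ.map_source (mem_chart_source E p))
    obtain ⟨ε, hε, hεt⟩ := Metric.nhds_basis_closedBall.mem_iff.1 hnhds
    -- the ends of the interval avoid the zeros of `α`
    obtain ⟨R, ⟨hR0, hRε⟩, hRZ⟩ : ∃ R ∈ Ioo (0 : ℝ) ε, R ∉ (fun z => dist (e (φ z)) t₀) '' Z :=
      ((Ioo_infinite hε).sdiff (hZfin.image _)).nonempty
    have hK : e ⁻¹' Metric.closedBall t₀ R ⊆ φ.target := by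
      intro y hy
      have := hεt (Metric.closedBall_subset_closedBall hRε.le hy)
      simpa using this
    have hV : φ.source ∩ φ ⁻¹' (e ⁻¹' Metric.ball t₀ R) ∈ 𝓝 p :=
      (φ.isOpen_inter_preimage (Metric.isOpen_ball.preimage e.continuous)).mem_nhds
        ⟨mem_chart_source E p, by simpa [ht₀] using hR0⟩
    refine ⟨_, hV, ?_⟩
    rintro ⟨q, ⟨hqs, hqb⟩, hqZ, β, hβ, hβz⟩ x ⟨hxs, hxb⟩
    have hq0 : β q = 0 := by
      have : q ∈ {x | β x = 0} := hβz ▸ mem_insert q Z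
      exact this
    have hβmin : ∀ γ : M → E →L[ℝ] ℝ, TransverseForm γ →
        {x | β x = 0}.ncard ≤ {x | γ x = 0}.ncard := by
      intro γ hγ
      refine le_trans (le_of_eq ?_) (hmin' γ hγ)
      rw [hβz, ncard_insert_of_notMem hqZ hZfin, hZ]
      exact ncard_sdiff_singleton_add_one ha hα.finite
    have hJ : ∀ z ∈ φ.source, e (φ z) ∈ Metric.closedBall t₀ R →
        z ∈ φ.symm '' (e ⁻¹' Metric.closedBall t₀ R) := fun z hz hzb =>
      ⟨φ z, hzb, φ.left_inv hz⟩
    have hend : ∀ t, dist t t₀ = R → locForm β p (e.symm t) ≠ 0 := by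
      intro t ht h0
      have htt : e.symm t ∈ φ.target := hK (by simp [ht])
      have h2 := (locForm_eq_zero_iff β (φ.map_target htt)).1 (by
        rwa [← hφ, φ.right_inv htt])
      have h3 : φ.symm (e.symm t) ∈ insert q Z := hβz ▸ h2
      have h4 : e (φ (φ.symm (e.symm t))) = t := by
        rw [φ.right_inv htt, e.apply_symm_apply]
      rcases h3 with h3 | h3
      · rw [← h3, mem_preimage, mem_preimage, h4, Metric.mem_ball, ht] at hqb
        exact lt_irrefl _ hqb
      · exact hRZ ⟨_, h3, by simp only [h4, ht]⟩
    obtain ⟨huniq, γ, hγ, hγz⟩ := exists_form_move e hβ hβmin hR0 hK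
      (hend _ (by rw [Real.dist_eq, sub_sub_cancel_left, abs_neg, abs_of_pos hR0]))
      (hend _ (by rw [Real.dist_eq, add_sub_cancel_left, abs_of_pos hR0])) hq0
      (hJ q hqs (Metric.ball_subset_closedBall hqb)) (s := e (φ x)) hxb
    refine ⟨fun hxZ => hqZ ?_, γ, hγ, ?_⟩
    · have hx0 : β x = 0 := by
        have : x ∈ {x | β x = 0} := hβz ▸ mem_insert_of_mem q hxZ
        exact this
      rw [← huniq x (hJ x hxs (Metric.ball_subset_closedBall hxb)) hx0]
      exact hxZ
    · rw [hγz, e.symm_apply_apply, ← hφ, φ.left_inv hxs, hβz, insert_sdiff_of_mem _ (mem_singleton q),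
        sdiff_singleton_eq_self hqZ]
  have hclopen : IsClopen S := by
    refine ⟨isClosed_of_closure_subset fun p hp => ?_, isOpen_iff_mem_nhds.2 fun p hp => ?_⟩
    · obtain ⟨V, hV, hVS⟩ := hlocal p
      exact hVS (mem_closure_iff_nhds.1 hp V hV) (mem_of_mem_nhds hV)
    · obtain ⟨V, hV, hVS⟩ := hlocal p
      exact Filter.mem_of_superset hV (hVS ⟨p, mem_of_mem_nhds hV, hp⟩)
  have haS : a ∈ S := ⟨fun h => h.2 rfl, α, hα, by
    rw [hZ, insert_sdiff_singleton, insert_eq_of_mem]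
    exact ha⟩
  have hcount := zeroCount_eq_zero_of_isClopen h1 hα hclopen
  have hset : {x | x ∈ S ∧ α x = 0} = {a} := by
    ext x
    refine ⟨fun hx => ?_, ?_⟩
    · by_contra hxa
      exact hx.1.1 ⟨hx.2, hxa⟩
    · rintro rfl
      exact ⟨haS, ha⟩
  unfold zeroCount at hcount
  rw [hset, finsum_mem_singleton] at hcount
  refine bilSign_ne_zero_iff.2 (hα.2 a (mem_univ a) ha) ?_
  rcases h : bilSign (formDeriv α a a) <;> rw [h] at hcount <;> simp at hcount ⊢

end Nonvanishing

end MorseJet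

end

theorem mainTheorem2 {E : Type*} [NormedAddCommGroup E] [NormedSpace ℝ E]
    [FiniteDimensional ℝ E] (hE : 1 ≤ Module.finrank ℝ E)
    {M : Type*} [TopologicalSpace M] [T2Space M] [CompactSpace M] [Nonempty M]
    [ChartedSpace E M] [IsManifold 𝓘(ℝ, E) ∞ M] :
    ¬ MorseJet.HPrinciple E M ∧
    (∃ s : MorseJet.MorseSection E M, s.Smooth ∧
      (∀ a : M, (s.jet a).first = 0 →
        Function.Bijective (s.derivForm a) ∧
        ((s.jet a).IsCritical 1 ∨ (s.jet a).IsCritical 2) ∧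
        ∃ (U : Set M) (f : M → ℝ), IsOpen U ∧ a ∈ U ∧
          ContMDiffOn 𝓘(ℝ, E) 𝓘(ℝ, ℝ) ∞ f U ∧
          ∀ x ∈ U, s.jet x = MorseJet.jet2 f x) ∧
      MorseJet.MorseSection.IsPairing 0 s 0) ∧
    (∀ s : MorseJet.MorseSection E M, MorseJet.MorseSection.IsPairing 0 s 0 →
      ¬ ∃ t : MorseJet.MorseSection E M, t.IsHolonomic ∧ s.Homotopic t) := by
  have hpair : ∃ s : MorseJet.MorseSection E M, s.Smooth ∧
      (∀ a : M, (s.jet a).first = 0 →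
        Function.Bijective (s.derivForm a) ∧
        ((s.jet a).IsCritical 1 ∨ (s.jet a).IsCritical 2) ∧
        ∃ (U : Set M) (f : M → ℝ), IsOpen U ∧ a ∈ U ∧
          ContMDiffOn 𝓘(ℝ, E) 𝓘(ℝ, ℝ) ∞ f U ∧
          ∀ x ∈ U, s.jet x = MorseJet.jet2 f x) ∧
      MorseJet.MorseSection.IsPairing 0 s 0 := by
    rcases hE.eq_or_lt with h1 | h2
    · obtain ⟨α, hα, hne⟩ := MorseJet.exists_form_ne_zero E M h1.symm
      exact MorseJet.exists_section_of_form hα fun a ha => absurd ha (hne a)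
    · obtain ⟨α, hα, hm⟩ := MorseJet.exists_form_isModelAt E M h2
      exact MorseJet.exists_section_of_form hα hm
  have hnot : ∀ s : MorseJet.MorseSection E M, MorseJet.MorseSection.IsPairing 0 s 0 →
      ¬ ∃ t : MorseJet.MorseSection E M, t.IsHolonomic ∧ s.Homotopic t := fun s hs ⟨t, ht, hst⟩ =>
    MorseJet.not_isPairing_zero_of_isHolonomic hst ht hs
  refine ⟨fun h => ?_, hpair, hnot⟩
  obtain ⟨s, -, -, hs⟩ := hpair
  exact hnot s hs (h s)
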